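/- Let $\mathcal G$ be an additive arithmetical semigroup: a commutative monoid, written additively with identity $e_{\mathcal G}$, freely generated by a finite or countable set $\mathcal P$ of primes, together with a degree map $\partial:\mathcal G\to\mathbb Z_{\ge 0}$ such that $\partial(g+h)=\partial(g)+\partial(h)$, $\partial(e_{\mathcal G})=0$, $\partial(P)>0$ for every $P\in\mathcal P$, and $\{g\in\mathcal G:\partial(g)\le x\}$ is finite for every real $x$. Suppose that $\mathcal G$ satisfies Axiom $A^{\#}$: there are constants $q>1$, $c_{\mathcal G}>0$ and $0\le\eta<1$ such that $$G^{\#}(n):=\#\{g\in\mathcal G:\partial(g)=n\}=c_{\mathcal G}\,q^{n}+O(q^{\eta n}).$$ Suppose also that $Z_{\mathcal G}(-q^{-1})\ne 0$, where $Z_{\mathcal G}(z)=\prod_{P\in\mathcal P}(1-z^{\partial(P)})^{-1}$ for $|z|<q^{-1}$ and the value at the boundary point $-q^{-1}$ is that of the analytic continuation of $Z_{\mathcal G}$. Put $\|g\|=q^{\partial(g)}$. Write $h\mid g$ if $h+r=g$ for some $r\in\mathcal G$. Let $\mu(g)=0$ if $2P\mid g$ for some prime $P$, and otherwise $\mu(g)=(-1)^k$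 with $k$ the number of primes dividing $g$. For $a:\mathcal G\to\mathbb C$ let $(\mu*a)(g)=\sum_{h\mid g}\mu(h)\,a(g-h)$, and let $\varphi(g)=\|g\|\prod_{P\mid g}(1-1/\|P\|)$, the product being over primes $P$. An element $g\ne e_{\mathcal G}$ is distinguishable if exactly one prime factor $P_{\min}(g)$ of $g$ attains the minimum degree among the prime factors of $g$. For $S\subseteq\mathcal P$ let $$\mathfrak D(\mathcal G,S)=\{g\in\mathcal G: g\text{ is distinguishable and }P_{\min}(g)\in S\}\cup\{e_{\mathcal G}\}.$$ Let $S\subseteq\mathcal P$ have natural density $\delta(S)$, that is, the limit $$\delta(S)=\lim_{n\to\infty}\frac{\#\{P\in S:\partial(P)=n\}}{\#\{P\in\mathcal P:\partial(P)=n\}}$$ exists. Let $a:\mathcal G\to\mathbb C$ satisfy $a(g)=0$ for all $g\notin\mathfrak D(\mathcal G,S)$, $a(e_{\mathcal G})=1$, and $|a(g)|\ll\|g\|^{-\alpha}$ for some $\alpha>0$. Then $$-\lim_{n\to\infty}\ \sum_{\substack{1\le\partial(g)\le n\\ g\in\mathfrak D(\mathcal G,S)}}\frac{(\mu*a)(g)}{\varphi(g)}=\delta(S).$$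 -/

import Mathlib

open Filter Topology

universe u

/-- An additive arithmetical semigroup: a commutative monoid `G`, written additively with identity
`0`, freely generated by its set of primes, with an integer-valued degree map such that the
primes have positive degree and only finitely many elements have degree at most a given bound.
(In particular the set of primes is finite or countable.) -/
structure AdditiveArithSemigroup (G : Type u) [AddCommMonoid G] where
  /-- the set of primes -/
  primes : Set G
  /-- every element is a finite sum `∑ aᵢ • Pᵢ` of primes, in exactly one way -/
  freely_generated :
    Function.Bijective (fun f : primes →₀ ℕ => f.sum fun P k => k • (P : G))
  /-- the degree map `∂`, with `∂ 0 = 0` and `∂ (g + h) = ∂ g + ∂ h` -/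
  deg : G →+ ℕ
  deg_pos : ∀ P ∈ primes, 0 < deg P
  finite_deg_le : ∀ x : ℝ, {g : G | (deg g : ℝ) ≤ x}.Finite

namespace AdditiveArithSemigroup

variable {G : Type u} [AddCommMonoid G] (A : AdditiveArithSemigroup G)

/-- `h` divides `g`: there is `r` with `h + r = g`. -/
def Divides (h g : G) : Prop := ∃ r, h + r = g

theorem finite_le (n : ℕ) : {g : G | A.deg g ≤ n}.Finite := by
  simpa using A.finite_deg_le n

/-- The finite set of elements of degree at most `n`. -/
noncomputable def elemsLE (n : ℕ) : Finset G := (A.finite_le n).toFinset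

theorem finite_primeFactors (g : G) : {P : G | P ∈ A.primes ∧ Divides P g}.Finite := by
  refine (A.finite_le (A.deg g)).subset ?_
  rintro P ⟨-, r, rfl⟩
  simp

/-- The finite set of (distinct) prime factors of `g`. -/
noncomputable def primeFactors (g : G) : Finset G := (A.finite_primeFactors g).toFinset

theorem finite_decompositions (A : AdditiveArithSemigroup G) (g : G) : {p : G × G | p.1 + p.2 = g}.Finite := by
  refine ((A.finite_le (A.deg g)).prod (A.finite_le (A.deg g))).subset ?_
  rintro ⟨h, k⟩ rfl
  simp

/-- The finite set of pairs `(h, k)` with `h + k = g`; since `G` is cancellative these are the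
pairs `(h, g - h)` with `h` dividing `g`. -/
noncomputable def decompositions (g : G) : Finset (G × G) := (A.finite_decompositions g).toFinset

/-- Dirichlet convolution `(f₁ * f₂)(g) = ∑_{h ∣ g} f₁(h) f₂(g - h)`. -/
noncomputable def conv (f₁ f₂ : G → ℂ) (g : G) : ℂ :=
  ∑ p ∈ A.decompositions g, f₁ p.1 * f₂ p.2

open Classical in
/-- The Möbius function: `0` if `2 • P` divides `g` for some prime `P`, and otherwise `(-1)^k`
with `k` the number of prime factors of `g`. -/
noncomputable def moebius (g : G) : ℂ :=
  if ∃ P ∈ A.primes, Divides (2 • P) g then 0 else (-1) ^ (A.primeFactors g).card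

/-- The norm `‖g‖ = q ^ ∂ g` with base `q`. -/
noncomputable def nrm (q : ℝ) (g : G) : ℝ := q ^ A.deg g

/-- Euler's totient function `φ(g) = ‖g‖ ∏_{P ∣ g} (1 - 1 / ‖P‖)`. -/
noncomputable def totient (q : ℝ) (g : G) : ℝ :=
  A.nrm q g * ∏ P ∈ A.primeFactors g, (1 - 1 / A.nrm q P)

/-- `G^#(n)`, the number of elements of degree `n`. -/
noncomputable def count (n : ℕ) : ℕ := {g : G | A.deg g = n}.ncard

/-- Axiom `A^#` with base `q > 1`: for some `c > 0` and `0 ≤ η < 1`,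
`G^#(n) = c q^n + O(q^{η n})`. -/
def AxiomASharp (q : ℝ) : Prop :=
  1 < q ∧ ∃ c η : ℝ, 0 < c ∧ 0 ≤ η ∧ η < 1 ∧
    (fun n : ℕ => (A.count n : ℝ) - c * q ^ n) =O[atTop] fun n : ℕ => q ^ (η * (n : ℝ))

/-- The Euler product `Z(z) = ∏_P (1 - z^{∂ P})⁻¹`. Under Axiom `A^#` with base `q` it converges
absolutely for `|z| < 1 / q`. -/
noncomputable def zeta (z : ℂ) : ℂ := ∏' P : A.primes, (1 - z ^ A.deg (P : G))⁻¹

/-- `Z(-1/q) ≠ 0`. The point `-1/q` lies on the boundary of the disc `|z| < 1/q` of convergence of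
the Euler product, so the value there is that of the analytic continuation `F` of `Z` from
the disc to a neighbourhood of the point. (Axiom `A^#` ensures that the continuation exists, and
it is unique by the identity theorem.) -/
def ZetaNeZero (q : ℝ) : Prop :=
  ∃ F : ℂ → ℂ, AnalyticAt ℂ F (-(q : ℂ)⁻¹) ∧
    F =ᶠ[𝓝[Metric.ball (0 : ℂ) q⁻¹] (-(q : ℂ)⁻¹)] A.zeta ∧ F (-(q : ℂ)⁻¹) ≠ 0

/-- The number of elements of degree `n` in a set `S` of primes. -/
noncomputable def primeCount (S : Set G) (n : ℕ) : ℕ := {P : G | P ∈ S ∧ A.deg P = n}.ncard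

/-- The set `S` of primes has natural density `δ`. -/
def HasNaturalDensity (S : Set G) (δ : ℝ) : Prop :=
  Tendsto (fun n : ℕ => (A.primeCount S n : ℝ) / (A.primeCount A.primes n : ℝ)) atTop (𝓝 δ)

/-- `P` is a prime factor of `g` of least degree among the prime factors of `g`. -/
def IsMinPrimeFactor (P g : G) : Prop :=
  P ∈ A.primeFactors g ∧ ∀ Q ∈ A.primeFactors g, A.deg P ≤ A.deg Q

/-- `g` is distinguishable: `g` is not the identity and exactly one prime factor of `g` attains
the minimum degree. -/
def Distinguishable (g : G) : Prop := g ≠ 0 ∧ ∃! P, A.IsMinPrimeFactor P g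

/-- The set `D(G, S)`: the identity, and the distinguishable elements whose prime factor of minimum
degree lies in `S`. -/
def distinguishedSet (S : Set G) : Set G :=
  {g | A.Distinguishable g ∧ ∃ P ∈ S, A.IsMinPrimeFactor P g} ∪ {0}

end AdditiveArithSemigroup

/-!
The proof has an analytic and a combinatorial half. Put `u = 1 / q`.

**Prime element theorem.** The power series `g(w) = ∑ G^#(n) (w / q)ⁿ` satisfies Chebyshev's
identity `w g' = Λ g`, where `Λ` has the coefficients `Λ(n) = uⁿ ∑_{∂P ∣ n} ∂P`; therefore
`g = exp (∑ Λ(n) wⁿ / n)` in the unit disc. By Axiom `A^#` the function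
`H(w) = (1 - w) g(w)` is holomorphic in a disc of radius larger than `1` and `H(1) ≠ 0`. The
inequality `3 + 4 cos θ + cos 2θ ≥ 0` excludes zeros of `H` on the unit circle except at `w = -1`,
where the hypothesis on `Z(-1/q)` is needed. Cauchy's estimate for `H' / H` then gives
`Λ(n) = 1 + O(sⁿ)` with `s < 1` (`exists_mangoldt_geometric_bound`).

**Möbius sums over rough elements.** Let `m(d, x)` be the sum of `μ(h) / ‖h‖` over the `h` of
degree at most `x` whose prime factors all have degree larger than `d`. Logarithmic
differentiation of the Euler product gives the delay equation
`x m(d, x) = ∑_{1 ≤ k ≤ x} (1 - Λ_d(k)) m(d, x - k)`, in which `1 - Λ_d(k)` is `1` for `k ≤ d` and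
exponentially small for `k > d`. Hence `m(d, x) ≪ 1` and `m(d, x) ≪ d / x`, uniformly
(`exists_moebiusSum_bound`).

**Alladi's formula.** Let `π_S(d)` be the number of primes of degree `d` in `S`, and `π(d)` that of
all primes. Summing `-μ(g) / ‖g‖` over the distinguished elements according to the least prime
factor gives `∑_{d ≤ n} π_S(d) u^d m(d, n - d)`. By the two bounds every term is `O(1 / n)`. If
`S` consists of all primes, telescoping `m(d - 1, n) - m(d, n)` shows that the sum tends to `1`,
since `m(0, n) → 0`, `m(n, n) = 1`, and the elements with several prime factors of least degree
contribute `o(1)`; for general `S` the ratios `π_S(d) / π(d)` tend to `δ`, and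
an average with weights `O(1 / n)` gives `δ` (`tendsto_sum_primeCount`).

**Twists.** For `c` with `∑ |c(k)| / ‖k‖ < ∞` and `c(0) = 1`, write the sum of `(μ * c)(g) / ‖g‖` as
`∑ c(k) / ‖k‖ T_n(k)`, where `T_n(k)` is the sum of `μ(h) / ‖h‖` over the `h` for which `h + k ≠ 0`
is distinguished of degree at most `n`. The
`T_n(k)` are uniformly bounded, tend to `0` for `k ≠ 0` and to `-δ` for `k = 0`
(`tendsto_sum_conv_moebius`). Finally `(‖·‖ / φ) (μ * a) = μ * c` with
`c = 1 * (‖·‖ / φ) (μ * a)`, and the sum `∑ |c(k)| / ‖k‖` converges because `c` is bounded by the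
convolution of `|a| ‖·‖ / φ` with the multiplicative function `r ↦ ∏_{P ∣ r} 1 / (‖P‖ - 1)`
(`summable_totientTwist`).
-/

/-! ### Unique factorization and the Möbius function -/

namespace AdditiveArithSemigroup

variable {G : Type u} [AddCommMonoid G] (A : AdditiveArithSemigroup G)

/-- Unique factorization: the additive isomorphism sending `g` to its exponents `P ↦ v_P(g)`. -/
noncomputable def factorization : G ≃+ (A.primes →₀ ℕ) :=
  AddEquiv.symm
    { Equiv.ofBijective _ A.freely_generated with
      map_add' := fun f g => by
        change (f + g).sum (fun (P : A.primes) k => k • (P : G)) =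
          f.sum (fun P k => k • (P : G)) + g.sum (fun P k => k • (P : G))
        exact Finsupp.sum_add_index' (fun _ => zero_nsmul _) (fun _ _ _ => add_nsmul _ _ _) }

theorem factorization_symm_apply (f : A.primes →₀ ℕ) :
    A.factorization.symm f = f.sum fun P k => k • (P : G) := rfl

theorem factorization_prime (P : A.primes) :
    A.factorization (P : G) = Finsupp.single P 1 := by
  rw [← AddEquiv.eq_symm_apply, factorization_symm_apply]
  simp

theorem divides_iff (h g : G) : Divides h g ↔ A.factorization h ≤ A.factorization g := by
  constructor
  · rintro ⟨r, rfl⟩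
    rw [map_add]
    exact le_self_add
  · intro hle
    refine ⟨A.factorization.symm (A.factorization g - A.factorization h), ?_⟩
    apply A.factorization.injective
    rw [map_add, AddEquiv.apply_symm_apply]
    exact add_tsub_cancel_of_le hle

theorem add_left_cancel' (A : AdditiveArithSemigroup G) {g h k : G} (H : g + h = g + k) : h = k := by
  apply A.factorization.injective
  have := congrArg A.factorization H
  rw [map_add, map_add] at this
  exact add_left_cancel this

theorem nsmul_prime_divides_iff (n : ℕ) (P : A.primes) (g : G) :
    Divides (n • (P : G)) g ↔ n ≤ A.factorization g P := by
  rw [A.divides_iff, map_nsmul, factorization_prime, Finsupp.smul_single, smul_eq_mul, mul_one,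
    Finsupp.single_le_iff]

theorem prime_divides_iff (P : A.primes) (g : G) :
    Divides (P : G) g ↔ A.factorization g P ≠ 0 := by
  have := A.nsmul_prime_divides_iff 1 P g
  rw [one_smul] at this
  rw [this, Nat.one_le_iff_ne_zero]

theorem mem_primeFactors {P g : G} : P ∈ A.primeFactors g ↔ P ∈ A.primes ∧ Divides P g := by
  simp [primeFactors]

theorem coe_mem_primeFactors (P : A.primes) (g : G) :
    (P : G) ∈ A.primeFactors g ↔ A.factorization g P ≠ 0 := by
  rw [mem_primeFactors, prime_divides_iff]
  simp

theorem primeFactors_eq (g : G) :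
    A.primeFactors g = (A.factorization g).support.map (Function.Embedding.subtype _) := by
  ext P
  simp only [Finset.mem_map, Finsupp.mem_support_iff, Function.Embedding.coe_subtype]
  constructor
  · intro h
    have hP := (A.mem_primeFactors.1 h).1
    exact ⟨⟨P, hP⟩, (A.coe_mem_primeFactors ⟨P, hP⟩ g).1 h, rfl⟩
  · rintro ⟨P, h, rfl⟩
    exact (A.coe_mem_primeFactors P g).2 h

theorem deg_eq_sum (g : G) :
    A.deg g = (A.factorization g).sum fun P k => k * A.deg (P : G) := by
  conv_lhs => rw [← A.factorization.symm_apply_apply g, factorization_symm_apply]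
  simp [Finsupp.sum]

theorem eq_zero_of_deg_eq_zero {g : G} (h : A.deg g = 0) : g = 0 := by
  rw [deg_eq_sum, Finsupp.sum, Finset.sum_eq_zero_iff] at h
  apply A.factorization.injective
  ext P
  by_contra hP
  have := h P (by simpa using hP)
  have h2 := A.deg_pos P P.2
  rcases mul_eq_zero.1 this with h3 | h3
  · exact hP (by simpa using h3)
  · omega

theorem mem_elemsLE {n : ℕ} {g : G} : g ∈ A.elemsLE n ↔ A.deg g ≤ n := by
  simp [elemsLE]

theorem mem_decompositions {p : G × G} {g : G} : p ∈ A.decompositions g ↔ p.1 + p.2 = g := by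
  simp [decompositions]

/-- The finite set of elements of degree exactly `n`. -/
noncomputable def elemsEq (n : ℕ) : Finset G := {g ∈ A.elemsLE n | A.deg g = n}

theorem mem_elemsEq {n : ℕ} {g : G} : g ∈ A.elemsEq n ↔ A.deg g = n := by
  simp only [elemsEq, Finset.mem_filter, mem_elemsLE]
  omega

theorem elemsEq_zero : A.elemsEq 0 = {0} := by
  ext g
  rw [mem_elemsEq, Finset.mem_singleton]
  exact ⟨A.eq_zero_of_deg_eq_zero, fun h => by simp [h]⟩

theorem count_eq_card (n : ℕ) : A.count n = (A.elemsEq n).card := by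
  rw [count, ← Set.ncard_coe_finset]
  congr 1
  ext g
  simp [mem_elemsEq]

theorem sum_elemsLE {M : Type*} [AddCommMonoid M] (n : ℕ) (f : G → M) :
    ∑ g ∈ A.elemsLE n, f g = ∑ k ∈ Finset.range (n + 1), ∑ g ∈ A.elemsEq k, f g := by
  classical
  rw [← Finset.sum_fiberwise_of_maps_to (s := A.elemsLE n) (t := Finset.range (n + 1))
    (g := fun g => A.deg g)]
  · refine Finset.sum_congr rfl fun k hk => Finset.sum_congr ?_ fun _ _ => rfl
    ext g
    simp only [Finset.mem_filter, mem_elemsLE, mem_elemsEq]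
    have := Finset.mem_range.1 hk
    omega
  · intro g hg
    have := A.mem_elemsLE.1 hg
    exact Finset.mem_range.2 (by omega)

/-- The finite set of primes of degree at most `n`. -/
noncomputable def primesLE (n : ℕ) : Finset A.primes :=
  ((A.finite_le n).preimage Subtype.val_injective.injOn).toFinset

theorem mem_primesLE {n : ℕ} {P : A.primes} : P ∈ A.primesLE n ↔ A.deg (P : G) ≤ n := by
  simp [primesLE]

/-- The squarefree element with set of prime factors `J`. -/
def squarefreeElem (J : Finset A.primes) : G := ∑ P ∈ J, (P : G)

theorem deg_squarefreeElem (J : Finset A.primes) :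
    A.deg (A.squarefreeElem J) = ∑ P ∈ J, A.deg (P : G) := by
  simp [squarefreeElem]

open Classical in
theorem factorization_squarefreeElem (J : Finset A.primes) (P : A.primes) :
    A.factorization (A.squarefreeElem J) P = if P ∈ J then 1 else 0 := by
  simp [squarefreeElem, map_sum, factorization_prime, Finsupp.finsetSum_apply,
    Finsupp.single_apply]

theorem support_squarefreeElem (J : Finset A.primes) :
    (A.factorization (A.squarefreeElem J)).support = J := by
  classical
  ext P
  simp [factorization_squarefreeElem]

theorem squarefreeElem_injective : Function.Injective A.squarefreeElem := by
  intro J K h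
  rw [← A.support_squarefreeElem J, h, support_squarefreeElem]

theorem moebius_squarefreeElem (J : Finset A.primes) :
    A.moebius (A.squarefreeElem J) = (-1) ^ J.card := by
  classical
  rw [moebius, if_neg, primeFactors_eq, Finset.card_map, support_squarefreeElem]
  rintro ⟨P, hP, h⟩
  have := (A.nsmul_prime_divides_iff 2 ⟨P, hP⟩ _).1 h
  rw [factorization_squarefreeElem] at this
  split_ifs at this <;> omega

theorem eq_squarefreeElem_of_moebius_ne_zero {g : G} (h : A.moebius g ≠ 0) :
    A.squarefreeElem (A.factorization g).support = g := by
  classical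
  have h1 : ¬ ∃ P ∈ A.primes, Divides (2 • P) g := fun h1 => h (by rw [moebius, if_pos h1])
  push Not at h1
  apply A.factorization.injective
  ext P
  have h2 := h1 P P.2
  rw [nsmul_prime_divides_iff] at h2
  rw [factorization_squarefreeElem]
  simp only [Finsupp.mem_support_iff]
  split_ifs <;> omega

theorem squarefreeElem_divides_iff (J : Finset A.primes) (g : G) :
    Divides (A.squarefreeElem J) g ↔ J ⊆ (A.factorization g).support := by
  classical
  rw [A.divides_iff]
  constructor
  · intro h P hP
    have := h P
    rw [factorization_squarefreeElem, if_pos hP] at this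
    simpa using Nat.one_le_iff_ne_zero.1 this
  · intro h P
    rw [factorization_squarefreeElem]
    split_ifs with hP
    · have := h hP
      rw [Finsupp.mem_support_iff] at this
      omega
    · exact Nat.zero_le _

/-- The Möbius function is supported on the elements `squarefreeElem J`. -/
theorem sum_moebius_mul {X : Finset G} {Y : Finset (Finset A.primes)}
    (h : ∀ J, J ∈ Y ↔ A.squarefreeElem J ∈ X) (f : G → ℂ) :
    ∑ g ∈ X, A.moebius g * f g = ∑ J ∈ Y, (-1) ^ J.card * f (A.squarefreeElem J) := by
  classical
  symm
  refine Finset.sum_bij_ne_zero (fun J _ _ => A.squarefreeElem J) ?_ ?_ ?_ ?_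
  · exact fun J hJ _ => (h J).1 hJ
  · exact fun J _ _ K _ _ hJK => A.squarefreeElem_injective hJK
  · intro g hg hne
    have h1 := A.eq_squarefreeElem_of_moebius_ne_zero (left_ne_zero_of_mul hne)
    refine ⟨(A.factorization g).support, (h _).2 (by rwa [h1]), ?_, h1⟩
    rw [h1]
    refine mul_ne_zero (pow_ne_zero _ (by norm_num)) (right_ne_zero_of_mul hne)
  · intro J _ _
    rw [moebius_squarefreeElem]

/-- Sums of `μ(h) f(h)` over the divisors `h` of `g` run over the sets of prime factors of `g`. -/
theorem sum_decompositions_moebius (g : G) (f : G → ℂ) :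
    ∑ p ∈ A.decompositions g, A.moebius p.1 * f p.1 =
      ∑ J ∈ (A.factorization g).support.powerset, (-1) ^ J.card * f (A.squarefreeElem J) := by
  classical
  have hinj : Set.InjOn Prod.fst (A.decompositions g : Set (G × G)) := by
    rintro ⟨a, b⟩ h1 ⟨c, d⟩ h2 (rfl : a = c)
    simp only [Finset.mem_coe, mem_decompositions] at h1 h2
    rw [A.add_left_cancel' (h1.trans h2.symm)]
  rw [← Finset.sum_image (f := fun h => A.moebius h * f h) hinj]
  refine A.sum_moebius_mul (fun J => ?_) f
  rw [Finset.mem_powerset, ← squarefreeElem_divides_iff, Finset.mem_image]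
  constructor
  · rintro ⟨r, hr⟩
    exact ⟨(_, r), A.mem_decompositions.2 hr, rfl⟩
  · rintro ⟨⟨a, b⟩, hp, rfl⟩
    exact ⟨b, A.mem_decompositions.1 hp⟩

theorem sum_decompositions_moebius_one (g : G) [Decidable (g = 0)] :
    ∑ p ∈ A.decompositions g, A.moebius p.1 = if g = 0 then 1 else 0 := by
  classical
  have := A.sum_decompositions_moebius g (fun _ => 1)
  simp only [mul_one] at this
  rw [this]
  have h2 := Finset.sum_powerset_neg_one_pow_card (x := (A.factorization g).support)
  have h3 := congrArg (fun z : ℤ => (z : ℂ)) h2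
  push_cast at h3
  rw [h3]
  simp

/-! ### Generating series and the delay equation -/

open PowerSeries in
theorem coeff_mul_congr {f f' g g' : ℂ⟦X⟧} {n : ℕ} (hf : ∀ k ≤ n, coeff k f = coeff k f')
    (hg : ∀ k ≤ n, coeff k g = coeff k g') : coeff n (f * g) = coeff n (f' * g') := by
  rw [coeff_mul, coeff_mul]
  refine Finset.sum_congr rfl fun p hp => ?_
  have := Finset.HasAntidiagonal.mem_antidiagonal.1 hp
  rw [hf p.1 (by omega), hg p.2 (by omega)]

/-- The weighted generating series `∑_g f(g) u^{∂ g} X^{∂ g}`. -/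
noncomputable def series (u : ℂ) (f : G → ℂ) : PowerSeries ℂ :=
  PowerSeries.mk fun n => ∑ g ∈ A.elemsEq n, f g * u ^ n

theorem series_conv (u : ℂ) (f₁ f₂ : G → ℂ) :
    A.series u (A.conv f₁ f₂) = A.series u f₁ * A.series u f₂ := by
  classical
  ext n
  rw [PowerSeries.coeff_mul]
  simp only [series, PowerSeries.coeff_mk, conv]
  simp_rw [Finset.sum_mul_sum, ← Finset.sum_product', Finset.sum_mul, Finset.sum_sigma']
  refine Finset.sum_bij' (fun x _ => ⟨(A.deg x.2.1, A.deg x.2.2), x.2⟩)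
    (fun y _ => ⟨y.2.1 + y.2.2, y.2⟩) ?_ ?_ ?_ ?_ ?_
  · rintro ⟨g, h, k⟩ hx
    simp only [Finset.mem_sigma, mem_elemsEq, mem_decompositions, Finset.HasAntidiagonal.mem_antidiagonal,
      Finset.mem_product] at hx ⊢
    obtain ⟨h1, rfl⟩ := hx
    simpa using h1
  · rintro ⟨⟨i, j⟩, h, k⟩ hx
    simp only [Finset.mem_sigma, mem_elemsEq, mem_decompositions, Finset.HasAntidiagonal.mem_antidiagonal,
      Finset.mem_product] at hx ⊢
    simp [hx]
  · rintro ⟨g, h, k⟩ hx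
    simp only [Finset.mem_sigma, mem_decompositions] at hx
    simp [hx.2]
  · rintro ⟨⟨i, j⟩, h, k⟩ hx
    simp only [Finset.mem_sigma, mem_elemsEq, Finset.mem_product] at hx
    simp [hx]
  · rintro ⟨g, h, k⟩ hx
    simp only [Finset.mem_sigma, mem_elemsEq, mem_decompositions] at hx
    obtain ⟨h1, rfl⟩ := hx
    simp only [map_add] at h1 ⊢
    rw [← h1, pow_add]
    ring

open Classical in
/-- The generating series of the Möbius function restricted to the elements all of whose prime
factors have degree larger than `d`. -/
noncomputable def roughSeries (u : ℂ) (d : ℕ) : PowerSeries ℂ :=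
  A.series u fun h =>
    A.moebius h * if ∀ P ∈ (A.factorization h).support, d < A.deg (P : G) then 1 else 0

open Classical in
/-- The primes of degree in `(d, N]`. -/
noncomputable def primesIoc (d N : ℕ) : Finset A.primes :=
  {P ∈ A.primesLE N | d < A.deg (P : G)}

theorem mem_primesIoc {d N : ℕ} {P : A.primes} :
    P ∈ A.primesIoc d N ↔ d < A.deg (P : G) ∧ A.deg (P : G) ≤ N := by
  simp [primesIoc, mem_primesLE, and_comm]

open PowerSeries in
/-- The finite Euler product `∏_P (1 - (u X)^{∂ P})` over a set of primes. -/
noncomputable def eulerProd (u : ℂ) (T : Finset A.primes) : ℂ⟦X⟧ :=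
  ∏ P ∈ T, (1 - (C u * X) ^ A.deg (P : G))

open PowerSeries in
theorem coeff_C_mul_X_pow' (u : ℂ) (m n : ℕ) :
    coeff n ((C u * X : ℂ⟦X⟧) ^ m) = if n = m then u ^ m else 0 := by
  rw [mul_pow, ← map_pow, coeff_C_mul, coeff_X_pow]
  simp

open PowerSeries in
theorem coeff_eulerProd (u : ℂ) (T : Finset A.primes) (n : ℕ) :
    coeff n (A.eulerProd u T) =
      ∑ J ∈ T.powerset, (-1) ^ J.card * if n = A.deg (A.squarefreeElem J) then u ^ n else 0 := by
  classical
  simp only [eulerProd, sub_eq_add_neg, Finset.prod_one_add]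
  rw [map_sum]
  refine Finset.sum_congr rfl fun J _ => ?_
  rw [Finset.prod_neg, Finset.prod_pow_eq_pow_sum, ← A.deg_squarefreeElem]
  have : ((-1 : ℂ⟦X⟧)) ^ J.card = C ((-1 : ℂ) ^ J.card) := by simp
  rw [this, coeff_C_mul, coeff_C_mul_X_pow']
  split_ifs with h <;> simp [h]

open PowerSeries in
/-- Up to degree `N` only the finitely many primes of degree at most `N` matter, so that infinite
products of power series are not needed. -/
theorem coeff_roughSeries (u : ℂ) {d n N : ℕ} (h : n ≤ N) :
    coeff n (A.roughSeries u d) = coeff n (A.eulerProd u (A.primesIoc d N)) := by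
  classical
  rw [coeff_eulerProd, roughSeries, series, coeff_mk]
  simp only [mul_assoc]
  rw [A.sum_moebius_mul
    (Y := (A.primesLE n).powerset.filter fun J => A.deg (A.squarefreeElem J) = n)]
  · simp only [support_squarefreeElem]
    symm
    rw [← Finset.sum_filter_add_sum_filter_not _ (fun J => A.deg (A.squarefreeElem J) = n),
      add_eq_left.2]
    · symm
      refine (Finset.sum_subset_zero_on_sdiff ?_ ?_ ?_).symm
      · intro J hJ
        simp only [Finset.mem_filter, Finset.mem_powerset] at hJ ⊢
        refine ⟨fun P hP => A.mem_primesLE.2 ?_, hJ.2⟩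
        rw [← hJ.2, deg_squarefreeElem]
        exact Finset.single_le_sum (f := fun P : A.primes => A.deg (P : G))
          (fun _ _ => Nat.zero_le _) hP
      · intro J hJ
        simp only [Finset.mem_sdiff, Finset.mem_filter, Finset.mem_powerset] at hJ
        rw [if_neg, zero_mul, mul_zero]
        intro hd
        refine hJ.2 ⟨fun P hP => A.mem_primesIoc.2 ⟨hd P hP, ?_⟩, hJ.1.2⟩
        exact (A.mem_primesLE.1 (hJ.1.1 hP)).trans h
      · intro J hJ
        simp only [Finset.mem_filter, Finset.mem_powerset] at hJ
        rw [if_pos hJ.2.symm, if_pos, one_mul]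
        exact fun P hP => (A.mem_primesIoc.1 (hJ.1 hP)).1
    · refine Finset.sum_eq_zero fun J hJ => ?_
      rw [if_neg, mul_zero]
      exact fun h => (Finset.mem_filter.1 hJ).2 h.symm
  · intro J
    simp only [Finset.mem_filter, Finset.mem_powerset, mem_elemsEq, and_iff_right_iff_imp]
    intro hJ P hP
    rw [mem_primesLE, ← hJ, deg_squarefreeElem]
    exact Finset.single_le_sum (f := fun P : A.primes => A.deg (P : G))
          (fun _ _ => Nat.zero_le _) hP

open PowerSeries in
/-- The generating series of the von Mangoldt function of the primes of degree larger than `d`: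
the coefficient of `X^k` is `u^k ∑ ∂P`, the sum over the primes `P` with `∂P > d` and
`∂P ∣ k`. -/
noncomputable def mangoldtSeries (u : ℂ) (d : ℕ) : ℂ⟦X⟧ :=
  PowerSeries.mk fun k => ∑ P ∈ (A.primesIoc d k).filter fun P : A.primes => A.deg (P : G) ∣ k,
    (A.deg (P : G) : ℂ) * u ^ k

open PowerSeries in
theorem X_mul_derivative_one_sub_pow (u : ℂ) (e : ℕ) (he : 0 < e) :
    X * derivative ℂ (1 - (C u * X : ℂ⟦X⟧) ^ e) =
      -((PowerSeries.mk fun k => if e ∣ k ∧ k ≠ 0 then (e : ℂ) * u ^ k else 0) * (1 - (C u * X) ^ e)) := by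
  have h1 : X * derivative ℂ (1 - (C u * X : ℂ⟦X⟧) ^ e) = - (C (e : ℂ) * (C u * X) ^ e) := by
    ext n
    rcases n with _ | n
    · rw [coeff_zero_X_mul, map_neg, coeff_C_mul, coeff_C_mul_X_pow', if_neg he.ne]
      simp
    · rw [coeff_succ_X_mul, coeff_derivative, map_sub, map_neg, coeff_C_mul,
        coeff_C_mul_X_pow', coeff_one, if_neg (Nat.succ_ne_zero n)]
      split_ifs with h
      · rw [← h]; push_cast; ring
      · simp
  rw [h1]
  congr 1
  ext n
  rw [mul_sub, mul_one, map_sub, coeff_C_mul, coeff_C_mul_X_pow', coeff_mk, mul_pow, ← map_pow,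
    mul_left_comm, coeff_C_mul, coeff_mul_X_pow', coeff_mk]
  rcases Nat.lt_or_ge n e with h | h
  · rw [if_neg h.ne, if_neg (by omega : ¬ e ≤ n), if_neg]
    · simp
    · rintro ⟨h2, h3⟩
      exact absurd (Nat.le_of_dvd (Nat.pos_of_ne_zero h3) h2) (by omega)
  · rw [if_pos h]
    have h2 : e ∣ n - e ↔ e ∣ n := by
      rw [← Nat.dvd_add_self_right (m := e) (n := n - e), Nat.sub_add_cancel h]
    simp only [h2]
    rcases h.eq_or_lt with rfl | h3
    · simp [he.ne']
    · rw [if_neg (by omega : ¬ n = e)]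
      by_cases h4 : e ∣ n
      · rw [if_pos ⟨h4, by omega⟩, if_pos ⟨h4, by omega⟩]
        have : u ^ n = u ^ e * u ^ (n - e) := by rw [← pow_add]; congr 1; omega
        rw [this]; ring
      · simp [h4]

open PowerSeries in
theorem X_mul_derivative_eulerProd (u : ℂ) (T : Finset A.primes) :
    X * derivative ℂ (A.eulerProd u T) =
      -((∑ P ∈ T, PowerSeries.mk fun k => if A.deg (P : G) ∣ k ∧ k ≠ 0 then (A.deg (P : G) : ℂ) * u ^ k
        else 0) * A.eulerProd u T) := by
  classical
  induction T using Finset.induction_on with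
  | empty => simp [eulerProd]
  | insert P T hP ih =>
    have h : A.eulerProd u (insert P T) =
        (1 - (C u * X) ^ A.deg (P : G)) * A.eulerProd u T := by
      rw [eulerProd, Finset.prod_insert hP, eulerProd]
    have h1 := X_mul_derivative_one_sub_pow u (A.deg (P : G)) (A.deg_pos P P.2)
    rw [h, Finset.sum_insert hP, Derivation.leibniz, smul_eq_mul, smul_eq_mul, mul_add,
      mul_left_comm, ih, mul_left_comm, h1]
    ring

open PowerSeries in
theorem coeff_mangoldtSeries (u : ℂ) {d k N : ℕ} (h : k ≤ N) :
    coeff k (A.mangoldtSeries u d) =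
      coeff k (∑ P ∈ A.primesIoc d N, (PowerSeries.mk fun k => if A.deg (P : G) ∣ k ∧ k ≠ 0 then
        (A.deg (P : G) : ℂ) * u ^ k else 0 : ℂ⟦X⟧)) := by
  classical
  rw [map_sum, mangoldtSeries, coeff_mk]
  simp only [coeff_mk]
  rw [← Finset.sum_filter]
  refine Finset.sum_congr ?_ fun _ _ => rfl
  ext P
  have := A.deg_pos P P.2
  simp only [Finset.mem_filter, mem_primesIoc]
  constructor
  · rintro ⟨⟨h1, h2⟩, h3⟩
    exact ⟨⟨h1, h2.trans h⟩, h3, by omega⟩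
  · rintro ⟨⟨h1, h2⟩, h3, h4⟩
    exact ⟨⟨h1, Nat.le_of_dvd (Nat.pos_of_ne_zero h4) h3⟩, h3⟩

open PowerSeries in
/-- Logarithmic differentiation of the Euler product over the primes of degree larger
than `d`. -/
theorem X_mul_derivative_roughSeries (u : ℂ) (d : ℕ) :
    X * derivative ℂ (A.roughSeries u d) = -(A.mangoldtSeries u d * A.roughSeries u d) := by
  ext n
  have h := congrArg (coeff n) (A.X_mul_derivative_eulerProd u (A.primesIoc d n))
  rw [map_neg] at h ⊢
  rw [coeff_mul_congr (fun k hk => A.coeff_mangoldtSeries u hk)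
    (fun k hk => A.coeff_roughSeries u hk), ← h]
  rcases n with _ | n
  · simp
  · rw [coeff_succ_X_mul, coeff_succ_X_mul, coeff_derivative,
      coeff_derivative, A.coeff_roughSeries u le_rfl]

open PowerSeries in
/-- Restoring the primes of degree `d` multiplies the series by their Euler factors. -/
theorem roughSeries_sub_one (u : ℂ) {d : ℕ} (hd : 1 ≤ d) :
    A.roughSeries u (d - 1) =
      (1 - (C u * X) ^ d) ^ (A.primeCount A.primes d) * A.roughSeries u d := by
  classical
  ext n
  have hN : n ≤ max n d := le_max_left _ _
  rw [A.coeff_roughSeries u hN, coeff_mul_congr (fun k hk => rfl)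
    (fun k hk => A.coeff_roughSeries u (hk.trans hN))]
  congr 1
  have h1 : A.primesIoc (d - 1) (max n d) =
      A.primesIoc (d - 1) d ∪ A.primesIoc d (max n d) := by
    ext P
    simp only [Finset.mem_union, mem_primesIoc, le_max_iff]
    omega
  have h2 : Disjoint (A.primesIoc (d - 1) d) (A.primesIoc d (max n d)) := by
    rw [Finset.disjoint_left]
    intro P
    simp only [mem_primesIoc]
    omega
  rw [eulerProd, h1, Finset.prod_union h2, ← eulerProd, ← eulerProd]
  congr 1
  have h3 : ∀ P ∈ A.primesIoc (d - 1) d, A.deg (P : G) = d := by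
    intro P
    simp only [mem_primesIoc]
    omega
  rw [eulerProd, Finset.prod_congr rfl (fun P hP => by rw [h3 P hP]), Finset.prod_const]
  congr 1
  rw [primeCount, ← Finset.card_map (Function.Embedding.subtype _), ← Set.ncard_coe_finset]
  congr 1
  ext P
  simp only [Finset.coe_map, Function.Embedding.coe_subtype, Set.mem_image, Finset.mem_coe,
    mem_primesIoc, Set.mem_ofPred_eq]
  constructor
  · rintro ⟨P, hP, rfl⟩
    exact ⟨P.2, by omega⟩
  · rintro ⟨hP, h⟩
    exact ⟨⟨P, hP⟩, ⟨by simp only; omega, by simp only; omega⟩, rfl⟩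

open Classical in
theorem conv_moebius_one (g : G) :
    A.conv A.moebius (fun _ => 1) g = if g = 0 then 1 else 0 := by
  simp only [conv, mul_one]
  exact A.sum_decompositions_moebius_one g

open PowerSeries in
theorem roughSeries_zero_mul (u : ℂ) : A.roughSeries u 0 * A.series u (fun _ => 1) = 1 := by
  classical
  have h : A.roughSeries u 0 = A.series u A.moebius := by
    rw [roughSeries]
    congr 1
    ext h
    rw [if_pos (fun P _ => A.deg_pos _ (Subtype.prop P)), mul_one]
  rw [h, ← series_conv]
  ext n
  rw [series, coeff_mk, coeff_one]
  simp only [conv_moebius_one]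
  rcases Nat.eq_zero_or_pos n with rfl | hn
  · simp [elemsEq_zero]
  · rw [if_neg hn.ne']
    refine Finset.sum_eq_zero fun g hg => ?_
    rw [if_neg, zero_mul]
    rintro rfl
    rw [mem_elemsEq, map_zero] at hg
    omega

open PowerSeries in
/-- Chebyshev's identity `X G' = Λ G`. -/
theorem X_mul_derivative_series_one (u : ℂ) :
    X * derivative ℂ (A.series u fun _ => 1) =
      A.mangoldtSeries u 0 * A.series u fun _ => 1 := by
  have h0 := A.roughSeries_zero_mul u
  have h1 := A.X_mul_derivative_roughSeries u 0
  have h2 := congrArg (fun f => X * derivative ℂ f) h0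
  simp only [Derivation.leibniz, smul_eq_mul, Derivation.map_one_eq_zero, mul_zero, mul_add] at h2
  set F := A.roughSeries u 0
  set Z := A.series u fun _ => 1
  have h3 : F * (X * derivative ℂ Z) = F * (A.mangoldtSeries u 0 * Z) := by
    linear_combination h2 - Z * h1
  calc X * derivative ℂ Z = (F * Z) * (X * derivative ℂ Z) := by rw [h0, one_mul]
    _ = Z * (F * (X * derivative ℂ Z)) := by ring
    _ = (F * Z) * (A.mangoldtSeries u 0 * Z) := by rw [h3]; ring
    _ = _ := by rw [h0, one_mul]

open PowerSeries in
/-- The summatory function `m(d, x) = ∑ μ(h) u^{∂ h}` over the elements `h` of degree at most `x`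
without prime factors of degree at most `d`. -/
noncomputable def moebiusSum (u : ℂ) (d x : ℕ) : ℂ :=
  coeff x (A.roughSeries u d * PowerSeries.mk fun _ => 1)

theorem moebiusSum_eq (u : ℂ) (d x : ℕ) :
    A.moebiusSum u d x =
      ∑ k ∈ Finset.range (x + 1), PowerSeries.coeff k (A.roughSeries u d) := by
  rw [moebiusSum, PowerSeries.coeff_mul, Finset.Nat.sum_antidiagonal_eq_sum_range_succ_mk]
  simp

theorem moebiusSum_zero (u : ℂ) (d : ℕ) : A.moebiusSum u d 0 = 1 := by
  rw [moebiusSum_eq, Finset.sum_range_one, A.coeff_roughSeries u le_rfl]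
  have : A.primesIoc d 0 = ∅ := by
    ext P
    simp only [mem_primesIoc, Finset.notMem_empty, iff_false]
    omega
  rw [this, eulerProd]
  simp

open PowerSeries in
/-- The discrete delay equation satisfied by the summatory function: the coefficient `1 - Λ_d(k)`
is `1` for `1 ≤ k ≤ d` and small for `k > d`. -/
theorem moebiusSum_recurrence (u : ℂ) (d x : ℕ) :
    (x : ℂ) * A.moebiusSum u d x = ∑ k ∈ Finset.Icc 1 x,
      (1 - coeff k (A.mangoldtSeries u d)) * A.moebiusSum u d (x - k) := by
  have hI : (1 - X : ℂ⟦X⟧) * (PowerSeries.mk fun _ => 1) = 1 := by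
    rw [mul_comm]; exact mk_one_mul_one_sub_eq_one ℂ
  set I : ℂ⟦X⟧ := PowerSeries.mk fun _ => 1 with hIdef
  set F := A.roughSeries u d
  have h1 := A.X_mul_derivative_roughSeries u d
  have hI' : X * derivative ℂ I = X * I * I := by
    have h2 := congrArg (fun f => X * derivative ℂ f) hI
    simp only [Derivation.leibniz, smul_eq_mul, Derivation.map_one_eq_zero, mul_zero, mul_add,
      map_sub, derivative_X] at h2
    linear_combination I * h2 - X * derivative ℂ I * hI
  have h3 : X * derivative ℂ (F * I) = (X * I - A.mangoldtSeries u d) * (F * I) := by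
    rw [Derivation.leibniz, smul_eq_mul, smul_eq_mul]
    linear_combination F * hI' + I * h1
  have h4 : coeff x (X * derivative ℂ (F * I)) = (x : ℂ) * A.moebiusSum u d x := by
    rcases x with _ | x
    · simp
    · rw [coeff_succ_X_mul, coeff_derivative, moebiusSum]
      push_cast
      ring
  rw [← h4, h3, coeff_mul, Finset.Nat.sum_antidiagonal_eq_sum_range_succ_mk,
    Finset.sum_range_succ']
  have h5 : coeff 0 (X * I - A.mangoldtSeries u d) = 0 := by
    rw [map_sub, coeff_zero_X_mul, mangoldtSeries, coeff_mk]
    have : A.primesIoc d 0 = ∅ := by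
      ext P
      simp only [mem_primesIoc, Finset.notMem_empty, iff_false]
      omega
    simp [this]
  rw [h5, zero_mul, add_zero, Finset.sum_bij (fun k _ => k + 1)]
  · intro k hk
    have := Finset.mem_range.1 hk
    exact Finset.mem_Icc.2 ⟨by omega, by omega⟩
  · intro a _ b _ h
    omega
  · intro b hb
    have := Finset.mem_Icc.1 hb
    exact ⟨b - 1, Finset.mem_range.2 (by omega), by omega⟩
  · intro k _
    rw [map_sub, coeff_succ_X_mul, hIdef, coeff_mk]
    rfl

end AdditiveArithSemigroup

/-! ### Bounds for the delay equation -/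

/-- Solutions of the discrete delay equation `x m(x) = ∑_{1 ≤ k ≤ x} κ(k) m(x - k)`, where `κ` is
`1` up to `d` and summable beyond `d`, are bounded and decay like `d / x`, uniformly in `d`. -/
theorem exists_bound_of_delay_equation {m κ : ℕ → ℕ → ℂ} {s : ℕ → ℝ} (hs : Summable s)
    (hs0 : ∀ k, 0 ≤ s k) (h0 : ∀ d, m d 0 = 1)
    (hrec : ∀ d x : ℕ, (x : ℂ) * m d x = ∑ k ∈ Finset.Icc 1 x, κ d k * m d (x - k))
    (hκ1 : ∀ d k, 1 ≤ k → k ≤ d → κ d k = 1) (hκ2 : ∀ d k, d < k → ‖κ d k‖ ≤ s k) :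
    ∃ B : ℝ, 0 < B ∧ (∀ d x, ‖m d x‖ ≤ B) ∧ ∀ d x : ℕ, x * ‖m d x‖ ≤ B * (d + 1) := by
  set K : ℕ → ℕ → ℝ := fun d x => ∑ k ∈ Finset.Icc 1 x, ‖κ d k‖ with hK
  have hmul : ∀ (d x : ℕ) (B : ℝ), (∀ y < x, ‖m d y‖ ≤ B) → x * ‖m d x‖ ≤ B * K d x := by
    intro d x B hB
    have h1 : (x : ℝ) * ‖m d x‖ = ‖(x : ℂ) * m d x‖ := by simp
    rw [h1, hrec, hK, Finset.mul_sum]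
    refine (norm_sum_le _ _).trans (Finset.sum_le_sum fun k hk => ?_)
    have := Finset.mem_Icc.1 hk
    rw [norm_mul, mul_comm]
    exact mul_le_mul_of_nonneg_right (hB _ (by omega)) (norm_nonneg _)
  have hKsplit : ∀ d x : ℕ, K d x ≤ d + ∑ k ∈ Finset.Ioc d x, s k := by
    intro d x
    calc K d x ≤ ∑ k ∈ Finset.Icc 1 d ∪ Finset.Ioc d x, ‖κ d k‖ := by
          refine Finset.sum_le_sum_of_subset_of_nonneg ?_ fun _ _ _ => norm_nonneg _
          intro k hk
          simp only [Finset.mem_union, Finset.mem_Icc, Finset.mem_Ioc] at hk ⊢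
          omega
      _ = ∑ k ∈ Finset.Icc 1 d, ‖κ d k‖ + ∑ k ∈ Finset.Ioc d x, ‖κ d k‖ := by
          refine Finset.sum_union (Finset.disjoint_left.2 fun k hk => ?_)
          simp only [Finset.mem_Icc, Finset.mem_Ioc] at hk ⊢
          omega
      _ ≤ d + ∑ k ∈ Finset.Ioc d x, s k := by
          refine add_le_add (le_of_eq ?_) (Finset.sum_le_sum fun k hk =>
            hκ2 d k (Finset.mem_Ioc.1 hk).1)
          rw [Finset.sum_congr rfl (g := fun _ => (1 : ℝ))]
          · simp
          · intro k hk
            have := Finset.mem_Icc.1 hk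
            rw [hκ1 d k this.1 this.2, norm_one]
  set E := ∑' k, s k with hE
  have hE0 : 0 ≤ E := tsum_nonneg hs0
  have hKE : ∀ d x : ℕ, K d x ≤ d + E := fun d x =>
    (hKsplit d x).trans (by gcongr; exact hs.sum_le_tsum _ fun k _ => hs0 k)
  have hind : ∀ (d X : ℕ) (B : ℝ), 0 ≤ B → (∀ x : ℕ, X < x → K d x ≤ x) →
      (∀ y ≤ X, ‖m d y‖ ≤ B) → ∀ x, ‖m d x‖ ≤ B := by
    intro d X B hB h1 h2 x
    induction x using Nat.strong_induction_on with
    | _ x ih =>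
      rcases Nat.lt_or_ge X x with h | h
      · have hx : (0 : ℝ) < x := by exact_mod_cast (by omega : 0 < x)
        have h3 := (hmul d x B ih).trans (mul_le_mul_of_nonneg_left (h1 x h) hB)
        rw [mul_comm] at h3
        exact le_of_mul_le_mul_right h3 hx
      · exact h2 x h
  -- for each single `d` the solution is bounded
  have hsingle : ∀ d, ∃ B, 0 ≤ B ∧ ∀ x, ‖m d x‖ ≤ B := by
    intro d
    refine ⟨∑ y ∈ Finset.range (⌈d + E⌉₊ + 1), ‖m d y‖,
      Finset.sum_nonneg fun _ _ => norm_nonneg _, hind d ⌈d + E⌉₊ _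
      (Finset.sum_nonneg fun _ _ => norm_nonneg _) ?_ ?_⟩
    · intro x hx
      exact (hKE d x).trans ((Nat.le_ceil _).trans (by exact_mod_cast hx.le))
    · intro y hy
      exact Finset.single_le_sum (f := fun y => ‖m d y‖) (fun _ _ => norm_nonneg _)
        (Finset.mem_range.2 (by omega))
  -- for large `d` the tail of `s` is at most `1`, and the bound `1` propagates
  obtain ⟨d₀, hd₀⟩ : ∃ d₀ : ℕ, ∀ d ≥ d₀, ∀ x : ℕ, ∑ k ∈ Finset.Ioc d x, s k ≤ 1 := by
    have h1 := hs.hasSum.tendsto_sum_nat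
    obtain ⟨d₀, hd₀⟩ := eventually_atTop.1 (h1.eventually (lt_mem_nhds (sub_one_lt E)))
    refine ⟨d₀, fun d hd x => ?_⟩
    have h2 := hd₀ d hd
    have h3 : ∑ k ∈ Finset.range d, s k + ∑ k ∈ Finset.Ioc d x, s k ≤ E := by
      rw [← Finset.sum_union]
      · exact hs.sum_le_tsum _ fun k _ => hs0 k
      · rw [Finset.disjoint_left]
        intro k hk hk'
        have := Finset.mem_range.1 hk
        have := Finset.mem_Ioc.1 hk'
        omega
    linarith
  have hlarge : ∀ d ≥ d₀, ∀ x, ‖m d x‖ ≤ 1 := by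
    intro d hd
    refine hind d d 1 zero_le_one (fun x hx => ?_) (fun y hy => ?_)
    · refine (hKsplit d x).trans ?_
      have h1 := hd₀ d hd x
      have h2 : (d : ℝ) + 1 ≤ x := by exact_mod_cast hx
      linarith
    · induction y using Nat.strong_induction_on with
      | _ y ih =>
        rcases Nat.eq_zero_or_pos y with rfl | hy0
        · rw [h0, norm_one]
        · have hx : (0 : ℝ) < y := by exact_mod_cast hy0
          have h3 := hmul d y 1 fun z hz => ih z hz (by omega)
          have h4 : K d y = y := by
            rw [hK]
            simp only
            rw [Finset.sum_congr rfl (g := fun _ => (1 : ℝ))]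
            · simp
            · intro k hk
              have := Finset.mem_Icc.1 hk
              rw [hκ1 d k this.1 (by omega), norm_one]
          rw [h4, mul_comm] at h3
          exact le_of_mul_le_mul_right h3 hx
  choose b hb0 hb using hsingle
  set B := 1 + ∑ d ∈ Finset.range d₀, b d with hB
  have hB1 : 1 ≤ B := le_add_of_nonneg_right (Finset.sum_nonneg fun d _ => hb0 d)
  have hbd : ∀ d x, ‖m d x‖ ≤ B := by
    intro d x
    rcases Nat.lt_or_ge d d₀ with h | h
    · refine (hb d x).trans ?_
      have := Finset.single_le_sum (f := b) (fun d _ => hb0 d) (Finset.mem_range.2 h)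
      linarith
    · exact (hlarge d h x).trans hB1
  refine ⟨B * (1 + E), by positivity, fun d x => (hbd d x).trans ?_, fun d x => ?_⟩
  · nlinarith
  · refine (hmul d x B fun y _ => hbd d y).trans ?_
    rw [mul_assoc]
    refine mul_le_mul_of_nonneg_left ((hKE d x).trans ?_) (by positivity)
    have : (0 : ℝ) ≤ d := Nat.cast_nonneg d
    nlinarith

/-! ### Power series -/

theorem summable_norm_mul_pow {a : ℕ → ℂ} {C r : ℝ} (ha : ∀ n, ‖a n‖ ≤ C * r ^ n)
    (hr : 0 < r) {w : ℂ} (hw : ‖w‖ < r⁻¹) : Summable fun n => ‖a n * w ^ n‖ := by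
  have h1 : r * ‖w‖ < 1 := by
    have := mul_lt_mul_of_pos_left hw hr
    rwa [mul_inv_cancel₀ hr.ne'] at this
  refine Summable.of_nonneg_of_le (fun _ => norm_nonneg _) (fun n => ?_)
    ((summable_geometric_of_lt_one (by positivity) h1).mul_left C)
  rw [norm_mul, norm_pow, mul_pow, ← mul_assoc]
  exact mul_le_mul_of_nonneg_right (ha n) (by positivity)

theorem summable_norm_succ_mul_pow {a : ℕ → ℂ} {C r : ℝ} (ha : ∀ n, ‖a n‖ ≤ C * r ^ n)
    (hr : 0 < r) {ρ : ℝ} (hρ0 : 0 ≤ ρ) (hρ : ρ < r⁻¹) :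
    Summable fun n : ℕ => ‖((n : ℂ) + 1) * a (n + 1)‖ * ρ ^ n := by
  have h1 : r * ρ < 1 := by
    have := mul_lt_mul_of_pos_left hρ hr
    rwa [mul_inv_cancel₀ hr.ne'] at this
  have h2 : ‖r * ρ‖ < 1 := by rwa [Real.norm_of_nonneg (by positivity)]
  have h3 := (summable_pow_mul_geometric_of_norm_lt_one 1 h2).add
    (summable_geometric_of_norm_lt_one h2)
  refine Summable.of_nonneg_of_le (fun _ => by positivity) (fun n => ?_) (h3.mul_left (C * r))
  have h4 : ‖((n : ℂ) + 1)‖ = n + 1 := by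
    have : ((n : ℂ) + 1) = ((n + 1 : ℕ) : ℂ) := by push_cast; rfl
    rw [this, Complex.norm_natCast]
    push_cast; rfl
  rw [norm_mul, h4]
  calc ((n : ℝ) + 1) * ‖a (n + 1)‖ * ρ ^ n ≤ ((n : ℝ) + 1) * (C * r ^ (n + 1)) * ρ ^ n := by
        gcongr; exact ha _
    _ = C * r * ((n : ℝ) ^ 1 * (r * ρ) ^ n + (r * ρ) ^ n) := by ring

/-- Termwise differentiation of a power series. -/
theorem hasDerivAt_tsum_mul_pow {a : ℕ → ℂ} {C r : ℝ} (ha : ∀ n, ‖a n‖ ≤ C * r ^ n)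
    (hr : 0 < r) {w : ℂ} (hw : ‖w‖ < r⁻¹) :
    HasDerivAt (fun w => ∑' n, a n * w ^ n) (∑' n : ℕ, (((n : ℂ) + 1) * a (n + 1)) * w ^ n) w := by
  obtain ⟨ρ, hρ1, hρ2⟩ := exists_between hw
  have hρ0 : 0 ≤ ρ := (norm_nonneg _).trans hρ1.le
  set b : ℕ → ℝ := fun n => ‖(n : ℂ) * a n‖ * ρ ^ (n - 1) with hb
  have hbs : Summable b := by
    rw [← summable_nat_add_iff 1]
    refine (summable_norm_succ_mul_pow ha hr hρ0 hρ2).congr fun n => ?_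
    simp only [hb, Nat.add_sub_cancel, Nat.cast_add, Nat.cast_one]
  have key := hasDerivAt_tsum_of_isPreconnected (𝕜 := ℂ) (g := fun n w => a n * w ^ n)
    (g' := fun n w => a n * ((n : ℂ) * w ^ (n - 1))) (t := Metric.ball (0 : ℂ) ρ) (y₀ := 0)
    (y := w) hbs Metric.isOpen_ball (convex_ball _ _).isPreconnected ?_ ?_ ?_ ?_ ?_
  · refine key.congr_deriv ?_
    rw [Summable.tsum_eq_zero_add (f := fun n : ℕ => a n * ((n : ℂ) * w ^ (n - 1)))]
    · simp only [Nat.cast_zero, zero_mul, mul_zero, zero_add, Nat.add_sub_cancel]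
      refine tsum_congr fun n => ?_
      push_cast
      ring
    · refine Summable.of_norm_bounded hbs fun n => ?_
      simp only [hb]
      rw [← mul_assoc, norm_mul, norm_pow, mul_comm (a n)]
      gcongr
  · intro n y _
    exact (hasDerivAt_pow n y).const_mul (a n)
  · intro n y hy
    simp only [hb]
    rw [← mul_assoc, norm_mul, norm_pow, mul_comm (a n)]
    have : ‖y‖ ≤ ρ := by simpa using (Metric.mem_ball.1 hy).le
    gcongr
  · simpa using (norm_nonneg w).trans_lt hρ1
  · exact (summable_norm_mul_pow ha hr (w := 0) (by simpa using hr)).of_norm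
  · simpa using hρ1

/-- Cauchy's estimate: the coefficients of a power series whose sum extends holomorphically to the
disc of radius `R` are `O(ρ⁻ⁿ)` for `ρ < R`. -/
theorem exists_norm_coeff_le {f : ℂ → ℂ} {R : ℝ} (hf : DifferentiableOn ℂ f (Metric.ball 0 R))
    {a : ℕ → ℂ} (ha : ∀ w : ℂ, ‖w‖ < 1 → HasSum (fun n => a n * w ^ n) (f w)) {ρ : ℝ}
    (hρ0 : 0 < ρ) (hρ : ρ < R) : ∃ C, ∀ n, ‖a n‖ ≤ C * ρ⁻¹ ^ n := by
  obtain ⟨ρ', h1, h2⟩ := exists_between hρ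
  lift ρ' to NNReal using hρ0.le.trans h1.le
  lift ρ to NNReal using hρ0.le
  have hp := DifferentiableOn.hasFPowerSeriesOnBall (R := ρ') (c := 0) (f := f)
    (hf.mono (Metric.closedBall_subset_ball h2)) (by exact_mod_cast hρ0.trans h1)
  set p := cauchyPowerSeries f 0 ρ'
  have hq : HasFPowerSeriesAt f (FormalMultilinearSeries.ofScalars ℂ a) 0 := by
    rw [hasFPowerSeriesAt_iff]
    filter_upwards [Metric.ball_mem_nhds (0 : ℂ) one_pos] with z hz
    have := ha z (by simpa using hz)
    simpa [FormalMultilinearSeries.coeff_ofScalars, mul_comm] using this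
  have heq := hp.hasFPowerSeriesAt.eq_formalMultilinearSeries hq
  obtain ⟨C, -, hC⟩ := p.norm_mul_pow_le_of_lt_radius (r := ρ)
    (lt_of_lt_of_le (by exact_mod_cast h1) hp.r_le)
  refine ⟨C, fun n => ?_⟩
  have h3 := hC n
  rw [heq, FormalMultilinearSeries.norm_apply_eq_norm_coef,
    FormalMultilinearSeries.coeff_ofScalars] at h3
  rw [inv_pow, ← div_eq_mul_inv, le_div_iff₀ (by positivity)]
  exact h3

/-! ### Exponential of the von Mangoldt series -/

theorem three_add_four_mul_add_sq_re_nonneg {ζ : ℂ} (hζ : ‖ζ‖ = 1) :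
    0 ≤ (3 + 4 * ζ + ζ ^ 2).re := by
  have h1 : ζ.re * ζ.re + ζ.im * ζ.im = 1 := by
    rw [← Complex.normSq_apply, Complex.normSq_eq_norm_sq, hζ, one_pow]
  have h2 : (3 + 4 * ζ + ζ ^ 2).re = 2 * (1 + ζ.re) ^ 2 := by
    simp [sq, Complex.add_re, Complex.mul_re]
    linear_combination (-1 : ℝ) * h1
  rw [h2]
  positivity

section

variable {γ : ℕ → ℂ} {ℓ : ℕ → ℝ} {M : ℝ}

/-- A power series with Chebyshev's recurrence is the exponential of `∑ ℓ(n) wⁿ / n`. -/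
theorem tsum_eq_exp_of_recurrence (hγ0 : γ 0 = 1)
    (hrec : ∀ n : ℕ, ((n : ℂ) + 1) * γ (n + 1) =
      ∑ p ∈ Finset.HasAntidiagonal.antidiagonal n, (ℓ (p.1 + 1) : ℂ) * γ p.2)
    (hγ : ∀ n, ‖γ n‖ ≤ M) (hℓ : ∀ n : ℕ, ‖(ℓ n / n : ℂ)‖ ≤ M) {w : ℂ} (hw : ‖w‖ < 1) :
    ∑' n, γ n * w ^ n = Complex.exp (∑' n : ℕ, (ℓ n / n : ℂ) * w ^ n) := by
  have hγ' : ∀ n, ‖γ n‖ ≤ M * 1 ^ n := by simpa using hγ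
  have hℓ' : ∀ n : ℕ, ‖(ℓ n / n : ℂ)‖ ≤ M * 1 ^ n := by simpa using hℓ
  set g : ℂ → ℂ := fun w => ∑' n, γ n * w ^ n with hg
  set L : ℂ → ℂ := fun w => ∑' n : ℕ, (ℓ n / n : ℂ) * w ^ n with hL
  have hg' : ∀ z : ℂ, ‖z‖ < 1 → HasDerivAt g (∑' n : ℕ, (((n : ℂ) + 1) * γ (n + 1)) * z ^ n) z :=
    fun z hz => hasDerivAt_tsum_mul_pow hγ' one_pos (by simpa using hz)
  have hL' : ∀ z : ℂ, ‖z‖ < 1 → HasDerivAt L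
      (∑' n : ℕ, (((n : ℂ) + 1) * (ℓ (n + 1) / ((n + 1 : ℕ) : ℂ))) * z ^ n) z :=
    fun z hz => hasDerivAt_tsum_mul_pow hℓ' one_pos (by simpa using hz)
  have hode : ∀ z : ℂ, ‖z‖ < 1 → (∑' n : ℕ, (((n : ℂ) + 1) * γ (n + 1)) * z ^ n) =
      (∑' n : ℕ, (((n : ℂ) + 1) * (ℓ (n + 1) / ((n + 1 : ℕ) : ℂ))) * z ^ n) * g z := by
    intro z hz
    have hs1 := summable_norm_succ_mul_pow hℓ' one_pos (norm_nonneg z) (by simpa using hz)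
    have hs2 := summable_norm_mul_pow hγ' one_pos (w := z) (by simpa using hz)
    rw [hg, tsum_mul_tsum_eq_tsum_sum_antidiagonal_of_summable_norm
      (by simpa only [norm_mul, norm_pow] using hs1) hs2]
    refine tsum_congr fun n => ?_
    rw [hrec, Finset.sum_mul]
    refine Finset.sum_congr rfl fun p hp => ?_
    rw [← Finset.HasAntidiagonal.mem_antidiagonal.1 hp, pow_add]
    have : ((p.1 + 1 : ℕ) : ℂ) ≠ 0 := Nat.cast_ne_zero.2 (Nat.succ_ne_zero _)
    push_cast at this ⊢
    field_simp
  have hφ : ∀ z : ℂ, ‖z‖ < 1 → HasDerivAt (fun z => g z * Complex.exp (-L z)) 0 z := by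
    intro z hz
    have := (hg' z hz).mul (hL' z hz).neg.cexp
    refine this.congr_deriv ?_
    rw [hode z hz]
    ring
  have hball : ∀ z : ℂ, z ∈ Metric.ball (0 : ℂ) 1 ↔ ‖z‖ < 1 := by simp
  have hconst := Metric.isOpen_ball.is_const_of_deriv_eq_zero
    (convex_ball (0 : ℂ) 1).isPreconnected (f := fun z => g z * Complex.exp (-L z))
    (fun z hz => (hφ z ((hball z).1 hz)).differentiableAt.differentiableWithinAt)
    (fun z hz => (hφ z ((hball z).1 hz)).deriv) ((hball w).2 hw) ((hball 0).2 (by simp))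
  have hz : ∀ a : ℕ → ℂ, ∑' n, a n * (0 : ℂ) ^ n = a 0 := by
    intro a
    rw [tsum_eq_single 0 (fun n hn => by simp [hn])]
    simp
  simp only [hg, hL, hz, hγ0, Nat.cast_zero, div_zero, neg_zero, Complex.exp_zero, mul_one]
    at hconst
  rw [Complex.exp_neg, ← div_eq_mul_inv, div_eq_one_iff_eq (Complex.exp_ne_zero _)] at hconst
  exact hconst

/-- The inequality `|g(ρ)³ g(ρζ)⁴ g(ρζ²)| ≥ 1` for `|ζ| = 1`. -/
theorem one_le_norm_three_four_one (hγ0 : γ 0 = 1)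
    (hrec : ∀ n : ℕ, ((n : ℂ) + 1) * γ (n + 1) =
      ∑ p ∈ Finset.HasAntidiagonal.antidiagonal n, (ℓ (p.1 + 1) : ℂ) * γ p.2)
    (hγ : ∀ n, ‖γ n‖ ≤ M) (hℓ : ∀ n : ℕ, ‖(ℓ n / n : ℂ)‖ ≤ M) (hℓ0 : ∀ n, 0 ≤ ℓ n)
    {ρ : ℝ} (hρ0 : 0 ≤ ρ) (hρ : ρ < 1) {ζ : ℂ} (hζ : ‖ζ‖ = 1) :
    1 ≤ ‖∑' n, γ n * (ρ : ℂ) ^ n‖ ^ 3 * ‖∑' n, γ n * (ρ * ζ) ^ n‖ ^ 4 *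
      ‖∑' n, γ n * (ρ * ζ ^ 2) ^ n‖ := by
  have hn1 : ‖(ρ : ℂ)‖ < 1 := by rwa [Complex.norm_real, Real.norm_of_nonneg hρ0]
  have hn2 : ‖(ρ : ℂ) * ζ‖ < 1 := by rwa [norm_mul, hζ, mul_one]
  have hn3 : ‖(ρ : ℂ) * ζ ^ 2‖ < 1 := by rwa [norm_mul, norm_pow, hζ, one_pow, mul_one]
  have hℓ' : ∀ n : ℕ, ‖(ℓ n / n : ℂ)‖ ≤ M * 1 ^ n := by simpa using hℓ
  have hs : ∀ w : ℂ, ‖w‖ < 1 → HasSum (fun n : ℕ => (ℓ n / n : ℂ) * w ^ n)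
      (∑' n : ℕ, (ℓ n / n : ℂ) * w ^ n) := fun w hw =>
    (summable_norm_mul_pow hℓ' one_pos (by simpa using hw)).of_norm.hasSum
  rw [tsum_eq_exp_of_recurrence hγ0 hrec hγ hℓ hn1, tsum_eq_exp_of_recurrence hγ0 hrec hγ hℓ hn2,
    tsum_eq_exp_of_recurrence hγ0 hrec hγ hℓ hn3, Complex.norm_exp, Complex.norm_exp,
    Complex.norm_exp, ← Real.exp_nat_mul, ← Real.exp_nat_mul, ← Real.exp_add, ← Real.exp_add]
  refine Real.one_le_exp ?_
  have h := Complex.hasSum_re ((((hs _ hn1).mul_left 3).add ((hs _ hn2).mul_left 4)).add (hs _ hn3))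
  have h2 := h.nonneg fun n => ?_
  · simpa [Complex.add_re, Complex.mul_re] using h2
  · have h3 : 3 * ((ℓ n / n : ℂ) * (ρ : ℂ) ^ n) + 4 * ((ℓ n / n : ℂ) * (ρ * ζ) ^ n) +
        (ℓ n / n : ℂ) * (ρ * ζ ^ 2) ^ n =
        ((ℓ n / n * ρ ^ n : ℝ) : ℂ) * (3 + 4 * ζ ^ n + (ζ ^ n) ^ 2) := by
      push_cast
      ring
    rw [h3, Complex.re_ofReal_mul]
    exact mul_nonneg (by have := hℓ0 n; positivity)
      (three_add_four_mul_add_sq_re_nonneg (by rw [norm_pow, hζ, one_pow]))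

end

/-! ### Zero-free region and the prime element theorem for sequences -/

section

variable {γ : ℕ → ℂ} {c : ℂ} {C r : ℝ}

/-- The coefficients of `(1 - w) ∑ γ(n) wⁿ`. -/
def firstDiff (γ : ℕ → ℂ) (n : ℕ) : ℂ := γ n - if n = 0 then 0 else γ (n - 1)

/-- If `γ(n) = c + O(rⁿ)`, then `(1 - w) ∑ γ(n) wⁿ` continues to the disc of radius `1 / r`. -/
theorem exists_norm_firstDiff_le (hr0 : 0 < r) (hC : ∀ n, ‖γ n - c‖ ≤ C * r ^ n) :
    ∃ C', ∀ n, ‖firstDiff γ n‖ ≤ C' * r ^ n := by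
  refine ⟨C + C * r⁻¹ + ‖γ 0‖, fun n => ?_⟩
  have hC0 : 0 ≤ C := by simpa using (norm_nonneg _).trans (hC 0)
  rcases n with _ | n
  · simp only [firstDiff, if_pos, sub_zero, pow_zero, mul_one]
    have : 0 ≤ C * r⁻¹ := by positivity
    linarith
  · rw [firstDiff, if_neg (Nat.succ_ne_zero n), Nat.add_sub_cancel]
    have h1 : γ (n + 1) - γ n = (γ (n + 1) - c) - (γ n - c) := by ring
    have h2 : C * r ^ n = C * r⁻¹ * r ^ (n + 1) := by
      rw [pow_succ]; field_simp
    rw [h1]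
    refine (norm_sub_le _ _).trans ?_
    have h3 := hC (n + 1)
    have h4 := hC n
    have h5 : 0 ≤ ‖γ 0‖ * r ^ (n + 1) := by positivity
    rw [h2] at h4
    linarith

theorem tsum_firstDiff_one (hr0 : 0 < r) (hr1 : r < 1) (hC : ∀ n, ‖γ n - c‖ ≤ C * r ^ n) :
    ∑' n, firstDiff γ n * (1 : ℂ) ^ n = c := by
  obtain ⟨C', hC'⟩ := exists_norm_firstDiff_le hr0 hC
  have hs := (summable_norm_mul_pow hC' hr0 (w := 1)
    (by simpa using one_lt_inv_iff₀.2 ⟨hr0, hr1⟩)).of_norm.hasSum.tendsto_sum_nat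
  have h1 : ∀ n, ∑ i ∈ Finset.range (n + 1), firstDiff γ i * (1 : ℂ) ^ i = γ n := by
    intro n
    induction n with
    | zero => simp [firstDiff]
    | succ n ih =>
      rw [Finset.sum_range_succ, ih, firstDiff, if_neg (Nat.succ_ne_zero n), Nat.add_sub_cancel]
      simp
  have h2 : Tendsto γ atTop (𝓝 c) := by
    rw [tendsto_iff_norm_sub_tendsto_zero]
    refine squeeze_zero (fun _ => norm_nonneg _) hC ?_
    simpa using (tendsto_pow_atTop_nhds_zero_of_lt_one hr0.le hr1).const_mul C
  refine tendsto_nhds_unique ((tendsto_add_atTop_iff_nat 1).2 hs) ?_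
  simpa only [h1] using h2

/-- Summation by parts: `∑ (γ(n) - γ(n - 1)) wⁿ = (1 - w) ∑ γ(n) wⁿ`. -/
theorem tsum_firstDiff (hγ : ∃ M, ∀ n, ‖γ n‖ ≤ M) {w : ℂ} (hw : ‖w‖ < 1) :
    ∑' n, firstDiff γ n * w ^ n = (1 - w) * ∑' n, γ n * w ^ n := by
  obtain ⟨M, hM⟩ := hγ
  have hs : Summable fun n => γ n * w ^ n :=
    (summable_norm_mul_pow (r := 1) (by simpa using hM) one_pos (by simpa using hw)).of_norm
  have h1 : HasSum (fun n => (if n = 0 then 0 else γ (n - 1)) * w ^ n)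
      (w * ∑' n, γ n * w ^ n) := by
    rw [← hasSum_nat_add_iff' 1]
    simp only [Nat.add_eq_zero_iff, one_ne_zero, and_false, if_false, Nat.add_sub_cancel,
      Finset.sum_range_one, if_true, zero_mul, sub_zero]
    simpa only [mul_left_comm w, ← pow_succ'] using hs.hasSum.mul_left w
  rw [sub_mul, one_mul, ← (hs.hasSum.sub h1).tsum_eq]
  refine tsum_congr fun n => ?_
  rw [firstDiff, sub_mul]

variable {ℓ : ℕ → ℝ} {M : ℝ}

/-- The argument with `3 + 4 cos θ + cos 2θ ≥ 0`: `(1 - w) ∑ γ(n) wⁿ` has no zero on the unit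
circle apart possibly from `w = ±1`. -/
theorem tsum_firstDiff_ne_zero_of_norm_eq_one (hr0 : 0 < r) (hr1 : r < 1)
    (hC : ∀ n, ‖γ n - c‖ ≤ C * r ^ n) (hγ0 : γ 0 = 1)
    (hrec : ∀ n : ℕ, ((n : ℂ) + 1) * γ (n + 1) =
      ∑ p ∈ Finset.HasAntidiagonal.antidiagonal n, (ℓ (p.1 + 1) : ℂ) * γ p.2)
    (hγ : ∀ n, ‖γ n‖ ≤ M) (hℓ : ∀ n : ℕ, ‖(ℓ n / n : ℂ)‖ ≤ M) (hℓ0 : ∀ n, 0 ≤ ℓ n)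
    {ζ : ℂ} (hζ : ‖ζ‖ = 1) (h1 : ζ ≠ 1) (h2 : ζ ≠ -1) :
    ∑' n, firstDiff γ n * ζ ^ n ≠ 0 := by
  obtain ⟨C', hC'⟩ := exists_norm_firstDiff_le hr0 hC
  set H : ℂ → ℂ := fun w => ∑' n, firstDiff γ n * w ^ n with hH
  have hr1' : 1 < r⁻¹ := one_lt_inv_iff₀.2 ⟨hr0, hr1⟩
  have hder : ∀ w : ℂ, ‖w‖ < r⁻¹ → DifferentiableAt ℂ H w := fun w hw =>
    (hasDerivAt_tsum_mul_pow hC' hr0 hw).differentiableAt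
  intro h0
  change H ζ = 0 at h0
  -- `H` has at least a simple zero at `ζ`, so `H(ρ ζ) = O(1 - ρ)`
  obtain ⟨D, hD⟩ : ∃ D : ℝ, ∀ᶠ w in 𝓝 ζ, ‖H w‖ ≤ D * ‖w - ζ‖ := by
    have h3 := (hder ζ (by rw [hζ]; exact hr1')).isBigO_sub
    obtain ⟨D, hD⟩ := h3.bound
    refine ⟨D, ?_⟩
    filter_upwards [hD] with w hw
    simpa [h0] using hw
  have htend : Tendsto (fun ρ : ℝ => (ρ : ℂ) * ζ) (𝓝[<] 1) (𝓝 ζ) := by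
    have : Continuous fun ρ : ℝ => (ρ : ℂ) * ζ := by fun_prop
    have h4 := (this.tendsto 1).mono_left (nhdsWithin_le_nhds (s := Set.Iio 1))
    simpa using h4
  have hev : ∀ᶠ ρ : ℝ in 𝓝[<] 1, 1 ≤ ‖H ρ‖ ^ 3 * (D ^ 4 * (1 - ρ)) / ‖1 - ρ * ζ‖ ^ 4 *
      (‖H (ρ * ζ ^ 2)‖ / ‖1 - ρ * ζ ^ 2‖) := by
    have hIoo : ∀ᶠ ρ : ℝ in 𝓝[<] 1, ρ ∈ Set.Ioo (0 : ℝ) 1 := Ioo_mem_nhdsLT zero_lt_one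
    filter_upwards [hIoo, htend.eventually hD] with ρ hρ hDρ
    have hn1 : ‖(ρ : ℂ)‖ < 1 := by
      rw [Complex.norm_real, Real.norm_of_nonneg hρ.1.le]; exact hρ.2
    have hn2 : ‖(ρ : ℂ) * ζ‖ < 1 := by rwa [norm_mul, hζ, mul_one]
    have hn3 : ‖(ρ : ℂ) * ζ ^ 2‖ < 1 := by rwa [norm_mul, norm_pow, hζ, one_pow, mul_one]
    have hg : ∀ w : ℂ, ‖w‖ < 1 → ‖∑' n, γ n * w ^ n‖ = ‖H w‖ / ‖1 - w‖ := by
      intro w hw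
      have h5 : (1 - w) ≠ 0 := by
        rw [sub_ne_zero]
        rintro rfl
        simp at hw
      rw [hH]
      simp only
      rw [tsum_firstDiff ⟨M, hγ⟩ hw, norm_mul, mul_div_cancel_left₀ _ (norm_ne_zero_iff.2 h5)]
    have key := one_le_norm_three_four_one hγ0 hrec hγ hℓ hℓ0 hρ.1.le hρ.2 hζ
    rw [hg _ hn1, hg _ hn2, hg _ hn3] at key
    have h6 : ‖(1 : ℂ) - ρ‖ = 1 - ρ := by
      rw [← Complex.ofReal_one, ← Complex.ofReal_sub, Complex.norm_real,
        Real.norm_of_nonneg (by linarith [hρ.2])]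
    have h7 : ‖(ρ : ℂ) * ζ - ζ‖ = 1 - ρ := by
      have : (ρ : ℂ) * ζ - ζ = -((1 - ρ) * ζ) := by ring
      rw [this, norm_neg, norm_mul, hζ, h6, mul_one]
    rw [h7] at hDρ
    rw [h6] at key
    have hpos : 0 < 1 - ρ := by linarith [hρ.2]
    refine key.trans (mul_le_mul_of_nonneg_right ?_ (by positivity))
    calc (‖H ρ‖ / (1 - ρ)) ^ 3 * (‖H (ρ * ζ)‖ / ‖1 - ρ * ζ‖) ^ 4
        ≤ (‖H ρ‖ / (1 - ρ)) ^ 3 * (D * (1 - ρ) / ‖1 - ρ * ζ‖) ^ 4 := by gcongr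
      _ = _ := by
        rw [div_pow, div_pow]
        field_simp
  have hcont : Tendsto (fun ρ : ℝ => ‖H ρ‖ ^ 3 * (D ^ 4 * (1 - ρ)) / ‖1 - ρ * ζ‖ ^ 4 *
      (‖H (ρ * ζ ^ 2)‖ / ‖1 - ρ * ζ ^ 2‖)) (𝓝[<] 1) (𝓝 0) := by
    have hz1 : (1 : ℂ) - (1 : ℝ) * ζ ≠ 0 := by
      rw [Complex.ofReal_one, one_mul, sub_ne_zero]
      exact h1.symm
    have hz2 : (1 : ℂ) - (1 : ℝ) * ζ ^ 2 ≠ 0 := by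
      rw [Complex.ofReal_one, one_mul, sub_ne_zero]
      intro h
      rcases mul_self_eq_one_iff.1 ((sq ζ).symm.trans h.symm) with h | h
      · exact h1 h
      · exact h2 h
    have hc0 : ContinuousAt H ((1 : ℝ) : ℂ) := (hder _ (by simpa using hr1')).continuousAt
    have hc2 : ContinuousAt H (((1 : ℝ) : ℂ) * ζ ^ 2) :=
      (hder _ (by simpa [hζ] using hr1')).continuousAt
    have hc0' : ContinuousAt (fun ρ : ℝ => H ρ) 1 :=
      ContinuousAt.comp (f := fun ρ : ℝ => (ρ : ℂ)) (g := H) hc0 (by fun_prop)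
    have hc2' : ContinuousAt (fun ρ : ℝ => H (ρ * ζ ^ 2)) 1 :=
      ContinuousAt.comp (f := fun ρ : ℝ => (ρ : ℂ) * ζ ^ 2) (g := H) hc2 (by fun_prop)
    have hcont : ContinuousAt (fun ρ : ℝ => ‖H ρ‖ ^ 3 * (D ^ 4 * (1 - ρ)) / ‖1 - ρ * ζ‖ ^ 4 *
        (‖H (ρ * ζ ^ 2)‖ / ‖1 - ρ * ζ ^ 2‖)) 1 := by
      refine ContinuousAt.mul (ContinuousAt.div ?_ ?_ ?_) (ContinuousAt.div ?_ ?_ ?_)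
      · exact (hc0'.norm.pow 3).mul (by fun_prop)
      · fun_prop
      · exact pow_ne_zero _ (norm_ne_zero_iff.2 hz1)
      · exact hc2'.norm
      · fun_prop
      · exact norm_ne_zero_iff.2 hz2
    have := hcont.tendsto.mono_left (nhdsWithin_le_nhds (s := Set.Iio 1))
    simpa using this
  exact absurd (ge_of_tendsto hcont hev) (by norm_num)

/-- The prime element theorem with geometric error term, in the form `ℓ(n) = 1 + O(ρⁿ)`. -/
theorem exists_norm_sub_one_le_geometric (hr0 : 0 < r) (hr1 : r < 1)
    (hC : ∀ n, ‖γ n - c‖ ≤ C * r ^ n) (hc : c ≠ 0) (hγ0 : γ 0 = 1)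
    (hrec : ∀ n : ℕ, ((n : ℂ) + 1) * γ (n + 1) =
      ∑ p ∈ Finset.HasAntidiagonal.antidiagonal n, (ℓ (p.1 + 1) : ℂ) * γ p.2)
    (hγ : ∀ n, ‖γ n‖ ≤ M) (hℓ : ∀ n : ℕ, ‖(ℓ n / n : ℂ)‖ ≤ M) (hℓ0 : ∀ n, 0 ≤ ℓ n)
    (hneg : ∑' n, firstDiff γ n * (-1 : ℂ) ^ n ≠ 0) :
    ∃ B s : ℝ, 0 < s ∧ s < 1 ∧ ∀ n : ℕ, 1 ≤ n → ‖(ℓ n : ℂ) - 1‖ ≤ B * s ^ n := by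
  obtain ⟨C', hC'⟩ := exists_norm_firstDiff_le hr0 hC
  set H : ℂ → ℂ := fun w => ∑' n, firstDiff γ n * w ^ n with hH
  have hr1' : 1 < r⁻¹ := one_lt_inv_iff₀.2 ⟨hr0, hr1⟩
  have hdiff : DifferentiableOn ℂ H (Metric.ball 0 r⁻¹) := fun w hw =>
    (hasDerivAt_tsum_mul_pow hC' hr0 (by simpa using hw)).differentiableAt.differentiableWithinAt
  have hγ' : ∀ n, ‖γ n‖ ≤ M * 1 ^ n := by simpa using hγ
  have hℓ' : ∀ n : ℕ, ‖(ℓ n / n : ℂ)‖ ≤ M * 1 ^ n := by simpa using hℓ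
  have hg := fun (w : ℂ) (hw : ‖w‖ < 1) => tsum_eq_exp_of_recurrence hγ0 hrec hγ hℓ hw
  have hH1 : ∀ w : ℂ, ‖w‖ < 1 → H w = (1 - w) * ∑' n, γ n * w ^ n := fun w hw =>
    tsum_firstDiff ⟨M, hγ⟩ hw
  have hsub : ∀ w : ℂ, ‖w‖ < 1 → 1 - w ≠ 0 := by
    intro w hw
    rw [sub_ne_zero]
    rintro rfl
    simp at hw
  -- no zeros in the closed unit disc
  have hnz : ∀ w : ℂ, ‖w‖ ≤ 1 → H w ≠ 0 := by
    intro w hw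
    rcases hw.lt_or_eq with h | h
    · rw [hH1 w h, hg w h]
      exact mul_ne_zero (hsub w h) (Complex.exp_ne_zero _)
    · by_cases h1 : w = 1
      · rw [h1, hH]
        simp only
        rwa [tsum_firstDiff_one hr0 hr1 hC]
      · by_cases h2 : w = -1
        · rw [h2]
          exact hneg
        · exact tsum_firstDiff_ne_zero_of_norm_eq_one hr0 hr1 hC hγ0 hrec hγ hℓ hℓ0 h h1 h2
  -- hence no zeros in a larger disc, by compactness
  obtain ⟨R, hR1, hRr, hRnz⟩ : ∃ R : ℝ, 1 < R ∧ R ≤ r⁻¹ ∧ ∀ w : ℂ, ‖w‖ < R → H w ≠ 0 := by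
    have hopen : IsOpen (Metric.ball (0 : ℂ) r⁻¹ ∩ H ⁻¹' {0}ᶜ) :=
      hdiff.continuousOn.isOpen_inter_preimage Metric.isOpen_ball isOpen_compl_singleton
    obtain ⟨δ, hδ, hsubset⟩ := (isCompact_closedBall (0 : ℂ) 1).exists_thickening_subset_open
      hopen (fun w hw => ⟨by
        rw [Metric.mem_ball, dist_zero_right]
        exact (mem_closedBall_zero_iff.1 hw).trans_lt hr1', hnz w (mem_closedBall_zero_iff.1 hw)⟩)
    rw [thickening_closedBall hδ zero_le_one] at hsubset
    refine ⟨min (δ + 1) r⁻¹, lt_min (by linarith) hr1', min_le_right _ _, fun w hw => ?_⟩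
    have := hsubset (show w ∈ Metric.ball (0 : ℂ) (δ + 1) by
      simpa using hw.trans_le (min_le_left _ _))
    exact this.2
  have hf : DifferentiableOn ℂ (fun w => deriv H w / H w) (Metric.ball 0 R) := by
    refine ((hdiff.deriv Metric.isOpen_ball).mono (Metric.ball_subset_ball hRr)).div
      (hdiff.mono (Metric.ball_subset_ball hRr)) fun w hw => hRnz w (by simpa using hw)
  have hcoef : ∀ w : ℂ, ‖w‖ < 1 →
      HasSum (fun n : ℕ => ((ℓ (n + 1) : ℂ) - 1) * w ^ n) (deriv H w / H w) := by
    intro w hw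
    have hL' := hasDerivAt_tsum_mul_pow hℓ' one_pos (w := w) (by simpa using hw)
    have hs1 := (summable_norm_succ_mul_pow hℓ' one_pos (norm_nonneg w) (by simpa using hw))
    have hs1' : Summable fun n : ℕ =>
        (((n : ℂ) + 1) * (ℓ (n + 1) / ((n + 1 : ℕ) : ℂ))) * w ^ n :=
      Summable.of_norm (by simpa only [norm_mul, norm_pow] using hs1)
    set D := ∑' n : ℕ, (((n : ℂ) + 1) * (ℓ (n + 1) / ((n + 1 : ℕ) : ℂ))) * w ^ n with hD
    have hevent : H =ᶠ[𝓝 w] fun w => (1 - w) *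
        Complex.exp (∑' n : ℕ, (ℓ n / n : ℂ) * w ^ n) := by
      have : Metric.ball (0 : ℂ) 1 ∈ 𝓝 w := Metric.isOpen_ball.mem_nhds (by simpa using hw)
      filter_upwards [this] with z hz
      have hz' : ‖z‖ < 1 := by simpa using hz
      rw [hH1 z hz', hg z hz']
    have hder := (((hasDerivAt_id w).const_sub 1).mul hL'.cexp).congr_of_eventuallyEq hevent
    rw [hder.deriv, hevent.eq_of_nhds]
    have h2 := hs1'.hasSum.sub (hasSum_geometric_of_norm_lt_one hw)
    have h3 : D - (1 - w)⁻¹ = (-1 * Complex.exp (∑' n : ℕ, (ℓ n / n : ℂ) * w ^ n) +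
        (1 - id w) * (Complex.exp (∑' n : ℕ, (ℓ n / n : ℂ) * w ^ n) * D)) /
        ((1 - w) * Complex.exp (∑' n : ℕ, (ℓ n / n : ℂ) * w ^ n)) := by
      have h4 := hsub w hw
      have h5 := Complex.exp_ne_zero (∑' n : ℕ, (ℓ n / n : ℂ) * w ^ n)
      rw [id]
      field_simp
      ring
    rw [← h3]
    refine h2.congr_fun fun n => ?_
    have : ((n + 1 : ℕ) : ℂ) ≠ 0 := Nat.cast_ne_zero.2 (Nat.succ_ne_zero _)
    push_cast at this ⊢
    field_simp
  obtain ⟨ρ, hρ1, hρR⟩ := exists_between hR1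
  have hρ0 : 0 < ρ := one_pos.trans hρ1
  obtain ⟨B, hB⟩ := exists_norm_coeff_le hf hcoef hρ0 hρR
  refine ⟨B * ρ, ρ⁻¹, by positivity, inv_lt_one_of_one_lt₀ hρ1, fun n hn => ?_⟩
  obtain ⟨k, rfl⟩ := Nat.exists_eq_add_of_le' hn
  refine (hB k).trans (le_of_eq ?_)
  rw [pow_succ]
  field_simp

end

/-! ### The prime element theorem -/

namespace AdditiveArithSemigroup

variable {G : Type u} [AddCommMonoid G] (A : AdditiveArithSemigroup G) {q : ℝ}

theorem coeff_series_one (u : ℂ) (n : ℕ) :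
    PowerSeries.coeff n (A.series u fun _ => 1) = A.count n * u ^ n := by
  rw [series, PowerSeries.coeff_mk, count_eq_card]
  simp

theorem AxiomASharp.exists_geometric_bound {A : AdditiveArithSemigroup G} (hA : A.AxiomASharp q) :
    ∃ c C r : ℝ, 0 < c ∧ 0 < r ∧ r < 1 ∧
      ∀ n, ‖PowerSeries.coeff n (A.series (q : ℂ)⁻¹ fun _ => 1) - c‖ ≤ C * r ^ n := by
  obtain ⟨hq, c, η, hc, -, hη1, hO⟩ := hA
  have hq0 : 0 < q := one_pos.trans hq
  obtain ⟨C, -, hC⟩ := Asymptotics.bound_of_isBigO_nat_atTop hO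
  refine ⟨c, C, q ^ (η - 1), hc, Real.rpow_pos_of_pos hq0 _,
    Real.rpow_lt_one_of_one_lt_of_neg hq (by linarith), fun n => ?_⟩
  have h1 := hC (x := n) (Real.rpow_pos_of_pos hq0 _).ne'
  have hqn : 0 < q ^ n := pow_pos hq0 n
  rw [coeff_series_one]
  have h2 : (A.count n : ℂ) * (q : ℂ)⁻¹ ^ n - c =
      (((A.count n : ℝ) - c * q ^ n) * (q ^ n)⁻¹ : ℝ) := by
    have : (q : ℂ) ≠ 0 := by exact_mod_cast hq0.ne'
    push_cast
    rw [inv_pow]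
    field_simp
  have h3 : q ^ (η * (n : ℝ)) = (q ^ (η - 1)) ^ n * q ^ n := by
    rw [← Real.rpow_natCast (q ^ (η - 1)), ← Real.rpow_mul hq0.le, ← Real.rpow_natCast q n,
      ← Real.rpow_add hq0]
    congr 1
    ring
  rw [h2, Complex.norm_real, norm_mul, norm_inv, Real.norm_of_nonneg hqn.le,
    ← div_eq_mul_inv, div_le_iff₀ hqn]
  rw [Real.norm_of_nonneg (Real.rpow_pos_of_pos hq0 _).le, h3] at h1
  rwa [mul_assoc]

theorem AxiomASharp.exists_count_le {A : AdditiveArithSemigroup G} (hA : A.AxiomASharp q) :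
    ∃ M : ℝ, 0 < M ∧ ∀ n, (A.count n : ℝ) ≤ M * q ^ n := by
  obtain ⟨c, C, r, hc, hr0, hr1, h⟩ := hA.exists_geometric_bound
  have hq0 : 0 < q := one_pos.trans hA.1
  have hC : 0 ≤ C := by simpa using (norm_nonneg _).trans (h 0)
  refine ⟨C + c, by positivity, fun n => ?_⟩
  have h1 := h n
  rw [coeff_series_one] at h1
  have h2 : ‖(A.count n : ℂ) * (q : ℂ)⁻¹ ^ n‖ = A.count n * (q ^ n)⁻¹ := by
    rw [norm_mul, norm_pow, norm_inv, Complex.norm_natCast, Complex.norm_real,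
      Real.norm_of_nonneg hq0.le, inv_pow]
  have h3 := norm_le_norm_sub_add ((A.count n : ℂ) * (q : ℂ)⁻¹ ^ n) (c : ℂ)
  rw [h2, Complex.norm_real, Real.norm_of_nonneg hc.le] at h3
  have h4 : C * r ^ n ≤ C := mul_le_of_le_one_right hC (pow_le_one₀ hr0.le hr1.le)
  rw [← div_eq_mul_inv] at h3
  rw [← div_le_iff₀ (pow_pos hq0 n)]
  linarith

theorem AxiomASharp.exists_card_elemsLE_le {A : AdditiveArithSemigroup G}
    (hA : A.AxiomASharp q) :
    ∃ M : ℝ, 0 < M ∧ ∀ n, ((A.elemsLE n).card : ℝ) ≤ M * q ^ n := by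
  obtain ⟨M, hM, h⟩ := hA.exists_count_le
  have hq := hA.1
  have hq0 : 0 < q := one_pos.trans hq
  refine ⟨M * (q / (q - 1)), mul_pos hM (div_pos hq0 (by linarith)), fun n => ?_⟩
  have h1 := A.sum_elemsLE n fun _ => (1 : ℝ)
  simp only [Finset.sum_const, nsmul_eq_mul, mul_one] at h1
  rw [h1]
  calc ∑ k ∈ Finset.range (n + 1), ((A.elemsEq k).card : ℝ)
      ≤ ∑ k ∈ Finset.range (n + 1), M * q ^ k := by
        refine Finset.sum_le_sum fun k _ => ?_
        rw [← count_eq_card]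
        exact h k
    _ = M * ((q ^ (n + 1) - 1) / (q - 1)) := by
        rw [← Finset.mul_sum, geom_sum_eq hq.ne']
    _ ≤ M * (q ^ (n + 1) / (q - 1)) := by
        have : 0 < q - 1 := by linarith
        gcongr
        linarith
    _ = _ := by rw [pow_succ]; ring

theorem card_primesLE_le (n : ℕ) : (A.primesLE n).card ≤ (A.elemsLE n).card := by
  rw [← Finset.card_map (Function.Embedding.subtype _)]
  refine Finset.card_le_card fun P hP => ?_
  obtain ⟨P, hP', rfl⟩ := Finset.mem_map.1 hP
  exact A.mem_elemsLE.2 (A.mem_primesLE.1 hP')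

/-- The normalized von Mangoldt sum `q⁻ⁿ ∑ ∂P` over the primes with `∂P ∣ n`. -/
noncomputable def mangoldtNorm (q : ℝ) (n : ℕ) : ℝ :=
  ∑ P ∈ (A.primesIoc 0 n).filter fun P : A.primes => A.deg (P : G) ∣ n,
    (A.deg (P : G) : ℝ) * q⁻¹ ^ n

theorem coe_mangoldtNorm (q : ℝ) (n : ℕ) :
    (A.mangoldtNorm q n : ℂ) = PowerSeries.coeff n (A.mangoldtSeries (q : ℂ)⁻¹ 0) := by
  rw [mangoldtNorm, mangoldtSeries, PowerSeries.coeff_mk]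
  push_cast
  rfl

theorem mangoldtNorm_nonneg (hq : 0 < q) (n : ℕ) : 0 ≤ A.mangoldtNorm q n :=
  Finset.sum_nonneg fun _ _ => by positivity

theorem primesIoc_subset (d n : ℕ) : A.primesIoc d n ⊆ A.primesLE n := fun _ hP =>
  A.mem_primesLE.2 (A.mem_primesIoc.1 hP).2

theorem AxiomASharp.exists_mangoldtNorm_le {A : AdditiveArithSemigroup G}
    (hA : A.AxiomASharp q) : ∃ M : ℝ, 0 < M ∧ ∀ n, A.mangoldtNorm q n ≤ n * M := by
  obtain ⟨M, hM, h⟩ := hA.exists_card_elemsLE_le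
  have hq0 : 0 < q := one_pos.trans hA.1
  refine ⟨M, hM, fun n => ?_⟩
  calc A.mangoldtNorm q n ≤ ∑ P ∈ (A.primesLE n), (n : ℝ) * q⁻¹ ^ n := by
        rw [mangoldtNorm]
        refine (Finset.sum_le_sum fun P hP => ?_).trans (Finset.sum_le_sum_of_subset_of_nonneg
          ((Finset.filter_subset _ _).trans (A.primesIoc_subset _ _)) fun _ _ _ => by positivity)
        have : (A.deg (P : G) : ℝ) ≤ n := by
          exact_mod_cast (A.mem_primesIoc.1 (Finset.mem_filter.1 hP).1).2
        gcongr
    _ = (A.primesLE n).card * (n * q⁻¹ ^ n) := by rw [Finset.sum_const, nsmul_eq_mul]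
    _ ≤ (M * q ^ n) * (n * q⁻¹ ^ n) := by
        gcongr
        exact (Nat.cast_le.2 (A.card_primesLE_le n)).trans (h n)
    _ = n * M := by
        rw [inv_pow]
        have := pow_pos hq0 n
        field_simp

theorem count_recurrence (q : ℝ) (n : ℕ) :
    ((n : ℂ) + 1) * PowerSeries.coeff (n + 1) (A.series (q : ℂ)⁻¹ fun _ => 1) =
      ∑ p ∈ Finset.HasAntidiagonal.antidiagonal n, (A.mangoldtNorm q (p.1 + 1) : ℂ) *
        PowerSeries.coeff p.2 (A.series (q : ℂ)⁻¹ fun _ => 1) := by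
  have h := congrArg (PowerSeries.coeff (n + 1)) (A.X_mul_derivative_series_one (q : ℂ)⁻¹)
  rw [PowerSeries.coeff_succ_X_mul, PowerSeries.coeff_derivative, PowerSeries.coeff_mul,
    Finset.Nat.sum_antidiagonal_succ, ← coe_mangoldtNorm] at h
  have h0 : A.mangoldtNorm q 0 = 0 := by
    rw [mangoldtNorm]
    refine Finset.sum_eq_zero fun P hP => ?_
    have := A.mem_primesIoc.1 (Finset.mem_filter.1 hP).1
    omega
  rw [h0, Complex.ofReal_zero, zero_mul, zero_add] at h
  rw [mul_comm, h]
  simp only [coe_mangoldtNorm]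

theorem hasSum_primes_mangoldt (q : ℝ) (hq : 0 < q) (z : ℂ) (n : ℕ) :
    HasSum (fun P : A.primes => if A.deg (P : G) ∣ n then (A.deg (P : G) / n : ℂ) * z ^ n else 0)
      ((A.mangoldtNorm q n / n : ℂ) * (q * z) ^ n) := by
  classical
  have hq' : (q : ℂ) ≠ 0 := by exact_mod_cast hq.ne'
  have h : (A.mangoldtNorm q n / n : ℂ) * (q * z) ^ n = ∑ P ∈ A.primesIoc 0 n,
      if A.deg (P : G) ∣ n then (A.deg (P : G) / n : ℂ) * z ^ n else 0 := by
    rw [mangoldtNorm, Finset.sum_filter, Complex.ofReal_sum, Finset.sum_div, Finset.sum_mul]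
    refine Finset.sum_congr rfl fun P _ => ?_
    split_ifs
    · push_cast
      rw [inv_pow, mul_pow]
      field_simp
    · simp
  rw [h]
  refine hasSum_sum_of_ne_finset_zero fun P hP => ?_
  split_ifs with hdvd
  · rcases Nat.eq_zero_or_pos n with rfl | hn
    · simp
    · exact absurd (A.mem_primesIoc.2 ⟨A.deg_pos P P.2, Nat.le_of_dvd hn hdvd⟩) hP
  · rfl

/-- The Euler product equals the power series `∑ G^#(n) zⁿ` inside the disc of convergence. -/
theorem zeta_eq_tsum (hA : A.AxiomASharp q) {z : ℂ} (hz : ‖z‖ < q⁻¹) :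
    A.zeta z =
      ∑' n, PowerSeries.coeff n (A.series (q : ℂ)⁻¹ fun _ => 1) * ((q : ℂ) * z) ^ n := by
  classical
  have hq0 : 0 < q := one_pos.trans hA.1
  obtain ⟨M, hM, hℓ⟩ := hA.exists_mangoldtNorm_le
  obtain ⟨M', hM', hγ⟩ := hA.exists_count_le
  have hqz : ‖(q : ℂ) * z‖ < 1 := by
    rw [norm_mul, Complex.norm_real, Real.norm_of_nonneg hq0.le]
    calc q * ‖z‖ < q * q⁻¹ := by gcongr
      _ = 1 := mul_inv_cancel₀ hq0.ne'
  have hz1 : ‖z‖ < 1 := hz.trans (inv_lt_one_of_one_lt₀ hA.1)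
  have hℓ' : ∀ n : ℕ, ‖(A.mangoldtNorm q n / n : ℂ)‖ ≤ max M M' := by
    intro n
    rw [norm_div, Complex.norm_real, Complex.norm_natCast,
      Real.norm_of_nonneg (A.mangoldtNorm_nonneg hq0 n)]
    refine (div_le_of_le_mul₀ (Nat.cast_nonneg n) hM.le ?_).trans (le_max_left _ _)
    rw [mul_comm]
    exact hℓ n
  have hγ' : ∀ n, ‖PowerSeries.coeff n (A.series (q : ℂ)⁻¹ fun _ => 1)‖ ≤ max M M' := by
    intro n
    rw [coeff_series_one, norm_mul, norm_pow, norm_inv, Complex.norm_natCast, Complex.norm_real,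
      Real.norm_of_nonneg hq0.le, inv_pow, ← div_eq_mul_inv]
    exact (div_le_of_le_mul₀ (by positivity) hM'.le (hγ n)).trans (le_max_right _ _)
  have hγ0 : PowerSeries.coeff 0 (A.series (q : ℂ)⁻¹ fun _ => 1) = 1 := by
    rw [coeff_series_one, count_eq_card, elemsEq_zero]
    simp
  rw [tsum_eq_exp_of_recurrence hγ0 (A.count_recurrence q) hγ' hℓ' hqz]
  set t : ℕ → A.primes → ℂ := fun n P =>
    if A.deg (P : G) ∣ n then (A.deg (P : G) / n : ℂ) * z ^ n else 0 with ht
  have hrow : ∀ n, HasSum (t n) ((A.mangoldtNorm q n / n : ℂ) * (q * z) ^ n) := fun n =>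
    A.hasSum_primes_mangoldt q hq0 z n
  have hnorm : ∀ n, HasSum (fun P => ‖t n P‖) ‖(A.mangoldtNorm q n / n : ℂ) * (q * z) ^ n‖ := by
    intro n
    have h1 := Complex.hasSum_re (A.hasSum_primes_mangoldt q hq0 (‖z‖ : ℂ) n)
    have h2 : ((A.mangoldtNorm q n / n : ℂ) * (q * (‖z‖ : ℂ)) ^ n).re =
        ‖(A.mangoldtNorm q n / n : ℂ) * (q * z) ^ n‖ := by
      rw [norm_mul, norm_div, norm_pow, norm_mul, Complex.norm_real, Complex.norm_real,
        Complex.norm_natCast, Real.norm_of_nonneg hq0.le,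
        Real.norm_of_nonneg (A.mangoldtNorm_nonneg hq0 n)]
      norm_cast
    rw [h2] at h1
    refine h1.congr_fun fun P => ?_
    simp only [ht]
    split_ifs
    · have h3 : (A.deg (P : G) / n : ℂ) * (‖z‖ : ℂ) ^ n =
          ((A.deg (P : G) / n * ‖z‖ ^ n : ℝ) : ℂ) := by push_cast; rfl
      rw [h3, Complex.ofReal_re, norm_mul, norm_div, norm_pow, Complex.norm_natCast,
        Complex.norm_natCast]
    · simp
  have hsum : Summable (Function.uncurry t) := by
    refine Summable.of_norm ((summable_prod_of_nonneg fun _ => norm_nonneg _).2 ⟨?_, ?_⟩)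
    · exact fun n => (hnorm n).summable
    · have h1 : (fun n => ∑' P, ‖Function.uncurry t (n, P)‖) =
          fun n => ‖(A.mangoldtNorm q n / n : ℂ) * (q * z) ^ n‖ := by
        ext n
        exact (hnorm n).tsum_eq
      rw [h1]
      exact summable_norm_mul_pow (C := max M M') (r := 1)
        (by simpa only [one_pow, mul_one] using hℓ') one_pos (by simpa using hqz)
  have hpow : ∀ P : A.primes, ‖z ^ A.deg (P : G)‖ < 1 := fun P => by
    rw [norm_pow]
    exact pow_lt_one₀ (norm_nonneg _) hz1 (A.deg_pos P P.2).ne'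
  have hlog : ∀ P : A.primes, Complex.log ((1 - z ^ A.deg (P : G))⁻¹) =
      -Complex.log (1 - z ^ A.deg (P : G)) := fun P => by
    refine Complex.log_inv _ (Complex.slitPlane_arg_ne_pi ?_)
    have := Complex.mem_slitPlane_of_norm_lt_one (z := -(z ^ A.deg (P : G)))
      (by rw [norm_neg]; exact hpow P)
    rwa [← sub_eq_add_neg] at this
  have hcol : ∀ P : A.primes, HasSum (fun n => t n P)
      (Complex.log ((1 - z ^ A.deg (P : G))⁻¹)) := by
    intro P
    have he := A.deg_pos P P.2
    have h1 := Complex.hasSum_taylorSeries_neg_log (hpow P)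
    rw [hlog]
    have hinj : Function.Injective fun k : ℕ => A.deg (P : G) * k := fun a b h =>
      Nat.eq_of_mul_eq_mul_left he h
    rw [← hinj.hasSum_iff]
    · refine h1.congr_fun fun k => ?_
      have he' : (A.deg (P : G) : ℂ) ≠ 0 := Nat.cast_ne_zero.2 he.ne'
      simp only [Function.comp, ht, dvd_mul_right, if_true]
      rw [← pow_mul]
      push_cast
      rcases Nat.eq_zero_or_pos k with rfl | hk
      · simp
      · have hk' : (k : ℂ) ≠ 0 := Nat.cast_ne_zero.2 hk.ne'
        field_simp
    · intro n hn
      simp only [ht]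
      rw [if_neg]
      rintro ⟨k, rfl⟩
      exact hn ⟨k, rfl⟩
  have hne : ∀ P : A.primes, (1 - z ^ A.deg (P : G))⁻¹ ≠ 0 := fun P => by
    refine inv_ne_zero (sub_ne_zero.2 fun h => ?_)
    have := hpow P
    rw [← h] at this
    simp at this
  have hsl : Summable fun P : A.primes => Complex.log ((1 - z ^ A.deg (P : G))⁻¹) := by
    refine (hsum.prod_symm.prod).congr fun P => ?_
    exact (hcol P).tsum_eq
  rw [zeta, ← Complex.cexp_tsum_eq_tprod hne hsl]
  congr 1
  have h1 := hsum.tsum_comm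
  calc ∑' P : A.primes, Complex.log ((1 - z ^ A.deg (P : G))⁻¹) = ∑' P, ∑' n, t n P :=
        tsum_congr fun P => (hcol P).tsum_eq.symm
    _ = ∑' n, ∑' P, t n P := h1
    _ = _ := tsum_congr fun n => (hrow n).tsum_eq

/-- The analytic continuation of `(1 - q z) Z(z)` does not vanish at `z = -1/q`. -/
theorem tsum_firstDiff_neg_one_ne_zero (hA : A.AxiomASharp q) (hZ : A.ZetaNeZero q) :
    ∑' n, firstDiff (fun n => PowerSeries.coeff n (A.series (q : ℂ)⁻¹ fun _ => 1)) n *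
      (-1 : ℂ) ^ n ≠ 0 := by
  have hq0 : 0 < q := one_pos.trans hA.1
  have hq' : (q : ℂ) ≠ 0 := by exact_mod_cast hq0.ne'
  obtain ⟨c, C, r, hc, hr0, hr1, hC⟩ := hA.exists_geometric_bound
  obtain ⟨C', hC'⟩ := exists_norm_firstDiff_le hr0 hC
  obtain ⟨F, hF, hFZ, hF0⟩ := hZ
  set γ : ℕ → ℂ := fun n => PowerSeries.coeff n (A.series (q : ℂ)⁻¹ fun _ => 1) with hγ
  have hγb : ∃ M, ∀ n, ‖γ n‖ ≤ M := by
    refine ⟨C + c, fun n => ?_⟩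
    have hC0 : 0 ≤ C := by simpa using (norm_nonneg _).trans (hC 0)
    have h3 := norm_le_norm_sub_add (γ n) (c : ℂ)
    rw [Complex.norm_real, Real.norm_of_nonneg hc.le] at h3
    have h4 : C * r ^ n ≤ C := mul_le_of_le_one_right hC0 (pow_le_one₀ hr0.le hr1.le)
    have h5 := hC n
    simp only [hγ] at h3 ⊢
    linarith
  set H : ℂ → ℂ := fun w => ∑' n, firstDiff γ n * w ^ n with hH
  have hcont : ContinuousAt H (-1) :=
    (hasDerivAt_tsum_mul_pow hC' hr0
      (by simpa using one_lt_inv_iff₀.2 ⟨hr0, hr1⟩)).differentiableAt.continuousAt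
  have hlim1 : Tendsto (fun z : ℂ => H (q * z)) (𝓝[Metric.ball (0 : ℂ) q⁻¹] (-(q : ℂ)⁻¹))
      (𝓝 (H (-1))) := by
    have h1 : (q : ℂ) * -(q : ℂ)⁻¹ = -1 := by field_simp
    have h2 : ContinuousAt (fun z : ℂ => H (q * z)) (-(q : ℂ)⁻¹) :=
      ContinuousAt.comp (g := H) (f := fun z : ℂ => (q : ℂ) * z) (by rw [h1]; exact hcont)
        (by fun_prop)
    have h3 := h2.tendsto.mono_left (nhdsWithin_le_nhds (s := Metric.ball (0 : ℂ) q⁻¹))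
    rwa [h1] at h3
  have hlim2 : Tendsto (fun z : ℂ => (1 - q * z) * F z)
      (𝓝[Metric.ball (0 : ℂ) q⁻¹] (-(q : ℂ)⁻¹)) (𝓝 (2 * F (-(q : ℂ)⁻¹))) := by
    have h1 : (1 : ℂ) - q * -(q : ℂ)⁻¹ = 2 := by field_simp; norm_num
    have h2 : ContinuousAt (fun z : ℂ => (1 - q * z) * F z) (-(q : ℂ)⁻¹) :=
      ContinuousAt.mul (by fun_prop) hF.continuousAt
    have h3 := h2.tendsto.mono_left (nhdsWithin_le_nhds (s := Metric.ball (0 : ℂ) q⁻¹))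
    rwa [h1] at h3
  have heq : (fun z : ℂ => H (q * z)) =ᶠ[𝓝[Metric.ball (0 : ℂ) q⁻¹] (-(q : ℂ)⁻¹)]
      fun z : ℂ => (1 - q * z) * F z := by
    filter_upwards [hFZ, self_mem_nhdsWithin] with z hz hzball
    have hz' : ‖z‖ < q⁻¹ := by simpa using hzball
    have hqz : ‖(q : ℂ) * z‖ < 1 := by
      rw [norm_mul, Complex.norm_real, Real.norm_of_nonneg hq0.le]
      calc q * ‖z‖ < q * q⁻¹ := by gcongr
        _ = 1 := mul_inv_cancel₀ hq0.ne'
    rw [hz, A.zeta_eq_tsum hA hz', hH]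
    exact tsum_firstDiff hγb hqz
  have hbot : (𝓝[Metric.ball (0 : ℂ) q⁻¹] (-(q : ℂ)⁻¹)).NeBot := by
    rw [← mem_closure_iff_nhdsWithin_neBot, closure_ball _ (inv_pos.2 hq0).ne']
    simp [abs_of_pos hq0]
  have := tendsto_nhds_unique hlim1 (hlim2.congr' heq.symm)
  change H (-1) ≠ 0
  rw [this]
  exact mul_ne_zero two_ne_zero hF0

/-- The prime element theorem: `q⁻ⁿ ∑_{∂P ∣ n} ∂P = 1 + O(sⁿ)` for some `s < 1`. -/
theorem exists_mangoldt_geometric_bound (hA : A.AxiomASharp q) (hZ : A.ZetaNeZero q) :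
    ∃ B s : ℝ, 0 < s ∧ s < 1 ∧ ∀ n : ℕ, 1 ≤ n → ‖(A.mangoldtNorm q n : ℂ) - 1‖ ≤ B * s ^ n := by
  have hq0 : 0 < q := one_pos.trans hA.1
  obtain ⟨c, C, r, hc, hr0, hr1, hC⟩ := hA.exists_geometric_bound
  obtain ⟨M, hM, hℓ⟩ := hA.exists_mangoldtNorm_le
  obtain ⟨M', hM', hγ⟩ := hA.exists_count_le
  have hγ0 : PowerSeries.coeff 0 (A.series (q : ℂ)⁻¹ fun _ => 1) = 1 := by
    rw [coeff_series_one, count_eq_card, elemsEq_zero]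
    simp
  refine exists_norm_sub_one_le_geometric (M := max M M') hr0 hr1 hC
    (by exact_mod_cast hc.ne') hγ0 (A.count_recurrence q) ?_ ?_
    (A.mangoldtNorm_nonneg hq0) (A.tsum_firstDiff_neg_one_ne_zero hA hZ)
  · intro n
    rw [coeff_series_one, norm_mul, norm_pow, norm_inv, Complex.norm_natCast, Complex.norm_real,
      Real.norm_of_nonneg hq0.le, inv_pow, ← div_eq_mul_inv]
    exact (div_le_of_le_mul₀ (by positivity) hM'.le (hγ n)).trans (le_max_right _ _)
  · intro n
    rw [norm_div, Complex.norm_real, Complex.norm_natCast,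
      Real.norm_of_nonneg (A.mangoldtNorm_nonneg hq0 n)]
    refine (div_le_of_le_mul₀ (Nat.cast_nonneg n) hM.le ?_).trans (le_max_left _ _)
    rw [mul_comm]
    exact hℓ n

/-! ### Alladi's formula by degree of the least prime factor -/

/-- Discarding the primes of degree at most `d` changes the von Mangoldt sum of index `k > d` only
by the primes of degree at most `k / 2`. -/
theorem norm_mangoldtSeries_sub_le (hA : A.AxiomASharp q) :
    ∃ M σ : ℝ, 0 < σ ∧ σ < 1 ∧ 0 ≤ M ∧ ∀ d k : ℕ, d < k →
      ‖PowerSeries.coeff k (A.mangoldtSeries (q : ℂ)⁻¹ 0) -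
        PowerSeries.coeff k (A.mangoldtSeries (q : ℂ)⁻¹ d)‖ ≤ M * (k * σ ^ k) := by
  classical
  obtain ⟨M, hM, h⟩ := hA.exists_card_elemsLE_le
  have hq := hA.1
  have hq0 : 0 < q := one_pos.trans hq
  have hsq : 1 < √q := by rwa [Real.lt_sqrt zero_le_one, one_pow]
  refine ⟨M, (√q)⁻¹, by positivity, inv_lt_one_of_one_lt₀ hsq, hM.le, fun d k hdk => ?_⟩
  have hsplit : ∑ P ∈ (A.primesIoc 0 k).filter (fun P : A.primes => A.deg (P : G) ∣ k),
        (A.deg (P : G) : ℂ) * (q : ℂ)⁻¹ ^ k =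
      ∑ P ∈ ((A.primesIoc 0 k).filter fun P : A.primes => A.deg (P : G) ∣ k).filter
        (fun P : A.primes => A.deg (P : G) ≤ d), (A.deg (P : G) : ℂ) * (q : ℂ)⁻¹ ^ k +
      ∑ P ∈ (A.primesIoc d k).filter (fun P : A.primes => A.deg (P : G) ∣ k),
        (A.deg (P : G) : ℂ) * (q : ℂ)⁻¹ ^ k := by
    rw [← Finset.sum_filter_add_sum_filter_not _ (fun P : A.primes => A.deg (P : G) ≤ d)]
    congr 1
    refine Finset.sum_congr ?_ fun _ _ => rfl
    ext P
    have := A.deg_pos P P.2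
    simp only [Finset.mem_filter, mem_primesIoc, not_le]
    tauto
  rw [mangoldtSeries, mangoldtSeries, PowerSeries.coeff_mk, PowerSeries.coeff_mk, hsplit,
    add_sub_cancel_right]
  refine (norm_sum_le _ _).trans ?_
  calc _ ≤ ∑ P ∈ A.primesLE (k / 2), (k : ℝ) * q⁻¹ ^ k := by
        refine (Finset.sum_le_sum fun P hP => ?_).trans
          (Finset.sum_le_sum_of_subset_of_nonneg ?_ fun _ _ _ => by positivity)
        · rw [norm_mul, norm_pow, norm_inv, Complex.norm_natCast, Complex.norm_real,
            Real.norm_of_nonneg hq0.le]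
          have h1 : (A.deg (P : G) : ℝ) ≤ k := by
            have := (Finset.mem_filter.1 hP).2
            exact_mod_cast this.trans hdk.le
          gcongr
        · intro P hP
          simp only [Finset.mem_filter] at hP
          -- a proper divisor of `k` is at most `k / 2`
          obtain ⟨⟨-, j, hj⟩, hd⟩ := hP
          rw [mem_primesLE, Nat.le_div_iff_mul_le two_pos, hj]
          refine Nat.mul_le_mul_left _ ?_
          by_contra hj2
          have hj1 : j = 0 ∨ j = 1 := by omega
          rcases hj1 with rfl | rfl <;> omega
    _ = (A.primesLE (k / 2)).card * (k * q⁻¹ ^ k) := by rw [Finset.sum_const, nsmul_eq_mul]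
    _ ≤ (M * q ^ (k / 2)) * (k * q⁻¹ ^ k) := by
        gcongr
        exact (Nat.cast_le.2 (A.card_primesLE_le _)).trans (h _)
    _ = M * (k * (q ^ (k / 2) * q⁻¹ ^ k)) := by ring
    _ ≤ M * (k * (√q)⁻¹ ^ k) := by
        have h1 : q ^ (k / 2) ≤ √q ^ k := by
          conv_lhs => rw [← Real.sq_sqrt hq0.le, ← pow_mul]
          exact pow_le_pow_right₀ hsq.le (Nat.mul_div_le k 2)
        have h2 : q⁻¹ ^ k = (√q)⁻¹ ^ k * (√q)⁻¹ ^ k := by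
          rw [← mul_pow, ← mul_inv, Real.mul_self_sqrt hq0.le]
        have h3 : √q ^ k * (√q)⁻¹ ^ k = 1 := by
          rw [← mul_pow, mul_inv_cancel₀ (by positivity), one_pow]
        have h4 : q ^ (k / 2) * q⁻¹ ^ k ≤ (√q)⁻¹ ^ k := by
          calc q ^ (k / 2) * q⁻¹ ^ k ≤ √q ^ k * q⁻¹ ^ k := by gcongr
            _ = (√q)⁻¹ ^ k := by rw [h2, ← mul_assoc, h3, one_mul]
        gcongr

/-- Uniform bounds for `m(d, x)`. -/
theorem exists_moebiusSum_bound (hA : A.AxiomASharp q) (hZ : A.ZetaNeZero q) :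
    ∃ B : ℝ, 0 < B ∧ (∀ d x, ‖A.moebiusSum (q : ℂ)⁻¹ d x‖ ≤ B) ∧
      ∀ d x : ℕ, x * ‖A.moebiusSum (q : ℂ)⁻¹ d x‖ ≤ B * (d + 1) := by
  obtain ⟨M, σ, hσ0, hσ1, hM, h⟩ := A.norm_mangoldtSeries_sub_le hA
  obtain ⟨B, s, hs0, hs1, hB⟩ := A.exists_mangoldt_geometric_bound hA hZ
  refine exists_bound_of_delay_equation (s := fun k => |B| * s ^ k + M * (k * σ ^ k)) ?_ ?_
    (A.moebiusSum_zero _) (A.moebiusSum_recurrence _) ?_ ?_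
  · refine ((summable_geometric_of_lt_one hs0.le hs1).mul_left _).add (Summable.mul_left _ ?_)
    simpa using summable_pow_mul_geometric_of_norm_lt_one 1
      (by rwa [Real.norm_of_nonneg hσ0.le] : ‖σ‖ < 1)
  · intro k
    positivity
  · intro d k _ hk
    rw [sub_eq_self, mangoldtSeries, PowerSeries.coeff_mk]
    refine Finset.sum_eq_zero fun P hP => ?_
    have := A.mem_primesIoc.1 (Finset.mem_filter.1 hP).1
    omega
  · intro d k hk
    have h1 := hB k (by omega)
    rw [coe_mangoldtNorm] at h1
    have h2 : (1 : ℂ) - PowerSeries.coeff k (A.mangoldtSeries (q : ℂ)⁻¹ d) =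
        -(PowerSeries.coeff k (A.mangoldtSeries (q : ℂ)⁻¹ 0) - 1) +
        (PowerSeries.coeff k (A.mangoldtSeries (q : ℂ)⁻¹ 0) -
          PowerSeries.coeff k (A.mangoldtSeries (q : ℂ)⁻¹ d)) := by ring
    rw [h2]
    refine (norm_add_le _ _).trans (add_le_add ?_ (h d k hk))
    rw [norm_neg]
    exact h1.trans (mul_le_mul_of_nonneg_right (le_abs_self B) (by positivity))

/-- The finite set of primes of degree exactly `d`. -/
noncomputable def primesEq (d : ℕ) : Finset A.primes :=
  (A.primesLE d).filter fun P : A.primes => A.deg (P : G) = d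

theorem mem_primesEq {d : ℕ} {P : A.primes} : P ∈ A.primesEq d ↔ A.deg (P : G) = d := by
  simp only [primesEq, Finset.mem_filter, mem_primesLE]
  omega

open Classical in
theorem primeCount_eq_card {S : Set G} (hS : S ⊆ A.primes) (d : ℕ) :
    A.primeCount S d = ((A.primesEq d).filter fun P : A.primes => (P : G) ∈ S).card := by
  rw [primeCount, ← Finset.card_map (Function.Embedding.subtype _), ← Set.ncard_coe_finset]
  congr 1
  ext P
  simp only [Finset.coe_map, Function.Embedding.coe_subtype, Set.mem_image, Finset.mem_coe,
    Finset.mem_filter, mem_primesEq, Set.mem_ofPred_eq]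
  constructor
  · rintro ⟨hP, h⟩
    exact ⟨⟨P, hS hP⟩, ⟨h, hP⟩, rfl⟩
  · rintro ⟨P, ⟨h, hP⟩, rfl⟩
    exact ⟨hP, h⟩

theorem primeCount_le {S : Set G} (hS : S ⊆ A.primes) (d : ℕ) :
    A.primeCount S d ≤ A.primeCount A.primes d := by
  classical
  rw [A.primeCount_eq_card hS, A.primeCount_eq_card subset_rfl]
  refine Finset.card_le_card fun P hP => ?_
  rw [Finset.mem_filter] at hP ⊢
  exact ⟨hP.1, P.2⟩

/-- Chebyshev's upper bound `π(d) ≪ q^d / d`. -/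
theorem exists_primeCount_le (hA : A.AxiomASharp q) (hZ : A.ZetaNeZero q) :
    ∃ C : ℝ, 0 < C ∧ ∀ d : ℕ, 1 ≤ d → (A.primeCount A.primes d : ℝ) * q⁻¹ ^ d ≤ C / d := by
  classical
  have hq0 : 0 < q := one_pos.trans hA.1
  obtain ⟨B, s, hs0, hs1, hB⟩ := A.exists_mangoldt_geometric_bound hA hZ
  refine ⟨1 + |B|, by positivity, fun d hd => ?_⟩
  have hd0 : (0 : ℝ) < d := by exact_mod_cast hd
  rw [le_div_iff₀ hd0]
  have h1 : (A.primeCount A.primes d : ℝ) * q⁻¹ ^ d * d ≤ A.mangoldtNorm q d := by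
    rw [A.primeCount_eq_card subset_rfl, mangoldtNorm, mul_assoc, ← nsmul_eq_mul,
      ← Finset.sum_const]
    calc _ = ∑ P ∈ (A.primesEq d).filter (fun P : A.primes => (P : G) ∈ A.primes),
          (A.deg (P : G) : ℝ) * q⁻¹ ^ d := by
          refine Finset.sum_congr rfl fun P hP => ?_
          rw [A.mem_primesEq.1 (Finset.mem_filter.1 hP).1, mul_comm]
      _ ≤ _ := by
          refine Finset.sum_le_sum_of_subset_of_nonneg (fun P hP => ?_)
            fun _ _ _ => by positivity
          have h := A.mem_primesEq.1 (Finset.mem_filter.1 hP).1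
          rw [Finset.mem_filter, mem_primesIoc, h]
          exact ⟨⟨hd, le_rfl⟩, dvd_rfl⟩
  have h2 := hB d hd
  have h3 : ‖(A.mangoldtNorm q d : ℂ) - 1‖ = |A.mangoldtNorm q d - 1| := by
    rw [← Complex.ofReal_one, ← Complex.ofReal_sub, Complex.norm_real, Real.norm_eq_abs]
  rw [h3] at h2
  have h4 : B * s ^ d ≤ |B| :=
    (mul_le_mul_of_nonneg_right (le_abs_self B) (by positivity)).trans
      (mul_le_of_le_one_right (abs_nonneg B) (pow_le_one₀ hs0.le hs1.le))
  have h5 := le_abs_self (A.mangoldtNorm q d - 1)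
  linarith

/-- Every degree contributes `O(1/n)` to Alladi's sum. -/
theorem exists_weight_bound (hA : A.AxiomASharp q) (hZ : A.ZetaNeZero q) :
    ∃ K : ℝ, 0 < K ∧ ∀ d n : ℕ, 1 ≤ d → d ≤ n → (A.primeCount A.primes d : ℝ) * q⁻¹ ^ d *
      ‖A.moebiusSum (q : ℂ)⁻¹ d (n - d)‖ ≤ K / n := by
  obtain ⟨B, hB0, hB1, hB2⟩ := A.exists_moebiusSum_bound hA hZ
  obtain ⟨C, hC0, hC⟩ := A.exists_primeCount_le hA hZ
  refine ⟨4 * C * B, by positivity, fun d n hd hdn => ?_⟩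
  have hd0 : (0 : ℝ) < d := by exact_mod_cast hd
  have hd1 : (1 : ℝ) ≤ d := by exact_mod_cast hd
  have hn0 : (0 : ℝ) < n := by exact_mod_cast hd.trans hdn
  refine (mul_le_mul_of_nonneg_right (hC d hd) (norm_nonneg _)).trans ?_
  rw [div_mul_eq_mul_div, div_le_div_iff₀ hd0 hn0]
  set y := ‖A.moebiusSum (q : ℂ)⁻¹ d (n - d)‖ with hy
  have hy0 : 0 ≤ y := norm_nonneg _
  suffices h : y * n ≤ 4 * B * d by nlinarith
  have h1 := hB1 d (n - d)
  have h2 := hB2 d (n - d)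
  rw [Nat.cast_sub hdn] at h2
  rw [← hy] at h1 h2
  rcases le_total (n : ℝ) (2 * d) with h | h
  · nlinarith
  · nlinarith

theorem moebiusSum_self (u : ℂ) (n : ℕ) : A.moebiusSum u n n = 1 := by
  rw [moebiusSum_eq, Finset.sum_congr rfl (fun k hk => A.coeff_roughSeries u (N := n)
    (by have := Finset.mem_range.1 hk; omega))]
  have : A.primesIoc n n = ∅ := by
    ext P
    simp only [mem_primesIoc, Finset.notMem_empty, iff_false]
    omega
  rw [this, eulerProd, Finset.prod_empty]
  simp [PowerSeries.coeff_one]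

open PowerSeries in
theorem moebiusSum_sub_one (u : ℂ) {d : ℕ} (hd : 1 ≤ d) (n : ℕ) :
    A.moebiusSum u (d - 1) n = ∑ t ∈ Finset.range (A.primeCount A.primes d + 1),
      (-1) ^ t * ((A.primeCount A.primes d).choose t : ℂ) * u ^ (d * t) *
        if d * t ≤ n then A.moebiusSum u d (n - d * t) else 0 := by
  rw [moebiusSum, A.roughSeries_sub_one u hd, mul_assoc, sub_eq_add_neg, add_comm, add_pow,
    Finset.sum_mul, map_sum]
  refine Finset.sum_congr rfl fun t _ => ?_
  have h1 : (-(C u * X : ℂ⟦X⟧) ^ d) ^ t * 1 ^ (A.primeCount A.primes d - t) *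
      ((A.primeCount A.primes d).choose t : ℂ⟦X⟧) *
      (A.roughSeries u d * PowerSeries.mk fun _ => 1) =
      C ((-1) ^ t * ((A.primeCount A.primes d).choose t : ℂ) * u ^ (d * t)) *
        ((A.roughSeries u d * PowerSeries.mk fun _ => 1) * X ^ (d * t)) := by
    rw [neg_pow, ← pow_mul, mul_pow]
    simp only [map_mul, map_pow, map_neg, map_one, map_natCast, one_pow]
    ring
  rw [h1, coeff_C_mul, coeff_mul_X_pow']
  rfl

theorem tendsto_moebiusSum (hA : A.AxiomASharp q) (hZ : A.ZetaNeZero q) (d : ℕ) :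
    Tendsto (fun n => A.moebiusSum (q : ℂ)⁻¹ d n) atTop (𝓝 0) := by
  obtain ⟨B, hB0, hB1, hB2⟩ := A.exists_moebiusSum_bound hA hZ
  refine squeeze_zero_norm' ?_ (tendsto_const_div_atTop_nhds_zero_nat (B * (d + 1)))
  filter_upwards [eventually_gt_atTop 0] with n hn
  rw [le_div_iff₀ (by exact_mod_cast hn), mul_comm]
  exact hB2 d n

/-- Alladi's formula for the set of all primes. It follows from the telescoping sum of
`m(d - 1, n) - m(d, n)`: the squarefree elements with at least two prime factors of least degree
contribute `o(1)`. -/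
theorem tendsto_sum_all_primes (hA : A.AxiomASharp q) (hZ : A.ZetaNeZero q) :
    Tendsto (fun n : ℕ => ∑ d ∈ Finset.range n, (A.primeCount A.primes (d + 1) : ℂ) *
      (q : ℂ)⁻¹ ^ (d + 1) * A.moebiusSum (q : ℂ)⁻¹ (d + 1) (n - (d + 1))) atTop (𝓝 1) := by
  obtain ⟨B, hB0, hB1, hB2⟩ := A.exists_moebiusSum_bound hA hZ
  obtain ⟨C, hC0, hC⟩ := A.exists_primeCount_le hA hZ
  have hq0 : 0 < q := one_pos.trans hA.1
  set u : ℂ := (q : ℂ)⁻¹ with hu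
  set p : ℕ → ℕ := fun d => A.primeCount A.primes d with hp
  set term : ℕ → ℕ → ℕ → ℂ := fun d n t => (-1) ^ t * ((p d).choose t : ℂ) * u ^ (d * t) *
        if d * t ≤ n then A.moebiusSum u d (n - d * t) else 0 with hterm
  set R : ℕ → ℕ → ℂ := fun d n => ∑ t ∈ Finset.Ico 2 (p d + 1), term d n t with hR
  have hRsum : ∀ d n, 1 ≤ d → d ≤ n → R d n =
      A.moebiusSum u (d - 1) n - A.moebiusSum u d n +
        (p d : ℂ) * u ^ d * A.moebiusSum u d (n - d) := by
    intro d n hd hdn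
    have h1 : A.moebiusSum u (d - 1) n = ∑ t ∈ Finset.range (p d + 1), term d n t :=
      A.moebiusSum_sub_one u hd n
    have h0 : term d n 0 = A.moebiusSum u d n := by simp [hterm]
    have h2 : term d n 1 = -((p d : ℂ) * u ^ d * A.moebiusSum u d (n - d)) := by
      simp [hterm, hdn]
    rcases Nat.eq_zero_or_pos (p d) with hpd | hpd
    · have h3 : R d n = 0 := by
        simp only [hR, hpd]
        rfl
      rw [h1, h3, hpd]
      simp [h0]
    · rw [h1, Finset.range_eq_Ico, Finset.sum_eq_sum_Ico_succ_bot (by omega),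
        Finset.sum_eq_sum_Ico_succ_bot (by omega), h0, h2]
      simp only [hR]
      ring
  have htermnorm : ∀ d n t, ‖term d n t‖ ≤ ((p d).choose t : ℝ) * (q⁻¹ ^ d) ^ t * B := by
    intro d n t
    simp only [hterm]
    rw [norm_mul, norm_mul, norm_mul, norm_pow, norm_neg, norm_one, one_pow, one_mul,
      Complex.norm_natCast, norm_pow, hu, norm_inv, Complex.norm_real,
      Real.norm_of_nonneg hq0.le, ← pow_mul]
    gcongr
    split_ifs
    · exact hB1 _ _
    · rw [norm_zero]; exact hB0.le
  have hRnorm : ∀ d n, 1 ≤ d → ‖R d n‖ ≤ B * Real.exp C * (1 / (d : ℝ) ^ 2) := by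
    intro d n hd
    have hd1 : (1 : ℝ) ≤ d := by exact_mod_cast hd
    have hd0 : (0 : ℝ) < d := by linarith
    calc ‖R d n‖ ≤ ∑ t ∈ Finset.Ico 2 (p d + 1), (1 / (d : ℝ) ^ 2) * (C ^ t / t.factorial) * B := by
          refine (norm_sum_le _ _).trans (Finset.sum_le_sum fun t ht => (htermnorm d n t).trans ?_)
          refine mul_le_mul_of_nonneg_right ?_ hB0.le
          have h2 := (Finset.mem_Ico.1 ht).1
          calc ((p d).choose t : ℝ) * (q⁻¹ ^ d) ^ t
              ≤ ((p d : ℝ) ^ t / t.factorial) * (q⁻¹ ^ d) ^ t := by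
                gcongr
                exact Nat.choose_le_pow_div t (p d)
            _ = ((p d : ℝ) * q⁻¹ ^ d) ^ t / t.factorial := by rw [mul_pow]; ring
            _ ≤ (C / d) ^ t / t.factorial := by gcongr; exact hC d hd
            _ = (1 / (d : ℝ) ^ t) * (C ^ t / t.factorial) := by rw [div_pow]; ring
            _ ≤ (1 / (d : ℝ) ^ 2) * (C ^ t / t.factorial) := by gcongr
      _ = B * ((∑ t ∈ Finset.Ico 2 (p d + 1), C ^ t / t.factorial) * (1 / (d : ℝ) ^ 2)) := by
          rw [← Finset.sum_mul, ← Finset.mul_sum]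
          ring
      _ ≤ B * (Real.exp C * (1 / (d : ℝ) ^ 2)) := by
          gcongr
          refine le_trans ?_ (Real.sum_le_exp_of_nonneg hC0.le (p d + 1))
          refine Finset.sum_le_sum_of_subset_of_nonneg (fun t ht => ?_) fun _ _ _ => by positivity
          exact Finset.mem_range.2 (Finset.mem_Ico.1 ht).2
      _ = _ := by ring
  have hRlim : ∀ d, Tendsto (fun n => R d n) atTop (𝓝 0) := by
    intro d
    have h1 : ∀ t, Tendsto (fun n => term d n t) atTop (𝓝 0) := by
      intro t
      have h2 := (((A.tendsto_moebiusSum hA hZ d).comp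
        (tendsto_sub_atTop_nat (d * t))).const_mul ((-1) ^ t * ((p d).choose t : ℂ) * u ^ (d * t)))
      rw [mul_zero] at h2
      refine h2.congr' ?_
      filter_upwards [eventually_ge_atTop (d * t)] with n hn
      simp only [hterm, if_pos hn, Function.comp]
      rfl
    have h3 := tendsto_finsetSum (Finset.Ico 2 (p d + 1)) fun t _ => h1 t
    simpa using h3
  have hmain : Tendsto (fun n : ℕ => ∑' d : ℕ, if d < n then R (d + 1) n else 0) atTop
      (𝓝 (∑' _ : ℕ, (0 : ℂ))) := by
    refine tendsto_tsum_of_dominated_convergence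
      (bound := fun d : ℕ => B * Real.exp C * (1 / ((d + 1 : ℕ) : ℝ) ^ 2)) ?_ ?_ ?_
    · exact Summable.mul_left _ ((summable_nat_add_iff 1).2
        (Real.summable_one_div_nat_pow.2 one_lt_two))
    · intro d
      refine (hRlim (d + 1)).congr' ?_
      filter_upwards [eventually_gt_atTop d] with n hn
      rw [if_pos hn]
    · refine Eventually.of_forall fun n d => ?_
      split_ifs
      · exact hRnorm (d + 1) n (by omega)
      · rw [norm_zero]
        positivity
  rw [tsum_zero] at hmain
  have heq : ∀ n : ℕ, ∑ d ∈ Finset.range n, (p (d + 1) : ℂ) * u ^ (d + 1) *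
      A.moebiusSum u (d + 1) (n - (d + 1)) =
      (∑' d : ℕ, if d < n then R (d + 1) n else 0) + 1 - A.moebiusSum u 0 n := by
    intro n
    rw [tsum_eq_sum (s := Finset.range n) (fun d hd => if_neg (by simpa using hd)),
      Finset.sum_congr rfl (g := fun d => (A.moebiusSum u d n - A.moebiusSum u (d + 1) n) +
        (p (d + 1) : ℂ) * u ^ (d + 1) * A.moebiusSum u (d + 1) (n - (d + 1)))
        (s₁ := Finset.range n) (f := fun d => if d < n then R (d + 1) n else 0)]
    · rw [Finset.sum_add_distrib, Finset.sum_range_sub', moebiusSum_self]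
      ring
    · intro d hd
      have hd' := Finset.mem_range.1 hd
      rw [if_pos hd', hRsum (d + 1) n (by omega) (by omega), Nat.add_sub_cancel]
  have hfin := (hmain.add_const 1).sub (A.tendsto_moebiusSum hA hZ 0)
  rw [zero_add, sub_zero] at hfin
  exact hfin.congr fun n => (heq n).symm

/-- Alladi's formula for a set of primes with a natural density, summed over the degree of the
least prime factor. -/
theorem tendsto_sum_primeCount (hA : A.AxiomASharp q) (hZ : A.ZetaNeZero q) {S : Set G}
    (hS : S ⊆ A.primes) {δ : ℝ} (hδ : A.HasNaturalDensity S δ) :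
    Tendsto (fun n : ℕ => ∑ d ∈ Finset.range n, (A.primeCount S (d + 1) : ℂ) *
      (q : ℂ)⁻¹ ^ (d + 1) * A.moebiusSum (q : ℂ)⁻¹ (d + 1) (n - (d + 1))) atTop (𝓝 δ) := by
  obtain ⟨K, hK0, hK⟩ := A.exists_weight_bound hA hZ
  have hq0 : 0 < q := one_pos.trans hA.1
  set u : ℂ := (q : ℂ)⁻¹ with hu
  set ρ : ℕ → ℝ := fun n => (A.primeCount S n : ℝ) / (A.primeCount A.primes n : ℝ) with hρ
  set W : ℕ → ℕ → ℂ := fun d n => (A.primeCount A.primes (d + 1) : ℂ) *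
      u ^ (d + 1) * A.moebiusSum u (d + 1) (n - (d + 1)) with hW
  have h1 : Tendsto (fun n : ℕ => ∑ d ∈ Finset.range n, W d n) atTop (𝓝 1) :=
    A.tendsto_sum_all_primes hA hZ
  have hWn : ∀ d n, d < n → ‖W d n‖ ≤ K * (n : ℝ)⁻¹ := by
    intro d n hdn
    have := hK (d + 1) n (by omega) (by omega)
    simp only [hW]
    rw [norm_mul, norm_mul, norm_pow, hu, norm_inv, Complex.norm_natCast, Complex.norm_real,
      Real.norm_of_nonneg hq0.le]
    rwa [div_eq_mul_inv] at this
  have hSW : ∀ d n : ℕ, (A.primeCount S (d + 1) : ℂ) *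
      u ^ (d + 1) * A.moebiusSum u (d + 1) (n - (d + 1)) = (ρ (d + 1) : ℂ) * W d n := by
    intro d n
    have h2 : (A.primeCount S (d + 1) : ℂ) = (ρ (d + 1) : ℂ) * A.primeCount A.primes (d + 1) := by
      simp only [hρ]
      push_cast
      rcases Nat.eq_zero_or_pos (A.primeCount A.primes (d + 1)) with h | h
      · have := A.primeCount_le hS (d + 1)
        rw [h] at this ⊢
        rw [Nat.le_zero.1 this]
        simp
      · rw [div_mul_cancel₀]
        exact Nat.cast_ne_zero.2 h.ne'
    rw [h2]
    simp only [hW]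
    ring
  have herr : Tendsto (fun n : ℕ => ∑ d ∈ Finset.range n, ((ρ (d + 1) - δ : ℝ) : ℂ) * W d n)
      atTop (𝓝 0) := by
    have h2 : Tendsto (fun d : ℕ => |ρ (d + 1) - δ|) atTop (𝓝 0) := by
      have h3 := ((tendsto_add_atTop_iff_nat 1).2 hδ).sub_const δ
      simpa using h3.abs
    have h4 := h2.cesaro.const_mul K
    rw [mul_zero] at h4
    refine squeeze_zero_norm (fun n => ?_) h4
    rw [← mul_assoc, Finset.mul_sum]
    refine (norm_sum_le _ _).trans (Finset.sum_le_sum fun d hd => ?_)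
    rw [norm_mul, Complex.norm_real, Real.norm_eq_abs, mul_comm]
    exact mul_le_mul_of_nonneg_right (hWn d n (Finset.mem_range.1 hd)) (abs_nonneg _)
  have hfin := herr.add (h1.const_mul (δ : ℂ))
  rw [zero_add, mul_one] at hfin
  refine hfin.congr fun n => ?_
  rw [Finset.mul_sum, ← Finset.sum_add_distrib]
  refine Finset.sum_congr rfl fun d _ => ?_
  rw [hSW]
  push_cast
  ring

/-! ### Twisting by an absolutely summable function -/

theorem sum_primesLE {M : Type*} [AddCommMonoid M] (n : ℕ) (f : A.primes → M) :
    ∑ P ∈ A.primesLE n, f P = ∑ d ∈ Finset.range n, ∑ P ∈ A.primesEq (d + 1), f P := by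
  classical
  rw [← Finset.sum_fiberwise_of_maps_to (s := A.primesLE n) (t := Finset.range n)
    (g := fun P => A.deg (P : G) - 1)]
  · refine Finset.sum_congr rfl fun k hk => Finset.sum_congr ?_ fun _ _ => rfl
    ext P
    have h0 := A.deg_pos P P.2
    have := Finset.mem_range.1 hk
    simp only [Finset.mem_filter, mem_primesLE, mem_primesEq]
    omega
  · intro P hP
    have h0 := A.deg_pos P P.2
    have := A.mem_primesLE.1 hP
    exact Finset.mem_range.2 (by omega)

theorem deg_le_of_mem_support {P : A.primes} {g : G} (h : P ∈ (A.factorization g).support) :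
    A.deg (P : G) ≤ A.deg g := by
  rw [Finsupp.mem_support_iff, ← prime_divides_iff] at h
  obtain ⟨r, rfl⟩ := h
  simp

theorem support_factorization_add (g h : G) [DecidableEq A.primes] :
    (A.factorization (g + h)).support =
      (A.factorization g).support ∪ (A.factorization h).support := by
  ext P
  simp only [map_add, Finsupp.mem_support_iff, Finsupp.add_apply, Finset.mem_union]
  omega

theorem support_factorization_eq_empty {g : G} : (A.factorization g).support = ∅ ↔ g = 0 := by
  rw [Finsupp.support_eq_empty, EmbeddingLike.map_eq_zero_iff]

/-- All prime factors of `g` other than `P` have degree larger than that of `P`. -/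
def OthersLarger (P : A.primes) (g : G) : Prop :=
  ∀ Q ∈ (A.factorization g).support, Q ≠ P → A.deg (P : G) < A.deg (Q : G)

theorem isMinPrimeFactor_coe (P : A.primes) (g : G) :
    A.IsMinPrimeFactor (P : G) g ↔ P ∈ (A.factorization g).support ∧
      ∀ Q ∈ (A.factorization g).support, A.deg (P : G) ≤ A.deg (Q : G) := by
  rw [IsMinPrimeFactor, coe_mem_primeFactors, Finsupp.mem_support_iff]
  refine and_congr_right fun _ => ?_
  rw [primeFactors_eq]
  simp

theorem IsMinPrimeFactor.mem_primes {A : AdditiveArithSemigroup G} {P g : G}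
    (h : A.IsMinPrimeFactor P g) : P ∈ A.primes := (A.mem_primeFactors.1 h.1).1

/-- The distinguishable elements are those with a prime factor of degree smaller than that of all
other prime factors. -/
theorem ne_zero_and_mem_distinguishedSet_iff {S : Set G} {g : G} :
    g ≠ 0 ∧ g ∈ A.distinguishedSet S ↔
      ∃ P : A.primes, (P : G) ∈ S ∧ P ∈ (A.factorization g).support ∧ A.OthersLarger P g := by
  constructor
  · rintro ⟨hg, ⟨⟨-, P₀, -, huniq⟩, P, hPS, hP⟩ | hg'⟩
    · have hPp := hP.mem_primes
      have hP' := (A.isMinPrimeFactor_coe ⟨P, hPp⟩ g).1 hP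
      refine ⟨⟨P, hPp⟩, hPS, hP'.1, fun Q hQ hne => lt_of_le_of_ne (hP'.2 Q hQ) fun heq => ?_⟩
      have hQmin : A.IsMinPrimeFactor (Q : G) g :=
        (A.isMinPrimeFactor_coe Q g).2 ⟨hQ, fun R hR => heq ▸ hP'.2 R hR⟩
      exact hne (Subtype.ext ((huniq Q hQmin).trans (huniq P hP).symm))
    · exact absurd hg' hg
  · rintro ⟨P, hPS, hP, hV⟩
    have hg : g ≠ 0 := by
      rintro rfl
      simp at hP
    have hmin : A.IsMinPrimeFactor (P : G) g := by
      refine (A.isMinPrimeFactor_coe P g).2 ⟨hP, fun Q hQ => ?_⟩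
      by_cases h : Q = P
      · rw [h]
      · exact (hV Q hQ h).le
    refine ⟨hg, Or.inl ⟨⟨hg, P, hmin, fun Q hQ => ?_⟩, P, hPS, hmin⟩⟩
    have hQ' := (A.isMinPrimeFactor_coe ⟨Q, hQ.mem_primes⟩ g).1 hQ
    by_contra hne
    have h1 := hV ⟨Q, hQ.mem_primes⟩ hQ'.1 (fun h => hne (congrArg Subtype.val h))
    have h2 := hQ'.2 P hP
    omega

theorem eq_of_othersLarger {P Q : A.primes} {g : G} (hP : P ∈ (A.factorization g).support)
    (hQ : Q ∈ (A.factorization g).support) (hVP : A.OthersLarger P g)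
    (hVQ : A.OthersLarger Q g) : P = Q := by
  by_contra h
  have h1 := hVP Q hQ (Ne.symm h)
  have h2 := hVQ P hP h
  omega

open Classical in
theorem moebius_prime_add {P : A.primes} {j : G} (hP : P ∉ (A.factorization j).support) :
    A.moebius ((P : G) + j) = -A.moebius j := by
  have hP0 : A.factorization j P = 0 := Finsupp.notMem_support_iff.1 hP
  have h1 : (∃ Q ∈ A.primes, Divides (2 • Q) ((P : G) + j)) ↔
      ∃ Q ∈ A.primes, Divides (2 • Q) j := by
    refine exists_congr fun Q => and_congr_right fun hQ => ?_
    have e1 := A.nsmul_prime_divides_iff 2 ⟨Q, hQ⟩ ((P : G) + j)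
    have e2 := A.nsmul_prime_divides_iff 2 ⟨Q, hQ⟩ j
    simp only at e1 e2
    rw [e1, e2, map_add, factorization_prime, Finsupp.add_apply, Finsupp.single_apply]
    split_ifs with h
    · rw [← h, hP0]
      omega
    · rw [zero_add]
  rw [moebius, moebius]
  simp only [h1]
  split_ifs
  · simp
  · rw [primeFactors_eq, primeFactors_eq, Finset.card_map, Finset.card_map,
      support_factorization_add, factorization_prime, Finsupp.support_single P one_ne_zero,
      ← Finset.insert_eq, Finset.card_insert_of_notMem hP, pow_succ]
    ring

open Classical in
theorem moebiusSum_eq_sum_elemsLE (u : ℂ) (d x : ℕ) :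
    A.moebiusSum u d x = ∑ h ∈ (A.elemsLE x).filter
      (fun h => ∀ P ∈ (A.factorization h).support, d < A.deg (P : G)),
        A.moebius h * u ^ A.deg h := by
  rw [moebiusSum_eq, Finset.sum_filter, sum_elemsLE]
  refine Finset.sum_congr rfl fun k _ => ?_
  rw [roughSeries, series, PowerSeries.coeff_mk]
  refine Finset.sum_congr rfl fun h hh => ?_
  rw [A.mem_elemsEq.1 hh]
  split_ifs <;> simp

open Classical in
/-- The squarefree elements `h` with least prime factor `P` are the `P + j` with `j` free of
primes of degree at most `∂P`. -/
theorem sum_moebius_least_prime (u : ℂ) (P : A.primes) (x : ℕ) :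
    ∑ h ∈ (A.elemsLE x).filter
      (fun h => P ∈ (A.factorization h).support ∧ A.OthersLarger P h),
        A.moebius h * u ^ A.deg h =
      -(if A.deg (P : G) ≤ x then
        u ^ A.deg (P : G) * A.moebiusSum u (A.deg (P : G)) (x - A.deg (P : G)) else 0) := by
  set d := A.deg (P : G) with hd
  split_ifs with hdx
  · rw [moebiusSum_eq_sum_elemsLE, Finset.mul_sum, ← Finset.sum_neg_distrib]
    symm
    have hnot : ∀ j : G, (∀ Q ∈ (A.factorization j).support, d < A.deg (Q : G)) →
        P ∉ (A.factorization j).support := fun j hj h => (hj P h).ne rfl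
    refine Finset.sum_bij_ne_zero (fun j _ _ => (P : G) + j) ?_ ?_ ?_ ?_
    · intro j hj _
      simp only [Finset.mem_filter, mem_elemsLE] at hj ⊢
      refine ⟨by rw [map_add]; omega, ?_, ?_⟩
      · rw [support_factorization_add, factorization_prime, Finsupp.support_single P one_ne_zero]
        simp
      · intro Q hQ hQP
        rw [support_factorization_add, factorization_prime, Finsupp.support_single P one_ne_zero,
          Finset.mem_union, Finset.mem_singleton] at hQ
        exact hj.2 Q (hQ.resolve_left hQP)
    · exact fun a _ _ b _ _ h => A.add_left_cancel' h
    · intro h hh hne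
      simp only [Finset.mem_filter, mem_elemsLE] at hh
      obtain ⟨hhx, hP, hV⟩ := hh
      have hμ := left_ne_zero_of_mul hne
      obtain ⟨j, rfl⟩ := (A.prime_divides_iff P h).2 (Finsupp.mem_support_iff.1 hP)
      have hPj : P ∉ (A.factorization j).support := by
        intro hPj
        apply hμ
        rw [moebius, if_pos]
        refine ⟨P, P.2, (A.nsmul_prime_divides_iff 2 P _).2 ?_⟩
        rw [map_add, factorization_prime, Finsupp.add_apply, Finsupp.single_eq_same]
        have := Finsupp.mem_support_iff.1 hPj
        omega
      have hrough : ∀ Q ∈ (A.factorization j).support, d < A.deg (Q : G) := by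
        intro Q hQ
        refine hV Q ?_ (fun h => hPj (h ▸ hQ))
        rw [support_factorization_add]
        exact Finset.mem_union_right _ hQ
      have hmem : j ∈ (A.elemsLE (x - d)).filter
          (fun h => ∀ P ∈ (A.factorization h).support, d < A.deg (P : G)) := by
        simp only [Finset.mem_filter, mem_elemsLE]
        rw [map_add] at hhx
        exact ⟨by omega, hrough⟩
      refine ⟨j, hmem, ?_, rfl⟩
      rw [A.moebius_prime_add hPj, map_add, pow_add] at hne
      intro h0
      apply hne
      linear_combination h0
    · intro j hj _
      simp only [Finset.mem_filter, mem_elemsLE] at hj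
      rw [A.moebius_prime_add (hnot j hj.2), map_add, pow_add]
      ring
  · rw [neg_zero]
    refine Finset.sum_eq_zero fun h hh => ?_
    simp only [Finset.mem_filter, mem_elemsLE] at hh
    have := A.deg_le_of_mem_support hh.2.1
    omega

open Classical in
theorem sum_moebius_add_least_prime (u : ℂ) (P : A.primes) (k : G) (x : ℕ) :
    ∑ h ∈ (A.elemsLE x).filter
      (fun h => P ∈ (A.factorization (h + k)).support ∧ A.OthersLarger P (h + k)),
        A.moebius h * u ^ A.deg h =
      if A.OthersLarger P k then
        (if P ∈ (A.factorization k).support then A.moebiusSum u (A.deg (P : G)) x else 0) -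
        (if A.deg (P : G) ≤ x then
          u ^ A.deg (P : G) * A.moebiusSum u (A.deg (P : G)) (x - A.deg (P : G)) else 0)
      else 0 := by
  have hV : ∀ h, A.OthersLarger P (h + k) ↔ A.OthersLarger P h ∧ A.OthersLarger P k := by
    intro h
    simp only [OthersLarger, support_factorization_add, Finset.mem_union, or_imp, forall_and]
  have h0 := A.sum_moebius_least_prime u P x
  by_cases h1 : A.OthersLarger P k
  · rw [if_pos h1, sub_eq_add_neg, ← h0]
    by_cases h2 : P ∈ (A.factorization k).support
    · rw [if_pos h2, moebiusSum_eq_sum_elemsLE, add_comm, ← Finset.sum_filter_add_sum_filter_not _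
        (fun h => P ∈ (A.factorization h).support), Finset.filter_filter, Finset.filter_filter]
      congr 1
      · refine Finset.sum_congr (Finset.filter_congr fun h _ => ?_) fun _ _ => rfl
        simp only [hV, h1, support_factorization_add, Finset.mem_union]
        tauto
      · refine Finset.sum_congr (Finset.filter_congr fun h _ => ?_) fun _ _ => rfl
        simp only [hV, h1, h2, support_factorization_add, Finset.mem_union, or_true, true_and,
          and_true]
        constructor
        · rintro ⟨h3, h4⟩ Q hQ
          exact h3 Q hQ fun h => h4 (h ▸ hQ)
        · exact fun h3 => ⟨fun Q hQ _ => h3 Q hQ, fun h4 => (h3 P h4).ne rfl⟩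
    · rw [if_neg h2, zero_add]
      refine Finset.sum_congr (Finset.filter_congr fun h _ => ?_) fun _ _ => rfl
      simp only [hV, h1, h2, support_factorization_add, Finset.mem_union, or_false, and_true]
  · rw [if_neg h1]
    refine Finset.sum_eq_zero fun h hh => ?_
    exact absurd ((hV h).1 (Finset.mem_filter.1 hh).2.2).2 h1

open Classical in
/-- The sum of `μ(h) u^{∂h}` over the `h` such that `h + k` is a nonzero element of the
distinguished set of degree at most `n`. -/
noncomputable def shiftedSum (u : ℂ) (S : Set G) (n : ℕ) (k : G) : ℂ :=
  ∑ h ∈ (A.elemsLE n).filter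
    (fun h => A.deg (h + k) ≤ n ∧ h + k ≠ 0 ∧ h + k ∈ A.distinguishedSet S),
      A.moebius h * u ^ A.deg h

open Classical in
/-- Evaluation of the shifted sum, grouped by the least prime factor `P` of `h + k`. -/
theorem shiftedSum_eq (u : ℂ) (S : Set G) (n : ℕ) (k : G) (hk : A.deg k ≤ n) :
    A.shiftedSum u S n k = ∑ P ∈ (A.primesLE n).filter
      (fun P : A.primes => (P : G) ∈ S ∧ A.OthersLarger P k),
        ((if P ∈ (A.factorization k).support then
            A.moebiusSum u (A.deg (P : G)) (n - A.deg k) else 0) -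
          (if A.deg (P : G) ≤ n - A.deg k then u ^ A.deg (P : G) *
            A.moebiusSum u (A.deg (P : G)) (n - A.deg k - A.deg (P : G)) else 0)) := by
  have h1 : A.shiftedSum u S n k = ∑ h ∈ A.elemsLE (n - A.deg k), A.moebius h * u ^ A.deg h *
      if h + k ≠ 0 ∧ h + k ∈ A.distinguishedSet S then 1 else 0 := by
    simp only [mul_ite, mul_one, mul_zero]
    rw [shiftedSum, ← Finset.sum_filter]
    refine Finset.sum_congr ?_ fun _ _ => rfl
    ext h
    simp only [Finset.mem_filter, mem_elemsLE, map_add, ← and_assoc]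
    refine and_congr_left fun _ => and_congr_left fun _ => ?_
    omega
  have h2 : ∀ h ∈ A.elemsLE (n - A.deg k),
      (if h + k ≠ 0 ∧ h + k ∈ A.distinguishedSet S then (1 : ℂ) else 0) =
      ∑ P ∈ (A.primesLE n).filter (fun P : A.primes => (P : G) ∈ S),
        if P ∈ (A.factorization (h + k)).support ∧ A.OthersLarger P (h + k) then 1 else 0 := by
    intro h hh
    rw [A.mem_elemsLE] at hh
    split_ifs with hc
    · obtain ⟨P, hPS, hP, hV⟩ := A.ne_zero_and_mem_distinguishedSet_iff.1 hc
      rw [Finset.sum_eq_single P, if_pos ⟨hP, hV⟩]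
      · intro Q _ hQP
        rw [if_neg]
        rintro ⟨hQ, hVQ⟩
        exact hQP (A.eq_of_othersLarger hQ hP hVQ hV)
      · intro hPn
        refine absurd (Finset.mem_filter.2 ⟨A.mem_primesLE.2 ?_, hPS⟩) hPn
        have := A.deg_le_of_mem_support hP
        rw [map_add] at this
        omega
    · symm
      refine Finset.sum_eq_zero fun P hP => if_neg fun h3 => hc ?_
      exact A.ne_zero_and_mem_distinguishedSet_iff.2 ⟨P, (Finset.mem_filter.1 hP).2, h3.1, h3.2⟩
  rw [h1, Finset.sum_congr rfl fun h hh => by rw [h2 h hh]]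
  simp only [Finset.mul_sum]
  rw [Finset.sum_comm]
  conv_rhs => rw [← Finset.filter_filter, Finset.sum_filter]
  refine Finset.sum_congr rfl fun P _ => ?_
  rw [← A.sum_moebius_add_least_prime, Finset.sum_filter]
  refine Finset.sum_congr rfl fun h _ => ?_
  rw [mul_ite, mul_one, mul_zero]

theorem exists_shiftedSum_bound (hA : A.AxiomASharp q) (hZ : A.ZetaNeZero q) (S : Set G) :
    ∃ K : ℝ, 0 < K ∧ ∀ n k, A.deg k ≤ n → ‖A.shiftedSum (q : ℂ)⁻¹ S n k‖ ≤ K := by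
  classical
  obtain ⟨B, hB0, hB1, -⟩ := A.exists_moebiusSum_bound hA hZ
  obtain ⟨K, hK0, hK⟩ := A.exists_weight_bound hA hZ
  have hq0 : 0 < q := one_pos.trans hA.1
  refine ⟨B + K, by positivity, fun n k hk => ?_⟩
  rw [A.shiftedSum_eq _ S n k hk, Finset.sum_sub_distrib]
  set x := n - A.deg k with hx
  refine (norm_sub_le _ _).trans (add_le_add ?_ ?_)
  · rw [← Finset.sum_filter]
    refine (norm_sum_le _ _).trans ((Finset.sum_le_card_nsmul _ _ B fun P _ => hB1 _ _).trans ?_)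
    rw [nsmul_eq_mul]
    refine mul_le_of_le_one_left hB0.le ?_
    rw [Nat.cast_le_one, Finset.card_le_one]
    intro P hP Q hQ
    simp only [Finset.mem_filter] at hP hQ
    exact A.eq_of_othersLarger hP.2 hQ.2 hP.1.2.2 hQ.1.2.2
  · rw [← Finset.sum_filter]
    refine (norm_sum_le _ _).trans ?_
    calc _ ≤ ∑ P ∈ A.primesLE x, q⁻¹ ^ A.deg (P : G) *
          ‖A.moebiusSum (q : ℂ)⁻¹ (A.deg (P : G)) (x - A.deg (P : G))‖ := by
          refine (Finset.sum_le_sum fun P hP => le_of_eq ?_).trans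
            (Finset.sum_le_sum_of_subset_of_nonneg (fun P hP => ?_) fun _ _ _ => by positivity)
          · rw [norm_mul, norm_pow, norm_inv, Complex.norm_real, Real.norm_of_nonneg hq0.le]
          · exact A.mem_primesLE.2 (Finset.mem_filter.1 hP).2
      _ = ∑ d ∈ Finset.range x, (A.primeCount A.primes (d + 1) : ℝ) * q⁻¹ ^ (d + 1) *
          ‖A.moebiusSum (q : ℂ)⁻¹ (d + 1) (x - (d + 1))‖ := by
          rw [sum_primesLE]
          refine Finset.sum_congr rfl fun d _ => ?_
          rw [Finset.sum_congr rfl (fun P hP => by rw [A.mem_primesEq.1 hP]), Finset.sum_const,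
            nsmul_eq_mul, A.primeCount_eq_card subset_rfl, mul_assoc,
            Finset.filter_true_of_mem fun P _ => P.2]
      _ ≤ ∑ d ∈ Finset.range x, K / x := by
          refine Finset.sum_le_sum fun d hd => ?_
          have := Finset.mem_range.1 hd
          exact hK (d + 1) x (by omega) (by omega)
      _ ≤ K := by
          rw [Finset.sum_const, Finset.card_range, nsmul_eq_mul]
          rcases Nat.eq_zero_or_pos x with h | h
          · rw [h]
            simpa using hK0.le
          · rw [mul_div_cancel₀]
            exact_mod_cast h.ne'

/-- For fixed `k ≠ 0` the least prime factor of `h + k` has degree at most `∂k`, so that finitely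
many of the sums `m(d, ·)` occur, and each of them tends to `0`. -/
theorem tendsto_shiftedSum (hA : A.AxiomASharp q) (hZ : A.ZetaNeZero q) (S : Set G) {k : G}
    (hk : k ≠ 0) : Tendsto (fun n => A.shiftedSum (q : ℂ)⁻¹ S n k) atTop (𝓝 0) := by
  classical
  set F : ℕ → A.primes → ℂ := fun n P => (if P ∈ (A.factorization k).support then
            A.moebiusSum (q : ℂ)⁻¹ (A.deg (P : G)) (n - A.deg k) else 0) -
          (if A.deg (P : G) ≤ n - A.deg k then (q : ℂ)⁻¹ ^ A.deg (P : G) *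
            A.moebiusSum (q : ℂ)⁻¹ (A.deg (P : G)) (n - A.deg k - A.deg (P : G)) else 0) with hF
  have hlim : ∀ P, Tendsto (fun n => F n P) atTop (𝓝 0) := by
    intro P
    have h1 := (A.tendsto_moebiusSum hA hZ (A.deg (P : G))).comp
      (tendsto_sub_atTop_nat (A.deg k))
    have h2 := ((A.tendsto_moebiusSum hA hZ (A.deg (P : G))).comp
      ((tendsto_sub_atTop_nat (A.deg (P : G))).comp (tendsto_sub_atTop_nat (A.deg k)))).const_mul
        ((q : ℂ)⁻¹ ^ A.deg (P : G))
    rw [mul_zero] at h2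
    have h3 : Tendsto (fun n => if P ∈ (A.factorization k).support then
        A.moebiusSum (q : ℂ)⁻¹ (A.deg (P : G)) (n - A.deg k) else 0) atTop (𝓝 0) := by
      split_ifs
      · exact h1
      · exact tendsto_const_nhds
    rw [← sub_zero (0 : ℂ)]
    refine h3.sub (h2.congr' ?_)
    filter_upwards [eventually_ge_atTop (A.deg k + A.deg (P : G))] with n hn
    rw [if_pos (by omega)]
    rfl
  -- only the primes of degree at most `∂k` contribute
  have hfin := tendsto_finsetSum ((A.primesLE (A.deg k)).filter
      (fun P : A.primes => (P : G) ∈ S ∧ A.OthersLarger P k)) fun P _ => hlim P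
  rw [Finset.sum_const_zero] at hfin
  refine hfin.congr' ?_
  filter_upwards [eventually_ge_atTop (A.deg k)] with n hn
  rw [A.shiftedSum_eq _ S n k hn]
  refine Finset.sum_congr ?_ fun _ _ => rfl
  ext P
  simp only [Finset.mem_filter, mem_primesLE]
  refine and_congr_left fun hP => ⟨fun h => h.trans hn, fun _ => ?_⟩
  obtain ⟨Q, hQ⟩ := Finset.nonempty_iff_ne_empty.2 (mt A.support_factorization_eq_empty.1 hk)
  have hQk := A.deg_le_of_mem_support hQ
  by_cases hQP : Q = P
  · rwa [← hQP]
  · exact (hP.2 Q hQ hQP).le.trans hQk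

theorem tendsto_shiftedSum_zero (hA : A.AxiomASharp q) (hZ : A.ZetaNeZero q) {S : Set G}
    (hS : S ⊆ A.primes) {δ : ℝ} (hδ : A.HasNaturalDensity S δ) :
    Tendsto (fun n => A.shiftedSum (q : ℂ)⁻¹ S n 0) atTop (𝓝 (-δ)) := by
  classical
  refine (A.tendsto_sum_primeCount hA hZ hS hδ).neg.congr fun n => ?_
  rw [A.shiftedSum_eq _ S n 0 (by simp), Finset.sum_filter, sum_primesLE, ← Finset.sum_neg_distrib]
  refine Finset.sum_congr rfl fun d hd => ?_
  have hdn := Finset.mem_range.1 hd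
  have h0 : ∀ P : A.primes, A.OthersLarger P 0 := by
    intro P Q hQ
    simp at hQ
  rw [← Finset.sum_filter, Finset.sum_congr rfl (g := fun _ => -((q : ℂ)⁻¹ ^ (d + 1) *
    A.moebiusSum (q : ℂ)⁻¹ (d + 1) (n - (d + 1)))), Finset.sum_const, nsmul_eq_mul,
    A.primeCount_eq_card hS]
  · simp only [h0, and_true]
    ring
  · intro P hP
    rw [A.mem_primesEq.1 (Finset.mem_filter.1 hP).1]
    simp only [map_zero, Finsupp.support_zero, Finset.notMem_empty, if_false, Nat.sub_zero,
      zero_sub]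
    rw [if_pos (by omega)]

open Classical in
theorem sum_conv_moebius (u : ℂ) (S : Set G) (c : G → ℂ) (n : ℕ) :
    ∑ g ∈ (A.elemsLE n).filter (fun g => 1 ≤ A.deg g ∧ g ∈ A.distinguishedSet S),
      A.conv A.moebius c g * u ^ A.deg g =
    ∑ k ∈ A.elemsLE n, c k * u ^ A.deg k * A.shiftedSum u S n k := by
  simp only [conv, shiftedSum, Finset.sum_mul, Finset.mul_sum]
  rw [Finset.sum_sigma', Finset.sum_sigma']
  refine Finset.sum_bij' (fun x _ => ⟨x.2.2, x.2.1⟩) (fun y _ => ⟨y.2 + y.1, (y.2, y.1)⟩)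
    ?_ ?_ ?_ ?_ ?_
  · rintro ⟨g, h, k⟩ hx
    simp only [Finset.mem_sigma, Finset.mem_filter, mem_elemsLE, mem_decompositions] at hx ⊢
    obtain ⟨⟨h1, h2, h3⟩, rfl⟩ := hx
    refine ⟨?_, ?_, h1, ?_, h3⟩
    · rw [map_add] at h1; omega
    · rw [map_add] at h1; omega
    · intro h0
      rw [h0, map_zero] at h2
      omega
  · rintro ⟨k, h⟩ hx
    simp only [Finset.mem_sigma, Finset.mem_filter, mem_elemsLE, mem_decompositions] at hx ⊢
    obtain ⟨-, -, h1, h2, h3⟩ := hx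
    exact ⟨⟨h1, Nat.one_le_iff_ne_zero.2 fun h0 => h2 (A.eq_zero_of_deg_eq_zero h0), h3⟩, trivial⟩
  · rintro ⟨g, h, k⟩ hx
    simp only [Finset.mem_sigma, mem_decompositions] at hx
    obtain ⟨-, rfl⟩ := hx
    rfl
  · rintro ⟨k, h⟩ _
    rfl
  · rintro ⟨g, h, k⟩ hx
    simp only [Finset.mem_sigma, mem_decompositions] at hx
    obtain ⟨-, rfl⟩ := hx
    simp only [map_add, pow_add]
    ring

open Classical in
/-- Alladi's formula twisted by an arithmetical function `c` with `∑ |c(k)| / ‖k‖ < ∞`. -/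
theorem tendsto_sum_conv_moebius (hA : A.AxiomASharp q) (hZ : A.ZetaNeZero q) {S : Set G}
    (hS : S ⊆ A.primes) {δ : ℝ} (hδ : A.HasNaturalDensity S δ) {c : G → ℂ} (hc0 : c 0 = 1)
    (hc : Summable fun k => ‖c k‖ * q⁻¹ ^ A.deg k) :
    Tendsto (fun n => ∑ g ∈ (A.elemsLE n).filter
      (fun g => 1 ≤ A.deg g ∧ g ∈ A.distinguishedSet S),
        A.conv A.moebius c g * (q : ℂ)⁻¹ ^ A.deg g) atTop (𝓝 (-δ)) := by
  obtain ⟨K, hK0, hK⟩ := A.exists_shiftedSum_bound hA hZ S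
  have hq0 : 0 < q := one_pos.trans hA.1
  have h := tendsto_tsum_of_dominated_convergence (𝓕 := atTop)
    (f := fun (n : ℕ) (k : G) => if A.deg k ≤ n then
      c k * (q : ℂ)⁻¹ ^ A.deg k * A.shiftedSum (q : ℂ)⁻¹ S n k else 0)
    (g := fun k => if k = 0 then (-δ : ℂ) else 0)
    (bound := fun k => ‖c k‖ * q⁻¹ ^ A.deg k * K) (hc.mul_right K) ?_ ?_
  · rw [tsum_ite_eq] at h
    refine h.congr fun n => ?_
    rw [sum_conv_moebius, tsum_eq_sum (s := A.elemsLE n)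
      (fun k hk => if_neg fun h => hk (A.mem_elemsLE.2 h))]
    exact Finset.sum_congr rfl fun k hk => if_pos (A.mem_elemsLE.1 hk)
  · intro k
    have h1 : Tendsto (fun n => c k * (q : ℂ)⁻¹ ^ A.deg k * A.shiftedSum (q : ℂ)⁻¹ S n k) atTop
        (𝓝 (if k = 0 then (-δ : ℂ) else 0)) := by
      split_ifs with hk
      · subst hk
        simpa [hc0] using A.tendsto_shiftedSum_zero hA hZ hS hδ
      · simpa using (A.tendsto_shiftedSum hA hZ S hk).const_mul (c k * (q : ℂ)⁻¹ ^ A.deg k)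
    refine h1.congr' ?_
    filter_upwards [eventually_ge_atTop (A.deg k)] with n hn
    rw [if_pos hn]
  · refine Eventually.of_forall fun n k => ?_
    split_ifs with hk
    · rw [norm_mul, norm_mul, norm_pow, norm_inv, Complex.norm_real, Real.norm_of_nonneg hq0.le]
      have := hK n k hk
      gcongr
    · rw [norm_zero]
      positivity

/-! ### From the weight `1 / φ` to the weight `1 / ‖·‖` -/

theorem sum_decompositions_assoc (F : G → G → G → ℂ) (g : G) :
    ∑ p ∈ A.decompositions g, ∑ x ∈ A.decompositions p.2, F p.1 x.1 x.2 =
      ∑ p ∈ A.decompositions g, ∑ x ∈ A.decompositions p.1, F x.1 x.2 p.2 := by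
  rw [Finset.sum_sigma', Finset.sum_sigma']
  refine Finset.sum_bij' (fun y _ => ⟨(y.1.1 + y.2.1, y.2.2), (y.1.1, y.2.1)⟩)
    (fun y _ => ⟨(y.2.1, y.2.2 + y.1.2), (y.2.2, y.1.2)⟩) ?_ ?_ ?_ ?_ ?_
  · rintro ⟨⟨a, b⟩, c, d⟩ h
    simp only [Finset.mem_sigma, mem_decompositions] at h ⊢
    obtain ⟨rfl, rfl⟩ := h
    exact ⟨add_assoc _ _ _, trivial⟩
  · rintro ⟨⟨a, b⟩, c, d⟩ h
    simp only [Finset.mem_sigma, mem_decompositions] at h ⊢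
    obtain ⟨rfl, rfl⟩ := h
    exact ⟨(add_assoc _ _ _).symm, trivial⟩
  · rintro ⟨⟨a, b⟩, c, d⟩ h
    simp only [Finset.mem_sigma, mem_decompositions] at h
    obtain ⟨-, rfl⟩ := h
    rfl
  · rintro ⟨⟨a, b⟩, c, d⟩ h
    simp only [Finset.mem_sigma, mem_decompositions] at h
    obtain ⟨-, rfl⟩ := h
    rfl
  · rintro ⟨⟨a, b⟩, c, d⟩ _
    rfl

theorem sum_decompositions_swap {M : Type*} [AddCommMonoid M] (F : G → G → M) (g : G) :
    ∑ p ∈ A.decompositions g, F p.1 p.2 = ∑ p ∈ A.decompositions g, F p.2 p.1 := by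
  refine Finset.sum_bij' (fun p _ => p.swap) (fun p _ => p.swap) ?_ ?_ ?_ ?_ ?_
  · intro p hp
    rw [mem_decompositions] at hp ⊢
    rw [← hp, add_comm]; rfl
  · intro p hp
    rw [mem_decompositions] at hp ⊢
    rw [← hp, add_comm]; rfl
  · exact fun p _ => p.swap_swap
  · exact fun p _ => p.swap_swap
  · exact fun p _ => rfl

/-- Möbius inversion. -/
theorem conv_moebius_conv_one (f : G → ℂ) :
    A.conv A.moebius (A.conv (fun _ => 1) f) = f := by
  classical
  ext g
  have h := A.sum_decompositions_assoc (fun h l r => A.moebius h * f r) g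
  have h1 : A.conv A.moebius (A.conv (fun _ => 1) f) g =
      ∑ p ∈ A.decompositions g, ∑ x ∈ A.decompositions p.2, A.moebius p.1 * f x.2 := by
    rw [conv]
    refine Finset.sum_congr rfl fun p _ => ?_
    rw [conv, Finset.mul_sum]
    simp only [one_mul]
  rw [h1, h]
  simp only [← Finset.sum_mul, sum_decompositions_moebius_one]
  rw [Finset.sum_eq_single (0, g)]
  · simp
  · rintro ⟨a, b⟩ hp hne
    rw [if_neg, zero_mul]
    rintro rfl
    rw [mem_decompositions, zero_add] at hp
    exact hne (by rw [← hp])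
  · intro hn
    exact absurd (A.mem_decompositions.2 (zero_add g)) hn

theorem summable_pow_deg (hA : A.AxiomASharp q) {y : ℝ} (hy0 : 0 ≤ y) (hy : q * y < 1) :
    Summable fun g : G => y ^ A.deg g := by
  obtain ⟨M, hM, h⟩ := hA.exists_count_le
  have hq0 : 0 < q := one_pos.trans hA.1
  refine summable_of_sum_le (c := M * (1 - q * y)⁻¹) (fun _ => by positivity) fun s => ?_
  have hs : s ⊆ A.elemsLE (s.sup A.deg) := fun g hg => A.mem_elemsLE.2 (Finset.le_sup hg)
  calc ∑ g ∈ s, y ^ A.deg g ≤ ∑ g ∈ A.elemsLE (s.sup A.deg), y ^ A.deg g :=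
        Finset.sum_le_sum_of_subset_of_nonneg hs fun _ _ _ => by positivity
    _ = ∑ k ∈ Finset.range (s.sup A.deg + 1), (A.count k : ℝ) * y ^ k := by
        rw [sum_elemsLE]
        refine Finset.sum_congr rfl fun k _ => ?_
        rw [Finset.sum_congr rfl (fun g hg => by rw [A.mem_elemsEq.1 hg]), Finset.sum_const,
          nsmul_eq_mul, count_eq_card]
    _ ≤ ∑ k ∈ Finset.range (s.sup A.deg + 1), M * (q * y) ^ k := by
        refine Finset.sum_le_sum fun k _ => ?_
        rw [mul_pow, ← mul_assoc]
        exact mul_le_mul_of_nonneg_right (h k) (by positivity)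
    _ ≤ M * (1 - q * y)⁻¹ := by
        rw [← Finset.mul_sum, ← tsum_geometric_of_lt_one (by positivity) hy]
        exact mul_le_mul_of_nonneg_left ((summable_geometric_of_lt_one (by positivity)
          hy).sum_le_tsum _ fun _ _ => by positivity) hM.le

/-- Convergence of an Euler product over the primes implies convergence of the corresponding
sum over the semigroup. -/
theorem summable_prod_support_mul_pow {f : A.primes → ℝ} (hf0 : ∀ P, 0 ≤ f P) {y : ℝ}
    (hy0 : 0 ≤ y) (hy1 : y < 1) (hf : Summable fun P : A.primes => f P * y ^ A.deg (P : G)) :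
    Summable fun g : G => (∏ P ∈ (A.factorization g).support, f P) * y ^ A.deg g := by
  classical
  set w : A.primes → ℕ → ℝ := fun P j => if j = 0 then 1 else f P * (y ^ A.deg (P : G)) ^ j with hw
  have hw0 : ∀ P j, 0 ≤ w P j := by
    intro P j
    simp only [hw]
    split_ifs
    · exact zero_le_one
    · exact mul_nonneg (hf0 P) (by positivity)
  have hy1' : 0 < 1 - y := by linarith
  have hsum : ∀ P N, ∑ j ∈ Finset.range (N + 1), w P j ≤
      1 + f P * y ^ A.deg (P : G) * (1 - y)⁻¹ := by
    intro P N
    set z := y ^ A.deg (P : G) with hz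
    have hz0 : 0 ≤ z := by positivity
    have hzy : z ≤ y := pow_le_of_le_one hy0 hy1.le (A.deg_pos P P.2).ne'
    rw [Finset.sum_range_succ', add_comm]
    have h1 : w P 0 = 1 := by simp [hw]
    have h2 : ∑ j ∈ Finset.range N, w P (j + 1) = f P * z * ∑ j ∈ Finset.range N, z ^ j := by
      rw [Finset.mul_sum]
      refine Finset.sum_congr rfl fun j _ => ?_
      simp only [hw, Nat.succ_ne_zero, if_false]
      rw [← hz, pow_succ]
      ring
    rw [h1, h2]
    have h3 : ∑ j ∈ Finset.range N, z ^ j ≤ (1 - y)⁻¹ := by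
      have hz1 : z < 1 := hzy.trans_lt hy1
      refine ((summable_geometric_of_lt_one hz0 hz1).sum_le_tsum _
        fun _ _ => by positivity).trans ?_
      rw [tsum_geometric_of_lt_one hz0 hz1]
      gcongr
    have := hf0 P
    gcongr
  have hg : ∀ (T : Finset A.primes) (g : G), (A.factorization g).support ⊆ T →
      (∏ P ∈ (A.factorization g).support, f P) * y ^ A.deg g =
        ∏ P ∈ T, w P (A.factorization g P) := by
    intro T g hT
    rw [← Finset.prod_subset hT, deg_eq_sum, Finsupp.sum, ← Finset.prod_pow_eq_pow_sum,
      ← Finset.prod_mul_distrib]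
    · refine Finset.prod_congr rfl fun P hP => ?_
      simp only [hw]
      rw [if_neg (Finsupp.mem_support_iff.1 hP), ← pow_mul, mul_comm (A.deg (P : G))]
    · intro P _ hP
      simp only [hw]
      rw [if_pos (Finsupp.notMem_support_iff.1 hP)]
  refine summable_of_sum_le (c := Real.exp (∑' P, f P * y ^ A.deg (P : G) * (1 - y)⁻¹))
    (fun g => mul_nonneg (Finset.prod_nonneg fun P _ => hf0 P) (by positivity)) fun s => ?_
  set T := s.biUnion fun g => (A.factorization g).support with hT
  set N := s.sup fun g => T.sup (A.factorization g) with hN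
  have hTs : ∀ g ∈ s, (A.factorization g).support ⊆ T := fun g hg =>
    Finset.subset_biUnion_of_mem (fun g => (A.factorization g).support) hg
  calc ∑ g ∈ s, (∏ P ∈ (A.factorization g).support, f P) * y ^ A.deg g
      = ∑ g ∈ s, ∏ x ∈ T.attach, w x.1 (A.factorization g x.1) := by
        refine Finset.sum_congr rfl fun g hgs => ?_
        rw [hg T g (hTs g hgs)]
        exact (Finset.prod_attach T fun P => w P (A.factorization g P)).symm
    _ = ∑ p ∈ s.image (fun g (P : A.primes) (_ : P ∈ T) => A.factorization g P),
          ∏ x ∈ T.attach, w x.1 (p x.1 x.2) := by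
        rw [Finset.sum_image]
        intro g hgs h hhs heq
        apply A.factorization.injective
        ext P
        by_cases hP : P ∈ T
        · exact congrFun (congrFun heq P) hP
        · rw [Finsupp.notMem_support_iff.1 fun h1 => hP (hTs g hgs h1),
            Finsupp.notMem_support_iff.1 fun h1 => hP (hTs h hhs h1)]
    _ ≤ ∑ p ∈ T.pi fun _ => Finset.range (N + 1), ∏ x ∈ T.attach, w x.1 (p x.1 x.2) := by
        refine Finset.sum_le_sum_of_subset_of_nonneg ?_
          fun _ _ _ => Finset.prod_nonneg fun _ _ => hw0 _ _
        intro p hp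
        obtain ⟨g, hgs, rfl⟩ := Finset.mem_image.1 hp
        refine Finset.mem_pi.2 fun P hP => Finset.mem_range.2 (Nat.lt_succ_of_le ?_)
        exact (Finset.le_sup (f := A.factorization g) hP).trans
          (Finset.le_sup (f := fun g => T.sup (A.factorization g)) hgs)
    _ = ∏ P ∈ T, ∑ j ∈ Finset.range (N + 1), w P j := by rw [Finset.prod_sum]
    _ ≤ ∏ P ∈ T, (1 + f P * y ^ A.deg (P : G) * (1 - y)⁻¹) :=
        Finset.prod_le_prod (fun P _ => Finset.sum_nonneg fun _ _ => hw0 _ _) fun P _ => hsum P N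
    _ ≤ Real.exp (∑ P ∈ T, f P * y ^ A.deg (P : G) * (1 - y)⁻¹) :=
        Real.prod_one_add_le_exp_sum T fun P => by have := hf0 P; positivity
    _ ≤ _ := by
        refine Real.exp_le_exp.2 ((hf.mul_right _).sum_le_tsum _ fun P _ => ?_)
        have := hf0 P
        positivity

/-- The local factor `(1 - ‖P‖⁻¹)⁻¹` of `‖g‖ / φ(g)`. -/
noncomputable def localFactor (q : ℝ) (P : A.primes) : ℝ := (1 - q⁻¹ ^ A.deg (P : G))⁻¹

/-- The function `‖g‖ / φ(g) = ∏_{P ∣ g} (1 - ‖P‖⁻¹)⁻¹`. -/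
noncomputable def normDivTotient (q : ℝ) (g : G) : ℝ :=
  ∏ P ∈ (A.factorization g).support, A.localFactor q P

theorem inv_totient (q : ℝ) (g : G) :
    (A.totient q g)⁻¹ = A.normDivTotient q g * q⁻¹ ^ A.deg g := by
  rw [totient, mul_inv, nrm, primeFactors_eq, Finset.prod_map, normDivTotient,
    ← Finset.prod_inv_distrib, inv_pow, mul_comm]
  congr 1
  refine Finset.prod_congr rfl fun P _ => ?_
  rw [localFactor, nrm, inv_pow, one_div]
  rfl

theorem localFactor_bounds (hq : 1 < q) (P : A.primes) :
    1 ≤ A.localFactor q P ∧ A.localFactor q P ≤ (1 - q⁻¹)⁻¹ ∧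
      A.localFactor q P - 1 ≤ (1 - q⁻¹)⁻¹ * q⁻¹ ^ A.deg (P : G) := by
  have hq1 : q⁻¹ < 1 := inv_lt_one_of_one_lt₀ hq
  have hq0 : 0 ≤ q⁻¹ := by positivity
  set x := q⁻¹ ^ A.deg (P : G) with hx
  have hx0 : 0 ≤ x := by positivity
  have hxq : x ≤ q⁻¹ := pow_le_of_le_one hq0 hq1.le (A.deg_pos P P.2).ne'
  have h1 : 0 < 1 - x := by linarith
  have h2 : (1 - x)⁻¹ ≤ (1 - q⁻¹)⁻¹ := inv_anti₀ (by linarith) (by linarith)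
  have hloc : A.localFactor q P = (1 - x)⁻¹ := rfl
  rw [hloc]
  refine ⟨(one_le_inv₀ h1).2 (by linarith), h2, ?_⟩
  have h3 : (1 - x)⁻¹ - 1 = (1 - x)⁻¹ * x := by field_simp; ring
  rw [h3]
  gcongr

theorem normDivTotient_squarefree_add (J : Finset A.primes) (k : G) [DecidableEq A.primes] :
    A.normDivTotient q (A.squarefreeElem J + k) = A.normDivTotient q k *
      ∏ P ∈ J, if P ∈ (A.factorization k).support then 1 else A.localFactor q P := by
  rw [normDivTotient, support_factorization_add, support_squarefreeElem, normDivTotient,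
    Finset.prod_ite, Finset.prod_const_one, one_mul, ← Finset.sdiff_eq_filter,
    ← Finset.prod_union Finset.disjoint_sdiff, Finset.union_sdiff_self_eq_union,
    Finset.union_comm]

/-- The sum `∑_{h ∣ r} μ(h) ‖h + k‖ / φ(h + k)` is a product over the prime factors of `r`, in
which the factors from the prime factors of `k` vanish. -/
theorem norm_sum_moebius_normDivTotient_le (hq : 1 < q) (r k : G) :
    ‖∑ p ∈ A.decompositions r, A.moebius p.1 * (A.normDivTotient q (p.1 + k) : ℂ)‖ ≤
      A.normDivTotient q k *
        ∏ P ∈ (A.factorization r).support, (A.localFactor q P - 1) := by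
  classical
  rw [A.sum_decompositions_moebius r fun h => (A.normDivTotient q (h + k) : ℂ)]
  set v : A.primes → ℝ := fun P =>
    if P ∈ (A.factorization k).support then 1 else A.localFactor q P with hv
  have h1 : ∑ J ∈ (A.factorization r).support.powerset, (-1) ^ J.card *
      (A.normDivTotient q (A.squarefreeElem J + k) : ℂ) =
      ((A.normDivTotient q k * ∏ P ∈ (A.factorization r).support, (1 - v P) : ℝ) : ℂ) := by
    simp only [sub_eq_add_neg, Finset.prod_one_add]
    rw [Finset.mul_sum, Complex.ofReal_sum]
    refine Finset.sum_congr rfl fun J _ => ?_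
    rw [normDivTotient_squarefree_add, Finset.prod_neg]
    push_cast
    ring
  have hpos : 0 ≤ A.normDivTotient q k := Finset.prod_nonneg fun P _ =>
    zero_le_one.trans (A.localFactor_bounds hq P).1
  rw [h1, Complex.norm_real, norm_mul, Real.norm_of_nonneg hpos, norm_prod]
  refine mul_le_mul_of_nonneg_left (Finset.prod_le_prod (fun _ _ => norm_nonneg _) fun P _ => ?_)
    hpos
  have := (A.localFactor_bounds hq P).1
  simp only [hv]
  split_ifs
  · rw [sub_self, norm_zero]
    linarith
  · rw [Real.norm_eq_abs, abs_sub_comm, abs_of_nonneg (by linarith)]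

/-- The function `1 * (‖·‖ / φ) (μ * a)`, which turns the weight `1 / φ` into `1 / ‖·‖`. -/
noncomputable def totientTwist (q : ℝ) (a : G → ℂ) : G → ℂ :=
  A.conv (fun _ => 1) fun g => (A.normDivTotient q g : ℂ) * A.conv A.moebius a g

theorem norm_totientTwist_le (hq : 1 < q) (a : G → ℂ) (g : G) :
    ‖A.totientTwist q a g‖ ≤ ∑ p ∈ A.decompositions g, (‖a p.1‖ * A.normDivTotient q p.1) *
      ∏ P ∈ (A.factorization p.2).support, (A.localFactor q P - 1) := by
  have h1 : A.totientTwist q a g = ∑ p ∈ A.decompositions g, a p.2 *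
      ∑ x ∈ A.decompositions p.1, A.moebius x.1 * (A.normDivTotient q (x.1 + p.2) : ℂ) := by
    have h2 := A.sum_decompositions_assoc
      (fun _ h k => (A.normDivTotient q (h + k) : ℂ) * (A.moebius h * a k)) g
    calc A.totientTwist q a g = ∑ p ∈ A.decompositions g, ∑ x ∈ A.decompositions p.2,
          (A.normDivTotient q (x.1 + x.2) : ℂ) * (A.moebius x.1 * a x.2) := by
          rw [totientTwist, conv]
          refine Finset.sum_congr rfl fun p _ => ?_
          rw [one_mul, conv, Finset.mul_sum]
          refine Finset.sum_congr rfl fun x hx => ?_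
          rw [A.mem_decompositions.1 hx]
      _ = _ := by
          rw [h2]
          refine Finset.sum_congr rfl fun p _ => ?_
          rw [A.sum_decompositions_swap
            (fun x y => (A.normDivTotient q (y + p.2) : ℂ) * (A.moebius y * a p.2)),
            Finset.mul_sum]
          refine Finset.sum_congr rfl fun x _ => ?_
          ring
  rw [h1, A.sum_decompositions_swap (fun x y => a y *
      ∑ x ∈ A.decompositions x, A.moebius x.1 * (A.normDivTotient q (x.1 + y) : ℂ))]
  refine (norm_sum_le _ _).trans (Finset.sum_le_sum fun p _ => ?_)
  rw [norm_mul, mul_assoc]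
  exact mul_le_mul_of_nonneg_left (A.norm_sum_moebius_normDivTotient_le hq p.2 p.1)
    (norm_nonneg _)

theorem summable_sum_decompositions {f g : G → ℝ}
    (h : Summable fun x : G × G => f x.1 * g x.2) :
    Summable fun n => ∑ p ∈ A.decompositions n, f p.1 * g p.2 := by
  let _ : Finset.HasAntidiagonal G := ⟨A.decompositions, A.mem_decompositions⟩
  exact summable_sum_mul_antidiagonal_of_summable_mul h

theorem normDivTotient_nonneg (hq : 1 < q) (g : G) : 0 ≤ A.normDivTotient q g :=
  Finset.prod_nonneg fun P _ => zero_le_one.trans (A.localFactor_bounds hq P).1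

theorem summable_normDivTotient_mul_pow (hA : A.AxiomASharp q) {y : ℝ} (hy0 : 0 ≤ y)
    (hy : q * y < 1) : Summable fun k => A.normDivTotient q k * y ^ A.deg k := by
  have hq := hA.1
  have hloc := fun P => A.localFactor_bounds hq P
  have hs : Summable fun P : A.primes => (1 - q⁻¹)⁻¹ * y ^ A.deg (P : G) :=
    ((A.summable_pow_deg hA hy0 hy).comp_injective Subtype.val_injective).mul_left _
  refine A.summable_prod_support_mul_pow (fun P => zero_le_one.trans (hloc P).1) hy0
    (lt_of_le_of_lt (le_mul_of_one_le_left hy0 hq.le) hy)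
    (Summable.of_nonneg_of_le (fun P => ?_) (fun P => ?_) hs)
  · exact mul_nonneg (zero_le_one.trans (hloc P).1) (pow_nonneg hy0 _)
  · exact mul_le_mul_of_nonneg_right (hloc P).2.1 (pow_nonneg hy0 _)

theorem summable_prod_localFactor_sub_one (hA : A.AxiomASharp q) :
    Summable fun r => (∏ P ∈ (A.factorization r).support, (A.localFactor q P - 1)) *
      q⁻¹ ^ A.deg r := by
  have hq := hA.1
  have hq0 : 0 < q := one_pos.trans hq
  have hqi0 : 0 ≤ q⁻¹ := inv_nonneg.2 hq0.le
  have hqi1 : q⁻¹ < 1 := inv_lt_one_of_one_lt₀ hq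
  have hloc := fun P => A.localFactor_bounds hq P
  have hqq : q * (q⁻¹ * q⁻¹) < 1 := by
    rw [← mul_assoc, mul_inv_cancel₀ hq0.ne', one_mul]
    exact hqi1
  have hs : Summable fun P : A.primes => (1 - q⁻¹)⁻¹ * (q⁻¹ * q⁻¹) ^ A.deg (P : G) :=
    ((A.summable_pow_deg hA (mul_nonneg hqi0 hqi0) hqq).comp_injective
      Subtype.val_injective).mul_left _
  refine A.summable_prod_support_mul_pow (fun P => sub_nonneg.2 (hloc P).1) hqi0 hqi1
    (Summable.of_nonneg_of_le (fun P => ?_) (fun P => ?_) hs)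
  · exact mul_nonneg (sub_nonneg.2 (hloc P).1) (pow_nonneg hqi0 _)
  · rw [mul_pow, ← mul_assoc]
    exact mul_le_mul_of_nonneg_right (hloc P).2.2 (pow_nonneg hqi0 _)

theorem summable_totientTwist (hA : A.AxiomASharp q) {a : G → ℂ} {α C : ℝ} (hα : 0 < α)
    (ha : ∀ g, ‖a g‖ ≤ C * (A.nrm q g) ^ (-α)) :
    Summable fun g => ‖A.totientTwist q a g‖ * q⁻¹ ^ A.deg g := by
  have hq := hA.1
  have hq0 : 0 < q := one_pos.trans hq
  have hqi0 : 0 ≤ q⁻¹ := inv_nonneg.2 hq0.le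
  set z := q ^ (-α) with hz
  have hz0 : 0 < z := Real.rpow_pos_of_pos hq0 _
  have hzq : q * (z * q⁻¹) < 1 := by
    rw [mul_left_comm, mul_inv_cancel₀ hq0.ne', mul_one]
    exact Real.rpow_lt_one_of_one_lt_of_neg hq (by linarith)
  have hψ0 := A.normDivTotient_nonneg hq
  have hs := (A.summable_normDivTotient_mul_pow hA (mul_nonneg hz0.le hqi0) hzq).mul_left C
  have h1 : Summable fun k => (‖a k‖ * A.normDivTotient q k) * q⁻¹ ^ A.deg k := by
    refine Summable.of_nonneg_of_le (fun k => ?_) (fun k => ?_) hs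
    · exact mul_nonneg (mul_nonneg (norm_nonneg _) (hψ0 k)) (pow_nonneg hqi0 _)
    · have h3 : A.nrm q k ^ (-α) = z ^ A.deg k := by
        rw [nrm, hz, ← Real.rpow_natCast, ← Real.rpow_natCast, ← Real.rpow_mul hq0.le,
          ← Real.rpow_mul hq0.le, mul_comm]
      have h4 := ha k
      rw [h3] at h4
      calc ‖a k‖ * A.normDivTotient q k * q⁻¹ ^ A.deg k
          ≤ (C * z ^ A.deg k) * A.normDivTotient q k * q⁻¹ ^ A.deg k :=
            mul_le_mul_of_nonneg_right (mul_le_mul_of_nonneg_right h4 (hψ0 k))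
              (pow_nonneg hqi0 _)
        _ = _ := by rw [mul_pow]; ring
  have h6 := A.summable_sum_decompositions
    (f := fun k => (‖a k‖ * A.normDivTotient q k) * q⁻¹ ^ A.deg k)
    (g := fun r => (∏ P ∈ (A.factorization r).support, (A.localFactor q P - 1)) *
      q⁻¹ ^ A.deg r) (h1.mul_of_nonneg (A.summable_prod_localFactor_sub_one hA)
    (fun k => mul_nonneg (mul_nonneg (norm_nonneg _) (hψ0 k)) (pow_nonneg hqi0 _))
    (fun r => mul_nonneg (Finset.prod_nonneg fun P _ =>
      sub_nonneg.2 (A.localFactor_bounds hq P).1) (pow_nonneg hqi0 _)))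
  refine Summable.of_nonneg_of_le (fun g => mul_nonneg (norm_nonneg _) (pow_nonneg hqi0 _))
    (fun g => ?_) h6
  refine (mul_le_mul_of_nonneg_right (A.norm_totientTwist_le hq a g)
    (pow_nonneg hqi0 _)).trans (le_of_eq ?_)
  rw [Finset.sum_mul]
  refine Finset.sum_congr rfl fun p hp => ?_
  have h7 : A.deg g = A.deg p.1 + A.deg p.2 := by
    rw [← map_add, A.mem_decompositions.1 hp]
  rw [h7, pow_add]
  ring

theorem decompositions_zero : A.decompositions 0 = {(0, 0)} := by
  ext ⟨h, k⟩
  rw [mem_decompositions, Finset.mem_singleton, Prod.mk.injEq]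
  constructor
  · intro h0
    have h1 : A.deg h + A.deg k = 0 := by rw [← map_add, h0, map_zero]
    exact ⟨A.eq_zero_of_deg_eq_zero (by omega), A.eq_zero_of_deg_eq_zero (by omega)⟩
  · rintro ⟨rfl, rfl⟩
    exact add_zero 0

theorem totientTwist_zero {a : G → ℂ} (ha : a 0 = 1) : A.totientTwist q a 0 = 1 := by
  have hμ : A.moebius 0 = 1 := by
    have := A.moebius_squarefreeElem ∅
    simpa [squarefreeElem] using this
  simp [totientTwist, conv, decompositions_zero, normDivTotient, ha, hμ]

end AdditiveArithSemigroup

open Classical in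
theorem corollary1p5 {G : Type u} [AddCommMonoid G] (A : AdditiveArithSemigroup G)
    (q : ℝ) (hA : A.AxiomASharp q) (hZ : A.ZetaNeZero q)
    (S : Set G) (hS : S ⊆ A.primes) (δ : ℝ) (hδ : A.HasNaturalDensity S δ)
    (a : G → ℂ) (ha_supp : ∀ g, g ∉ A.distinguishedSet S → a g = 0) (ha_one : a 0 = 1)
    (ha_bound : ∃ α : ℝ, 0 < α ∧ ∃ C : ℝ, ∀ g, ‖a g‖ ≤ C * (A.nrm q g) ^ (-α)) :
    Tendsto
      (fun n : ℕ =>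
        -∑ g ∈ A.elemsLE n with 1 ≤ A.deg g ∧ g ∈ A.distinguishedSet S,
          A.conv A.moebius a g / (A.totient q g : ℂ))
      atTop (𝓝 (δ : ℂ)) := by
  obtain ⟨α, hα, C, hC⟩ := ha_bound
  have h := (A.tendsto_sum_conv_moebius hA hZ hS hδ (A.totientTwist_zero ha_one)
    (A.summable_totientTwist hA hα hC)).neg
  rw [neg_neg] at h
  refine h.congr fun n => ?_
  congr 1
  refine Finset.sum_congr rfl fun g _ => ?_
  have h1 : (A.totient q g : ℂ)⁻¹ = (A.normDivTotient q g : ℂ) * (q : ℂ)⁻¹ ^ A.deg g := by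
    rw [← Complex.ofReal_inv, A.inv_totient]
    push_cast
    rfl
  rw [AdditiveArithSemigroup.totientTwist, A.conv_moebius_conv_one, div_eq_mul_inv, h1]
  ring
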